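/- **Setting.** Let $(X,T,S(0),S(1),Y(0),Y(1),R)$ have distribution $\mathbb P$, where $T,R\in\{0,1\}$, $Y(t)\in\mathbb R$, and $X$, $S(t)$ take values in standard Borel spaces (e.g. Euclidean spaces); put $S=S(T)$, $Y=Y(T)$. The distribution is specified by $\mathbb P(R=1)\in[0,1]$ and the conditional distributions given $R=1$ and given $R=0$; $\mathbb P(R=1)=0$ is allowed, the conditional distribution given $R=1$ being part of the data. Let $\delta^*=\mathbb E[Y(1)]-\mathbb E[Y(0)]$, $e^*(X)=\mathbb P(T=1\mid X)$, $e^*(1,X)=\mathbb P(T=1\mid R=1,X)$, $\tilde\mu^*(t,X,S)=\mathbb E[Y\mid T=t,R=1,X,S]$, and, as Radon–Nikodym derivatives, $$\lambda^*(X)=\frac{f^*(X)}{f^*(X\mid R=1)},\qquad \lambda^*_t(S,X)=\frac{f^*(S\mid X,T=t)}{f^*(S\mid X,T=t,R=1)}\quad(t=0,1).$$ **Assumptions.** Fix $\varepsilon\in(0,1/2)$ and $C>0$. For $t=0,1$: $\mathbb E|Y(t)|<\infty$; $(Y(t),S(t))\perp T\mid X$; $R\perp Y(t)\mid (X,T=t,S(t))$,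 meaning that the conditional distribution of $Y(t)$ given $(X,T=t,S(t))$ is unchanged by further conditioning on $R=1$; $\varepsilon\le e^*(X)\le 1-\varepsilon$ a.s.; $0<e^*(1,X)<1$ a.s.; and $\lambda^*(X)$, $\lambda_t^*(S,X)$ are well defined (the measures in the numerators are absolutely continuous with respect to those in the denominators) and a.s. at most $C$. Neither $R\perp S(t)\mid T,X$ nor $R\perp T\mid X$ is assumed. Put $$\tilde\psi'=\frac{T\lambda^*(X)\lambda_1^*(S,X)}{e^*(1,X)}\bigl(Y-\tilde\mu^*(1,X,S)\bigr)-\frac{(1-T)\lambda^*(X)\lambda_0^*(S,X)}{1-e^*(1,X)}\bigl(Y-\tilde\mu^*(0,X,S)\bigr),$$ and assume $\mathbb E[\tilde\psi'^2\mid R=1]<\infty$. **Model.** One observes i.i.d. draws from the distribution of $(X,T,S,Y)$ given $R=1$, and the unconditional distribution of $(X,T,S)$ is known: the model consists of all distributions that satisfy the assumptions (with the same $\varepsilon,C$, and without the condition on $\tilde\psi'$) and have this known law of $(X,T,S)$. A regular submodel is a path $\gamma\mapsto\mathbb P_\gamma$ of such distributions, $\gamma$ near $0$, with $\mathbb P_0=\mathbb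 P$, along which the following is bounded near $\gamma=0$: the second moment, given $R=1$ under $\mathbb P_\gamma$, of the function obtained from $\tilde\psi'$ by using the density ratios and the labelled propensity score of $\mathbb P_\gamma$ and keeping $\tilde\mu^*$. Its score $g$, if it exists, is the square-integrable derivative at $\gamma=0$ in quadratic mean of the law of $(X,T,S,Y)$ given $R=1$. **Theorem.** $\tilde\psi'$ is the efficient influence function for $\delta^*$: along every regular submodel with a score $g$, the average treatment effect $\delta(\mathbb P_\gamma)$ is differentiable at $\gamma=0$ with derivative $\mathbb E[\tilde\psi' g\mid R=1]$, and $\tilde\psi'$ lies in the closed linear span in $L^2$ of all such scores. The efficiency lower bound for $\delta^*$, i.e. the supremum of the Cramér–Rao bounds $(\tfrac{d}{d\gamma}\delta(\mathbb P_\gamma)|_{\gamma=0})^2/\mathbb E[g^2\mid R=1]$ over all regular submodels with a score, is $$\tilde V'^*=\mathbb E[\tilde\psi'^2\mid R=1].$$ -/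

import Mathlib

open MeasureTheory ProbabilityTheory Filter Topology
open scoped ENNReal NNReal

noncomputable section

/-! ### Semiparametric efficiency for a model indexed by `Θ`

`obs θ` is the law of one observation under `θ`, `χ θ` is the real target parameter, and a
one-dimensional submodel is a path `ℝ → Θ`.  `Γ` is the collection of regular parametric submodels
through the truth that are contained in the model; the truth is the value of the path at `0`. -/

namespace Efficiency

variable {Θ W : Type*} [MeasurableSpace W]

/-- The path of laws `Q` is differentiable in quadratic mean at `0` with score `g`:
`g ∈ L²(Q 0)` and `∫ ((√q_γ - √q_0) / γ - g √q_0 / 2)² → 0` as `γ → 0`.  The densities of `Q γ` and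
`Q 0` are taken with respect to `Q γ + Q 0`; the integral does not depend on the dominating
measure. -/
def HasScore (Q : ℝ → Measure W) (g : W → ℝ) : Prop :=
  MemLp g 2 (Q 0) ∧
  Tendsto (fun γ : ℝ =>
      ∫⁻ w, ENNReal.ofReal
        (((√(((Q γ).rnDeriv (Q γ + Q 0) w).toReal) - √(((Q 0).rnDeriv (Q γ + Q 0) w).toReal)) / γ
          - g w * √(((Q 0).rnDeriv (Q γ + Q 0) w).toReal) / 2) ^ 2) ∂(Q γ + Q 0))
    (𝓝[≠] 0) (𝓝 0)

/-- The tangent set: all scores of the submodels in `Γ`. -/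
def tangentSet (obs : Θ → Measure W) (Γ : Set (ℝ → Θ)) : Set (W → ℝ) :=
  {g | ∃ path ∈ Γ, HasScore (fun γ => obs (path γ)) g}

/-- `ψ` is an influence function (a gradient) of `χ` at `θ₀`: it is square integrable, and along
every submodel that has a score `g` the parameter is differentiable with derivative `E[ψ g]`. -/
def IsInfluenceFunction (obs : Θ → Measure W) (χ : Θ → ℝ) (θ₀ : Θ) (Γ : Set (ℝ → Θ))
    (ψ : W → ℝ) : Prop :=
  MemLp ψ 2 (obs θ₀) ∧
  ∀ path ∈ Γ, ∀ g : W → ℝ, HasScore (fun γ => obs (path γ)) g →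
    HasDerivAt (fun γ => χ (path γ)) (∫ w, ψ w * g w ∂(obs θ₀)) 0

/-- The efficient influence function: the influence function that lies in the tangent space, the
closed linear span in `L²` of the tangent set. -/
def IsEfficientInfluenceFunction (obs : Θ → Measure W) (χ : Θ → ℝ) (θ₀ : Θ) (Γ : Set (ℝ → Θ))
    (ψ : W → ℝ) : Prop :=
  IsInfluenceFunction obs χ θ₀ Γ ψ ∧
  ∀ η : ℝ≥0∞, 0 < η → ∃ h ∈ Submodule.span ℝ (tangentSet obs Γ),
    eLpNorm (fun w => ψ w - h w) 2 (obs θ₀) < η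

/-- The efficiency lower bound: the supremum, over the submodels in `Γ`, of the Cramér-Rao bound
`(dχ/dγ)² / E[g²]` (in `[0, ∞]`, with `0 / 0 = 0` and `a / 0 = ∞` for `a > 0`). -/
def efficiencyLowerBound (obs : Θ → Measure W) (χ : Θ → ℝ) (θ₀ : Θ) (Γ : Set (ℝ → Θ)) : ℝ≥0∞ :=
  ⨆ (path : ℝ → Θ) (_ : path ∈ Γ) (g : W → ℝ) (_ : HasScore (fun γ => obs (path γ)) g)
    (d : ℝ) (_ : HasDerivAt (fun γ => χ (path γ)) d 0),
    ENNReal.ofReal (d ^ 2) / ENNReal.ofReal (∫ w, g w ^ 2 ∂(obs θ₀))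

end Efficiency

/-! ### Populations with surrogates, potential outcomes and partially observed outcomes -/

namespace Surrogate

/-- The complete data `(X, T, (S(0), S(1)), (Y(0), Y(1)))` of a unit, without the labelling
indicator; `true` is the treatment `1` and `false` is the treatment `0`. -/
abbrev FullData (𝒳 𝒮 : Type*) := 𝒳 × Bool × (Bool → 𝒮) × (Bool → ℝ)

/-- The observation `(X, T, S, Y)` on a labelled unit. -/
abbrev Obs (𝒳 𝒮 : Type*) := 𝒳 × Bool × 𝒮 × ℝ

variable {𝒳 𝒮 : Type*}

/-- The covariates `X`. -/
def cov (v : FullData 𝒳 𝒮) : 𝒳 := v.1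

/-- The treatment `T`. -/
def trt (v : FullData 𝒳 𝒮) : Bool := v.2.1

/-- The potential surrogate `S(t)`. -/
def surr (t : Bool) (v : FullData 𝒳 𝒮) : 𝒮 := v.2.2.1 t

/-- The potential outcome `Y(t)`. -/
def out (t : Bool) (v : FullData 𝒳 𝒮) : ℝ := v.2.2.2 t

/-- The actual surrogate `S = S(T)`. -/
def surrObs (v : FullData 𝒳 𝒮) : 𝒮 := surr (trt v) v

/-- The actual outcome `Y = Y(T)`. -/
def outObs (v : FullData 𝒳 𝒮) : ℝ := out (trt v) v

/-- `(X, T, S)`. -/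
def covTrtSurr (v : FullData 𝒳 𝒮) : 𝒳 × Bool × 𝒮 := (cov v, trt v, surrObs v)

/-- `(X, T, S, Y)`. -/
def observe (v : FullData 𝒳 𝒮) : Obs 𝒳 𝒮 := (cov v, trt v, surrObs v, outObs v)

/-- The event `T = t`. -/
def arm (t : Bool) : Set (FullData 𝒳 𝒮) := {v | trt v = t}

variable [MeasurableSpace 𝒳] [MeasurableSpace 𝒮]

lemma measurable_cov : Measurable (cov : FullData 𝒳 𝒮 → 𝒳) := measurable_fst

/-- A distribution of `(X, T, S(0), S(1), Y(0), Y(1), R)`, given by `P(R = 1)` and by the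
conditional distributions of the other variables given `R = 1` and given `R = 0`.  The conditional
distribution given `R = 1` is part of the data, so that `P(R = 1) = 0` (unlabelled data of
a larger order than labelled data) is allowed. -/
structure Population (𝒳 𝒮 : Type*) [MeasurableSpace 𝒳] [MeasurableSpace 𝒮] where
  /-- `P(R = 1)` -/
  rate : ℝ≥0
  rate_le_one : rate ≤ 1
  /-- the distribution given `R = 1` -/
  labelled : Measure (FullData 𝒳 𝒮)
  /-- the distribution given `R = 0` -/
  unlabelled : Measure (FullData 𝒳 𝒮)
  isProb_labelled : IsProbabilityMeasure labelled
  isProb_unlabelled : IsProbabilityMeasure unlabelled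

namespace Population

instance (p : Population 𝒳 𝒮) : IsProbabilityMeasure p.labelled := p.isProb_labelled

instance (p : Population 𝒳 𝒮) : IsProbabilityMeasure p.unlabelled := p.isProb_unlabelled

/-- The unconditional distribution of `(X, T, S(0), S(1), Y(0), Y(1))`. -/
def law (p : Population 𝒳 𝒮) : Measure (FullData 𝒳 𝒮) :=
  p.rate • p.labelled + (1 - p.rate) • p.unlabelled

instance (p : Population 𝒳 𝒮) : IsProbabilityMeasure p.law := by
  refine ⟨?_⟩
  have h : (p.rate : ℝ≥0∞) + ((1 - p.rate : ℝ≥0) : ℝ≥0∞) = 1 := by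
    rw [← ENNReal.coe_add, add_tsub_cancel_of_le p.rate_le_one, ENNReal.coe_one]
  rw [law, Measure.add_apply, Measure.smul_apply, Measure.smul_apply, measure_univ, measure_univ,
    ENNReal.smul_def, ENNReal.smul_def, smul_eq_mul, smul_eq_mul, mul_one, mul_one, h]

/-- The law of one observation `(X, T, S, Y)` given `R = 1`. -/
def obsLaw (p : Population 𝒳 𝒮) : Measure (Obs 𝒳 𝒮) := p.labelled.map observe

/-- The unconditional law of `(X, T, S)`. -/
def covTrtSurrLaw (p : Population 𝒳 𝒮) : Measure (𝒳 × Bool × 𝒮) := p.law.map covTrtSurr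

/-- The average treatment effect `E[Y(1)] - E[Y(0)]`. -/
def ate (p : Population 𝒳 𝒮) : ℝ := (∫ v, out true v ∂p.law) - ∫ v, out false v ∂p.law

/-- The propensity score `e(x) = P(T = 1 | X = x)`. -/
def propensity (p : Population 𝒳 𝒮) (x : 𝒳) : ℝ := (condDistrib trt cov p.law x).real {true}

/-- The labelled propensity score `e(1, x) = P(T = 1 | R = 1, X = x)`. -/
def propensityLabelled (p : Population 𝒳 𝒮) (x : 𝒳) : ℝ :=
  (condDistrib trt cov p.labelled x).real {true}

/-- The density ratio `λ(x) = f(x) / f(x | R = 1)`. -/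
def ratioCov (p : Population 𝒳 𝒮) (x : 𝒳) : ℝ :=
  ((p.law.map cov).rnDeriv (p.labelled.map cov) x).toReal

variable [StandardBorelSpace 𝒮] [Nonempty 𝒮]

/-- The conditional distribution of `S` given `X = x, T = t`. -/
def surrKernel (p : Population 𝒳 𝒮) (t : Bool) : Kernel 𝒳 𝒮 :=
  condDistrib surrObs cov (ProbabilityTheory.cond p.law (arm t))

/-- The conditional distribution of `S` given `X = x, T = t, R = 1`. -/
def surrKernelLabelled (p : Population 𝒳 𝒮) (t : Bool) : Kernel 𝒳 𝒮 :=
  condDistrib surrObs cov (ProbabilityTheory.cond p.labelled (arm t))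

/-- The density ratio `λ_t(s, x) = f(s | x, T = t) / f(s | x, T = t, R = 1)`. -/
def ratioSurr (p : Population 𝒳 𝒮) (t : Bool) (s : 𝒮) (x : 𝒳) : ℝ :=
  (Kernel.rnDeriv (p.surrKernel t) (p.surrKernelLabelled t) x s).toReal

/-- The regression function `μ̃(t, x, s) = E[Y | T = t, R = 1, X = x, S = s]`. -/
def outcomeReg (p : Population 𝒳 𝒮) (t : Bool) (x : 𝒳) (s : 𝒮) : ℝ :=
  ∫ y, y ∂(condDistrib outObs covTrtSurr p.labelled (x, t, s))

/-- The weighted residual with propensity and density ratios from `p` and regression function from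
`p₀`. -/
def weightedResidual (p p₀ : Population 𝒳 𝒮) : Obs 𝒳 𝒮 → ℝ := fun ⟨x, t, s, y⟩ =>
  (if t then 1 else 0) * p.ratioCov x * p.ratioSurr true s x / p.propensityLabelled x
      * (y - p₀.outcomeReg true x s)
    - (1 - if t then 1 else 0) * p.ratioCov x * p.ratioSurr false s x
        / (1 - p.propensityLabelled x)
      * (y - p₀.outcomeReg false x s)

/-- The function `ψ̃'`. -/
def psi (p : Population 𝒳 𝒮) : Obs 𝒳 𝒮 → ℝ := p.weightedResidual p

/-- The assumptions on a population, with constants `ε` and `C`. -/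
structure Admissible [StandardBorelSpace 𝒳] (ε C : ℝ) (p : Population 𝒳 𝒮) : Prop where
  /-- `E[Y(t)]` exists -/
  integrable_out : ∀ t, Integrable (out t) p.law
  /-- `(Y(t), S(t)) ⊥ T | X` -/
  unconfounded_trt : ∀ t, CondIndepFun (MeasurableSpace.comap cov inferInstance)
    measurable_cov.comap_le (fun v => (out t v, surr t v)) trt p.law
  /-- `R ⊥ Y(t) | X, T = t, S(t)`: some version of the conditional distribution of `Y(t)` given
  `X, T = t, S(t)` is also one given `X, T = t, S(t), R = 1`. -/
  missing_at_random : ∀ t, ∃ κ : Kernel (𝒳 × 𝒮) ℝ, IsMarkovKernel κ ∧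
    HasCondDistrib (out t) (fun v => (cov v, surr t v)) κ
      (ProbabilityTheory.cond p.law (arm t)) ∧
    HasCondDistrib (out t) (fun v => (cov v, surr t v)) κ
      (ProbabilityTheory.cond p.labelled (arm t))
  /-- `ε ≤ e(X) ≤ 1 - ε` almost surely -/
  overlap : ∀ᵐ x ∂(p.law.map cov), ε ≤ p.propensity x ∧ p.propensity x ≤ 1 - ε
  /-- `λ(X)` is well defined and at most `C` almost surely -/
  ratioCov_ac : p.law.map cov ≪ p.labelled.map cov
  ratioCov_le : ∀ᵐ x ∂(p.law.map cov), p.ratioCov x ≤ C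
  /-- `0 < e(1, X) < 1` almost surely, so that conditioning on `X, T = t, R = 1` makes sense -/
  overlap_labelled : ∀ᵐ x ∂(p.law.map cov),
    0 < p.propensityLabelled x ∧ p.propensityLabelled x < 1
  /-- `λ_t(S, X)` is well defined and at most `C` almost surely -/
  ratioSurr_ac : ∀ t, ∀ᵐ x ∂(p.law.map cov), p.surrKernel t x ≪ p.surrKernelLabelled t x
  ratioSurr_le : ∀ t, ∀ᵐ x ∂(p.law.map cov), ∀ᵐ s ∂(p.surrKernel t x), p.ratioSurr t s x ≤ C

/-- The model: all admissible populations with the given, known law `ν` of `(X, T, S)`. -/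
def model [StandardBorelSpace 𝒳] (ε C : ℝ) (ν : Measure (𝒳 × Bool × 𝒮)) :
    Set (Population 𝒳 𝒮) :=
  {p | p.Admissible ε C ∧ p.covTrtSurrLaw = ν}

/-- The regular submodels through `p₀`: paths of populations that are at `p₀` for the parameter
value `0`, stay in the model near `0`, and have a second moment of the weighted residual
that is bounded near `0` (the usual local moment condition under which an expectation can be
differentiated along the path). -/
def regularSubmodels (M : Set (Population 𝒳 𝒮)) (p₀ : Population 𝒳 𝒮) :
    Set (ℝ → Population 𝒳 𝒮) :=
  {path | path 0 = p₀ ∧ (∀ᶠ γ in 𝓝 (0 : ℝ), path γ ∈ M) ∧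
    ∃ B : ℝ≥0, ∀ᶠ γ in 𝓝 (0 : ℝ),
      ∫⁻ w, ENNReal.ofReal ((path γ).weightedResidual p₀ w ^ 2) ∂(path γ).obsLaw ≤ B}

end Population

end Surrogate

end

/-! The known law of (X,T,S) fixes the law of X and the law of S given (X,T), hence, by
unconfoundedness and overlap, the law of (X,S(t)). Only the law of Y(t) given (X,S(t)) is free, and
since labels are missing at random it is the labelled law of Y given (X,T=t,S). The weight λ λ_t /
P(T=t | R=1,X) therefore turns the labelled law of (X,S,Y) in arm t into the law of (X,S(t),Y(t))
(`Admissible.withDensity_weight_out`).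

Influence function. For a member p' of the model, weighting the signed residual Y - μ̃* with the
weights of p' gives δ(p') - δ(p) exactly, with no remainder (`Admissible.ate_sub_ate`), because the
regression function of p has the same mean under both populations. What remains is to differentiate
∫ w_γ(π) r dQ_γ at 0, where π = (X,T,S), r is a fixed residual and w_0(π) r is centred given π. The
weights move with γ, but w_γ times the law of π under Q_γ is a fixed measure. So w_γ = w_0/θ_γ,
where θ_γ is the density of one law of π with respect to the other, away from a set where these laws
differ appreciably. On that set the squared Hellinger distance is o(γ²), which makes its mass o(γ²)
and, by Cauchy-Schwarz and the bounded second moments, its contribution o(γ). Elsewhere θ_γ is close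
to 1, and w_0 r/θ_γ is still centred given π, so moving weights add nothing to the derivative: it is
∫ w_0 r g (`HasScore.tendsto_integral_weighted_div`).

Efficiency. ψ̃' is centred given (X,T,S), hence an L² limit of bounded functions h with this
property (`exists_bounded_centred_approx`). Tilting the outcome kernel by 1 + γh, while keeping the
laws of (X,T,S) and drawing the counterfactual pair independently, gives a path inside the model
with score h (`Admissible.tiltPath_mem_regularSubmodels`, `hasScore_tiltPath`). So ψ̃' is in the
closure of the tangent set. Cauchy-Schwarz bounds every Cramér-Rao bound by E[ψ̃'² | R=1], and
scores close to ψ̃' approach this value (`IsInfluenceFunction.efficient_of_approx`). -/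

noncomputable section

namespace Efficiency

/-! ### Density ratios, Hellinger distance and Cauchy-Schwarz bounds. -/

section Analysis

variable {W V : Type*} [MeasurableSpace W] [MeasurableSpace V]

lemma rnDeriv_add_right_mul_eq_one (P Q : Measure W) [IsFiniteMeasure P] [IsFiniteMeasure Q] :
    ∀ᵐ w ∂P, P.rnDeriv (Q + P) w * (Q.rnDeriv P w + 1) = 1 := by
  have hac : P ≪ Q + P := Measure.absolutelyContinuous_of_le (Measure.le_add_left le_rfl)
  filter_upwards [Measure.rnDeriv_mul_rnDeriv (κ := P) hac, Measure.rnDeriv_add' Q P P,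
    Measure.rnDeriv_self P] with w h1 h2 h3
  simp only [Pi.mul_apply, Pi.add_apply] at h1 h2
  rw [h2, h3] at h1
  exact h1

lemma rnDeriv_add_right_add_eq_one (P Q : Measure W) [IsFiniteMeasure P] [IsFiniteMeasure Q] :
    ∀ᵐ w ∂(Q + P), Q.rnDeriv (Q + P) w + P.rnDeriv (Q + P) w = 1 := by
  filter_upwards [Measure.rnDeriv_add' Q P (Q + P), Measure.rnDeriv_self (Q + P)] with w h1 h2
  rw [h2] at h1
  exact h1.symm

/-- For f = dQ/dP, the densities of Q and P with respect to Q + P are f/(f+1) and 1/(f+1), and f + 1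
is the density of the absolutely continuous part of Q + P with respect to P. This is the pointwise
change of dominating measure. -/
lemma sq_sqrt_div_add_one (f γ g : ℝ) (hf : 0 ≤ f) :
    (f + 1) * ((√(f / (f + 1)) - √(1 / (f + 1))) / γ - g * √(1 / (f + 1)) / 2) ^ 2
      = ((√f - 1) / γ - g / 2) ^ 2 := by
  have h1 : 0 < f + 1 := by linarith
  rw [Real.sqrt_div hf, Real.sqrt_div zero_le_one, Real.sqrt_one]
  have h2 : √(f + 1) ≠ 0 := (Real.sqrt_pos.2 h1).ne'
  have h3 : (√f / √(f + 1) - 1 / √(f + 1)) / γ - g * (1 / √(f + 1)) / 2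
      = ((√f - 1) / γ - g / 2) / √(f + 1) := by
    field_simp
  rw [h3, div_pow, Real.sq_sqrt h1.le]
  field_simp

/-- The integral in the definition of differentiability in quadratic mean, written with the
Lebesgue decomposition of the perturbed measure with respect to the base measure. -/
lemma lintegral_sq_sqrt_rnDeriv (P Q : Measure W) [IsFiniteMeasure P] [IsFiniteMeasure Q]
    (g : W → ℝ) (γ : ℝ) :
    ∫⁻ w, ENNReal.ofReal
        (((√((Q.rnDeriv (Q + P) w).toReal) - √((P.rnDeriv (Q + P) w).toReal)) / γ
          - g w * √((P.rnDeriv (Q + P) w).toReal) / 2) ^ 2) ∂(Q + P)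
      = ∫⁻ w, ENNReal.ofReal (((√((Q.rnDeriv P w).toReal) - 1) / γ - g w / 2) ^ 2) ∂P
        + ENNReal.ofReal ((1 / γ) ^ 2) * Q.singularPart P Set.univ := by
  -- On the part singular to P the density of P vanishes and that of Q is 1, so the integrand there
  -- is the constant 1/γ².
  have hdec : Q + P = P.withDensity (fun w => Q.rnDeriv P w + 1) + Q.singularPart P := by
    have h1 : P.withDensity (fun w => Q.rnDeriv P w + 1)
        = P.withDensity (Q.rnDeriv P) + P.withDensity (fun _ => 1) :=
      withDensity_add_left (Measure.measurable_rnDeriv Q P) _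
    rw [h1]
    conv_lhs => rw [← Measure.rnDeriv_add_singularPart Q P]
    simp only [withDensity_const, one_smul]
    abel
  have hP : P ≪ Q + P := Measure.absolutelyContinuous_of_le (Measure.le_add_left le_rfl)
  have hs : Q.singularPart P ≪ Q + P := Measure.absolutelyContinuous_of_le
    ((Measure.singularPart_le Q P).trans (Measure.le_add_right le_rfl))
  have hb0 : ∀ᵐ w ∂(Q.singularPart P), P.rnDeriv (Q + P) w = 0 :=
    Measure.rnDeriv_eq_zero_of_mutuallySingular (Measure.mutuallySingular_singularPart Q P).symm hs
  have hab := rnDeriv_add_right_add_eq_one P Q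
  have hb1 := rnDeriv_add_right_mul_eq_one P Q
  have hfin : ∀ᵐ w ∂P, Q.rnDeriv P w < ∞ := Measure.rnDeriv_lt_top Q P
  have hsplit : ∀ H : W → ℝ≥0∞, ∫⁻ w, H w ∂(Q + P)
      = ∫⁻ w, (Q.rnDeriv P w + 1) * H w ∂P + ∫⁻ w, H w ∂(Q.singularPart P) := by
    intro H
    conv_lhs => rw [hdec]
    rw [lintegral_add_measure, lintegral_withDensity_eq_lintegral_mul_non_measurable]
    · rfl
    · exact (Measure.measurable_rnDeriv Q P).add_const 1
    · filter_upwards [hfin] with w hw using ENNReal.add_lt_top.2 ⟨hw, ENNReal.one_lt_top⟩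
  rw [hsplit]
  congr 1
  · refine lintegral_congr_ae ?_
    filter_upwards [hb1, hP.ae_le hab, hfin] with w h1 h2 h3
    set a := Q.rnDeriv (Q + P) w
    set b := P.rnDeriv (Q + P) w
    set F := Q.rnDeriv P w
    have hF1 : (F + 1).toReal = F.toReal + 1 := by
      rw [ENNReal.toReal_add h3.ne ENNReal.one_ne_top, ENNReal.toReal_one]
    have hpos : 0 < F.toReal + 1 := by positivity
    have hb : b.toReal = 1 / (F.toReal + 1) := by
      have := congrArg ENNReal.toReal h1
      rw [ENNReal.toReal_mul, hF1, ENNReal.toReal_one] at this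
      field_simp
      linarith
    have hle : a ≤ 1 ∧ b ≤ 1 := by
      constructor <;> rw [← h2]
      · exact le_self_add
      · exact le_add_self
    have ha : a.toReal = F.toReal / (F.toReal + 1) := by
      have := congrArg ENNReal.toReal h2
      rw [ENNReal.toReal_add (ne_top_of_le_ne_top ENNReal.one_ne_top hle.1)
        (ne_top_of_le_ne_top ENNReal.one_ne_top hle.2), ENNReal.toReal_one, hb] at this
      field_simp at this ⊢
      linarith
    rw [ha, hb, ← sq_sqrt_div_add_one _ γ (g w) ENNReal.toReal_nonneg,
      ENNReal.ofReal_mul hpos.le, ← hF1, ENNReal.ofReal_toReal]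
    exact (ENNReal.add_lt_top.2 ⟨h3, ENNReal.one_lt_top⟩).ne
  · rw [← lintegral_const]
    refine lintegral_congr_ae ?_
    filter_upwards [hb0, hs.ae_le hab] with w h1 h2
    rw [h1, add_zero] at h2
    rw [h1, h2]
    simp

lemma integral_abs_mul_le_sqrt_mul_sqrt {μ : Measure W} {f g : W → ℝ} (hf : MemLp f 2 μ)
    (hg : MemLp g 2 μ) :
    ∫ w, |f w * g w| ∂μ ≤ √(∫ w, f w ^ 2 ∂μ) * √(∫ w, g w ^ 2 ∂μ) := by
  have h2 : (2 : ℝ≥0∞) = ENNReal.ofReal 2 := by simp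
  have h := integral_mul_le_Lp_mul_Lq_of_nonneg (μ := μ) (p := 2) (q := 2)
    Real.HolderConjugate.two_two (f := fun w => |f w|) (g := fun w => |g w|)
    (ae_of_all _ fun _ => abs_nonneg _) (ae_of_all _ fun _ => abs_nonneg _)
    (by rw [← h2]; exact hf.norm) (by rw [← h2]; exact hg.norm)
  simp only [abs_mul, Real.sqrt_eq_rpow]
  simpa [sq_abs] using h

lemma abs_integral_mul_le_sqrt_mul_sqrt {μ : Measure W} {f g : W → ℝ} (hf : MemLp f 2 μ)
    (hg : MemLp g 2 μ) :
    |∫ w, f w * g w ∂μ| ≤ √(∫ w, f w ^ 2 ∂μ) * √(∫ w, g w ^ 2 ∂μ) :=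
  (abs_integral_le_integral_abs).trans (integral_abs_mul_le_sqrt_mul_sqrt hf hg)

lemma abs_setIntegral_le_sqrt_mul_sqrt {μ : Measure W} [IsFiniteMeasure μ] {f : W → ℝ}
    (hf : MemLp f 2 μ) (A : Set W) :
    |∫ w in A, f w ∂μ| ≤ √(∫ w, f w ^ 2 ∂μ) * √(μ.real A) := by
  have h := abs_integral_mul_le_sqrt_mul_sqrt (μ := μ.restrict A) (hf.restrict A)
    (memLp_const (1 : ℝ))
  simp only [mul_one, one_pow, integral_const, smul_eq_mul, measureReal_restrict_apply_univ] at h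
  refine h.trans (mul_le_mul_of_nonneg_right (Real.sqrt_le_sqrt ?_) (Real.sqrt_nonneg _))
  exact setIntegral_le_integral hf.integrable_sq (ae_of_all _ fun _ => sq_nonneg _)

/-- Young's inequality for the square root of a density ratio. -/
lemma le_add_sq_sqrt_sub_one {f η : ℝ} (hf : 0 ≤ f) (hη : 0 < η) :
    f ≤ (1 + η / 2) + (1 + 2 / η) * (√f - 1) ^ 2 := by
  have h : f = √f ^ 2 := (Real.sq_sqrt hf).symm
  have h2 : 0 ≤ (√(η / 2) - √(2 / η) * (√f - 1)) ^ 2 := sq_nonneg _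
  have h3 : √(η / 2) * √(2 / η) = 1 := by
    rw [← Real.sqrt_mul (by positivity)]
    rw [show η / 2 * (2 / η) = 1 by field_simp, Real.sqrt_one]
  have h4 : √(η / 2) ^ 2 = η / 2 := Real.sq_sqrt (by positivity)
  have h5 : √(2 / η) ^ 2 = 2 / η := Real.sq_sqrt (by positivity)
  rw [sub_sq, mul_pow, h4, h5] at h2
  have h6 : 2 * √(η / 2) * (√(2 / η) * (√f - 1)) = 2 * (√f - 1) := by
    rw [show 2 * √(η / 2) * (√(2 / η) * (√f - 1)) = 2 * (√(η / 2) * √(2 / η)) * (√f - 1) by ring,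
      h3, mul_one]
  rw [h6] at h2
  have h7 : f = 1 + 2 * (√f - 1) + (√f - 1) ^ 2 := by nlinarith
  linarith

/-- The companion inequality with the two measures exchanged: expand 1 = (√f - (√f - 1))² and apply
Young's inequality to the cross term. -/
lemma one_le_add_sq_sqrt_sub_one {f η : ℝ} (hf : 0 ≤ f) (hη : 0 < η) :
    1 ≤ (1 + η / 2) * f + (1 + 2 / η) * (√f - 1) ^ 2 := by
  have h2 : 0 ≤ (√(η / 2) * √f + √(2 / η) * (√f - 1)) ^ 2 := sq_nonneg _
  have h3 : √(η / 2) * √(2 / η) = 1 := by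
    rw [← Real.sqrt_mul (by positivity)]
    rw [show η / 2 * (2 / η) = 1 by field_simp, Real.sqrt_one]
  have h4 : √(η / 2) ^ 2 = η / 2 := Real.sq_sqrt (by positivity)
  have h5 : √(2 / η) ^ 2 = 2 / η := Real.sq_sqrt (by positivity)
  have h : √f ^ 2 = f := Real.sq_sqrt hf
  rw [add_sq, mul_pow, mul_pow, h4, h5, h] at h2
  have h6 : 2 * (√(η / 2) * √f) * (√(2 / η) * (√f - 1)) = 2 * √f * (√f - 1) := by
    rw [show 2 * (√(η / 2) * √f) * (√(2 / η) * (√f - 1))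
      = 2 * (√(η / 2) * √(2 / η)) * √f * (√f - 1) by ring, h3, mul_one]
  rw [h6] at h2
  nlinarith

lemma integrable_rnDeriv_toReal (P Q : Measure W) [IsFiniteMeasure P] [IsFiniteMeasure Q] :
    Integrable (fun w => (Q.rnDeriv P w).toReal) P :=
  Measure.integrable_toReal_rnDeriv

lemma memLp_sqrt_rnDeriv (P Q : Measure W) [IsFiniteMeasure P] [IsFiniteMeasure Q] :
    MemLp (fun w => √((Q.rnDeriv P w).toReal)) 2 P := by
  rw [memLp_two_iff_integrable_sq]
  · simpa [Real.sq_sqrt] using integrable_rnDeriv_toReal P Q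
  · exact (Measure.measurable_rnDeriv Q P).ennreal_toReal.sqrt.aestronglyMeasurable

lemma memLp_sqrt_rnDeriv_sub_one (P Q : Measure W) [IsFiniteMeasure P] [IsFiniteMeasure Q] :
    MemLp (fun w => √((Q.rnDeriv P w).toReal) - 1) 2 P :=
  (memLp_sqrt_rnDeriv P Q).sub (memLp_const 1)

lemma measureReal_eq_setIntegral_rnDeriv_add (P Q : Measure W) [IsFiniteMeasure P]
    [IsFiniteMeasure Q] (A : Set W) :
    Q.real A = ∫ w in A, (Q.rnDeriv P w).toReal ∂P + (Q.singularPart P).real A := by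
  rw [Measure.setIntegral_toReal_rnDeriv_eq_withDensity]
  conv_lhs => rw [← Measure.rnDeriv_add_singularPart Q P]
  rw [measureReal_add_apply]

/-- A set on which two measures differ by a factor bounded away from one has mass controlled by the
squared Hellinger distance. -/
lemma measureReal_le_hellinger (P Q : Measure W) [IsFiniteMeasure P] [IsFiniteMeasure Q]
    {A : Set W} {η : ℝ} (hη : 0 < η) (hη1 : η ≤ 1)
    (h : (1 + η) * P.real A ≤ Q.real A ∨ Q.real A ≤ (1 - η) * P.real A) :
    P.real A ≤ (1 + 2 / η) * (4 / η) * (∫ w in A, (√((Q.rnDeriv P w).toReal) - 1) ^ 2 ∂P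
        + (Q.singularPart P).real A) ∧
    Q.real A ≤ (1 + 2 / η) * (4 / η) * (∫ w in A, (√((Q.rnDeriv P w).toReal) - 1) ^ 2 ∂P
        + (Q.singularPart P).real A) := by
  have hQ := measureReal_eq_setIntegral_rnDeriv_add P Q A
  set D := ∫ w in A, (√((Q.rnDeriv P w).toReal) - 1) ^ 2 ∂P with hD
  set S := (Q.singularPart P).real A
  have hS : 0 ≤ S := measureReal_nonneg
  have hD0 : 0 ≤ D := integral_nonneg fun _ => sq_nonneg _
  have hi1 : Integrable (fun w => (√((Q.rnDeriv P w).toReal) - 1) ^ 2) (P.restrict A) :=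
    ((memLp_sqrt_rnDeriv_sub_one P Q).restrict A).integrable_sq
  have hi2 : Integrable (fun w => (Q.rnDeriv P w).toReal) (P.restrict A) :=
    (integrable_rnDeriv_toReal P Q).restrict
  have hPA : 0 ≤ P.real A := measureReal_nonneg
  have hQA : 0 ≤ Q.real A := measureReal_nonneg
  have hk : 0 < 1 + 2 / η := by positivity
  rcases h with h | h
  · have h1 : ∫ w in A, (Q.rnDeriv P w).toReal ∂P ≤ (1 + η / 2) * P.real A + (1 + 2 / η) * D := by
      calc _ ≤ ∫ w in A, ((1 + η / 2) + (1 + 2 / η) * (√((Q.rnDeriv P w).toReal) - 1) ^ 2) ∂P :=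
            integral_mono hi2 ((integrable_const _).add (hi1.const_mul _))
              fun w => le_add_sq_sqrt_sub_one ENNReal.toReal_nonneg hη
        _ = _ := by
            rw [integral_add (integrable_const _) (hi1.const_mul _), integral_const_mul,
              integral_const, measureReal_restrict_apply_univ, smul_eq_mul, mul_comm (P.real A)]
    have h2 : S ≤ (1 + 2 / η) * S := le_mul_of_one_le_left hS (by linarith [div_pos two_pos hη])
    -- Young's inequality costs η/2, only half of the gap η between Q and P on A; the other half is
    -- absorbed on the left.
    have h3 : Q.real A * (η / 2) ≤ (1 + η) * ((1 + 2 / η) * (D + S)) := by nlinarith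
    have h4 : Q.real A ≤ (1 + 2 / η) * (4 / η) * (D + S) := by
      have h5 : Q.real A * (η / 2) ≤ 2 * ((1 + 2 / η) * (D + S)) :=
        h3.trans (mul_le_mul_of_nonneg_right (by linarith) (by positivity))
      calc Q.real A = Q.real A * (η / 2) * (2 / η) := by field_simp
        _ ≤ 2 * ((1 + 2 / η) * (D + S)) * (2 / η) := by gcongr
        _ = _ := by ring
    exact ⟨le_trans (by nlinarith) h4, h4⟩
  · have h1 : P.real A ≤ (1 + η / 2) * ∫ w in A, (Q.rnDeriv P w).toReal ∂P + (1 + 2 / η) * D := by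
      calc P.real A = ∫ w in A, (1 : ℝ) ∂P := by simp
        _ ≤ ∫ w in A, ((1 + η / 2) * (Q.rnDeriv P w).toReal
              + (1 + 2 / η) * (√((Q.rnDeriv P w).toReal) - 1) ^ 2) ∂P :=
            integral_mono (integrable_const _) ((hi2.const_mul _).add (hi1.const_mul _))
              fun w => one_le_add_sq_sqrt_sub_one ENNReal.toReal_nonneg hη
        _ = _ := by
            rw [integral_add (hi2.const_mul _) (hi1.const_mul _), integral_const_mul,
              integral_const_mul]
    have h3 : P.real A * (η / 2) ≤ (1 + 2 / η) * (D + S) := by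
      have : (1 + η / 2) * ∫ w in A, (Q.rnDeriv P w).toReal ∂P
          ≤ (1 + η / 2) * ((1 - η) * P.real A) := by
        apply mul_le_mul_of_nonneg_left _ (by positivity)
        linarith
      nlinarith [mul_nonneg hk.le hS, mul_nonneg hPA (sq_nonneg η)]
    have h4 : P.real A ≤ (1 + 2 / η) * (4 / η) * (D + S) := by
      calc P.real A = P.real A * (η / 2) * (2 / η) := by field_simp
        _ ≤ ((1 + 2 / η) * (D + S)) * (2 / η) := by gcongr
        _ ≤ ((1 + 2 / η) * (D + S)) * (4 / η) := by gcongr; norm_num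
        _ = _ := by ring
    exact ⟨h4, le_trans (by nlinarith) h4⟩

/-- Away from two exceptional sets a finite measure has a density close to one with respect to
another one. -/
lemma exists_density_near_one (P Q : Measure V) [IsFiniteMeasure P] [IsFiniteMeasure Q]
    {η : ℝ} (hη : 0 < η) (hη1 : η < 1) :
    ∃ A B : Set V, ∃ θ : V → ℝ, MeasurableSet A ∧ MeasurableSet B ∧ Measurable θ ∧
      (1 + η) * P.real A ≤ Q.real A ∧ Q.real B ≤ (1 - η) * P.real B ∧
      (∀ v, 1 - η ≤ θ v ∧ θ v ≤ 1 + η) ∧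
      Q.restrict (A ∪ B)ᶜ = (P.restrict (A ∪ B)ᶜ).withDensity fun v => ENNReal.ofReal (θ v) := by
  obtain ⟨N, hN, hN1, hN2⟩ := Measure.mutuallySingular_singularPart Q P
  set F := Q.rnDeriv P
  have hF : Measurable F := Measure.measurable_rnDeriv Q P
  set A₀ : Set V := {v | ENNReal.ofReal (1 + η) < F v}
  set B₀ : Set V := {v | F v < ENNReal.ofReal (1 - η)}
  have hA₀ : MeasurableSet A₀ := measurableSet_lt measurable_const hF
  have hB₀ : MeasurableSet B₀ := measurableSet_lt hF measurable_const
  have hdec : ∀ E : Set V, MeasurableSet E →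
      Q E = ∫⁻ v in E, F v ∂P + Q.singularPart P E := by
    intro E hE
    conv_lhs => rw [← Measure.rnDeriv_add_singularPart Q P]
    rw [Measure.add_apply, withDensity_apply _ hE]
  -- `Nᶜ` is P-null and carries the singular part of Q: adding it to the set where Q is large, and
  -- removing it from the set where Q is small, preserves both inequalities.
  set A := A₀ ∪ Nᶜ
  set B := B₀ ∩ N
  have hA : MeasurableSet A := hA₀.union hN.compl
  have hB : MeasurableSet B := hB₀.inter hN
  have hoff : ∀ v ∈ (A ∪ B)ᶜ, v ∈ N ∧ F v ≤ ENNReal.ofReal (1 + η) ∧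
      ENNReal.ofReal (1 - η) ≤ F v := by
    intro v hv
    simp only [A, B, Set.mem_compl_iff, Set.mem_union, Set.mem_inter_iff, not_or, not_not,
      not_and] at hv
    obtain ⟨⟨h1, h2⟩, h3⟩ := hv
    exact ⟨h2, not_lt.1 h1, not_lt.1 fun h => h3 h h2⟩
  have hAB : MeasurableSet (A ∪ B)ᶜ := (hA.union hB).compl
  classical
  -- The default value 1 on the exceptional sets makes the bounds on θ hold everywhere.
  refine ⟨A, B, fun v => if v ∈ (A ∪ B)ᶜ then (F v).toReal else 1, hA, hB,
    Measurable.ite hAB hF.ennreal_toReal measurable_const, ?_, ?_, ?_, ?_⟩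
  · have h1 : ENNReal.ofReal (1 + η) * P A ≤ Q A := by
      calc ENNReal.ofReal (1 + η) * P A ≤ ENNReal.ofReal (1 + η) * P A₀ := by
            exact mul_le_mul' le_rfl ((measure_union_le _ _).trans (by rw [hN2, add_zero]))
        _ = ∫⁻ _ in A₀, ENNReal.ofReal (1 + η) ∂P := by rw [setLIntegral_const]
        _ ≤ ∫⁻ v in A₀, F v ∂P := setLIntegral_mono hF fun v hv => le_of_lt hv
        _ ≤ Q A₀ := by rw [hdec A₀ hA₀]; exact le_self_add
        _ ≤ Q A := measure_mono Set.subset_union_left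
    have h2 := ENNReal.toReal_mono (measure_ne_top Q A) h1
    rwa [ENNReal.toReal_mul, ENNReal.toReal_ofReal (by linarith)] at h2
  · have h1 : Q B ≤ ENNReal.ofReal (1 - η) * P B := by
      have h0 : Q.singularPart P B = 0 := measure_mono_null Set.inter_subset_right hN1
      rw [hdec B hB, h0, add_zero, ← setLIntegral_const]
      exact setLIntegral_mono measurable_const fun v hv => le_of_lt hv.1
    have h2 := ENNReal.toReal_mono
      (ENNReal.mul_ne_top ENNReal.ofReal_ne_top (measure_ne_top P B)) h1
    rwa [ENNReal.toReal_mul, ENNReal.toReal_ofReal (by linarith)] at h2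
  · intro v
    dsimp only
    split_ifs with hv
    · obtain ⟨-, h2, h3⟩ := hoff v hv
      have hne : F v ≠ ∞ := ne_top_of_le_ne_top ENNReal.ofReal_ne_top h2
      exact ⟨(ENNReal.ofReal_le_iff_le_toReal hne).1 h3,
        ENNReal.toReal_le_of_le_ofReal (by linarith) h2⟩
    · constructor <;> linarith
  · have h1 : Q.restrict (A ∪ B)ᶜ = (P.restrict (A ∪ B)ᶜ).withDensity F := by
      conv_lhs => rw [← Measure.rnDeriv_add_singularPart Q P]
      have h0 : (Q.singularPart P).restrict (A ∪ B)ᶜ = 0 :=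
        Measure.restrict_eq_zero.2 (measure_mono_null (fun v hv => (hoff v hv).1) hN1)
      rw [Measure.restrict_add, h0, add_zero, restrict_withDensity hAB]
    rw [h1]
    refine withDensity_congr_ae ?_
    filter_upwards [ae_restrict_mem hAB] with v hv
    rw [if_pos hv, ENNReal.ofReal_toReal]
    exact ne_top_of_le_ne_top ENNReal.ofReal_ne_top (hoff v hv).2.1

end Analysis

end Efficiency

namespace Efficiency

/-! ### Differentiating expectations of centred functions. -/

section Differentiation

variable {W V : Type*} [MeasurableSpace W] [MeasurableSpace V]

lemma integral_eq_integral_rnDeriv_mul_add (P Q : Measure W) [IsFiniteMeasure P]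
    [IsFiniteMeasure Q] {Φ : W → ℝ} (hΦ : Integrable Φ Q) :
    ∫ w, Φ w ∂Q = ∫ w, Φ w * (Q.rnDeriv P w).toReal ∂P + ∫ w, Φ w ∂(Q.singularPart P) := by
  have h1 : Integrable Φ (P.withDensity (Q.rnDeriv P)) :=
    hΦ.mono_measure (Measure.withDensity_rnDeriv_le Q P)
  have h2 : Integrable Φ (Q.singularPart P) := hΦ.mono_measure (Measure.singularPart_le Q P)
  conv_lhs => rw [← Measure.rnDeriv_add_singularPart Q P]
  rw [integral_add_measure h1 h2, integral_withDensity_eq_integral_toReal_smul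
    (Measure.measurable_rnDeriv Q P) (Measure.rnDeriv_lt_top Q P)]
  simp [mul_comm]

/-- Carries a second-moment bound from Q over to P, where the factor √f of the quadratic-mean
expansion lives. -/
lemma memLp_mul_sqrt_rnDeriv (P Q : Measure W) [IsFiniteMeasure P] [IsFiniteMeasure Q] {Φ : W → ℝ}
    (hΦP : AEStronglyMeasurable Φ P) (hΦ : MemLp Φ 2 Q) :
    MemLp (fun w => Φ w * √((Q.rnDeriv P w).toReal)) 2 P ∧
      ∫ w, (Φ w * √((Q.rnDeriv P w).toReal)) ^ 2 ∂P ≤ ∫ w, Φ w ^ 2 ∂Q := by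
  have h1 : Integrable (fun w => Φ w ^ 2) (P.withDensity (Q.rnDeriv P)) :=
    hΦ.integrable_sq.mono_measure (Measure.withDensity_rnDeriv_le Q P)
  have h2 : ∀ w, (Φ w * √((Q.rnDeriv P w).toReal)) ^ 2
      = (Q.rnDeriv P w).toReal • Φ w ^ 2 := fun w => by
    rw [mul_pow, Real.sq_sqrt ENNReal.toReal_nonneg, smul_eq_mul, mul_comm]
  constructor
  · refine (memLp_two_iff_integrable_sq (hΦP.mul
      (Measure.measurable_rnDeriv Q P).ennreal_toReal.sqrt.aestronglyMeasurable)).2 ?_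
    simp only [Pi.mul_apply, h2]
    exact (integrable_withDensity_iff_integrable_smul' (Measure.measurable_rnDeriv Q P)
      (Measure.rnDeriv_lt_top Q P)).1 h1
  · simp only [h2]
    rw [← integral_withDensity_eq_integral_toReal_smul
      (Measure.measurable_rnDeriv Q P) (Measure.rnDeriv_lt_top Q P) (fun w => Φ w ^ 2)]
    exact integral_mono_measure (Measure.withDensity_rnDeriv_le Q P)
      (ae_of_all _ fun _ => sq_nonneg _) hΦ.integrable_sq

/-- Quantitative differentiation of the expectation of a centred function along a path that is
differentiable in quadratic mean. -/
lemma abs_integral_div_sub_integral_mul_le (P Q : Measure W) [IsFiniteMeasure P]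
    [IsFiniteMeasure Q] {Φ g : W → ℝ} {γ b n M : ℝ} (hg : MemLp g 2 P) (hΦP : MemLp Φ 2 P)
    (hΦQ : MemLp Φ 2 Q) (hb : √(∫ w, Φ w ^ 2 ∂Q) ≤ b) (hn : √(∫ w, Φ w ^ 2 ∂P) ≤ n)
    (h0 : ∫ w, Φ w ∂P = 0) (hγ : γ ≠ 0) (hM : 0 ≤ M) :
    |(∫ w, Φ w ∂Q) / γ - ∫ w, Φ w * g w ∂P| ≤
      (b + n) * √(∫ w, ((√((Q.rnDeriv P w).toReal) - 1) / γ - g w / 2) ^ 2 ∂P)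
      + (M * n * √(∫ w, (√((Q.rnDeriv P w).toReal) - 1) ^ 2 ∂P)
        + (b + n) * √(∫ w, ({w | M < |g w|}.indicator g w) ^ 2 ∂P))
      + b * √((Q.singularPart P).real Set.univ) / |γ| := by
  set f : W → ℝ := fun w => (Q.rnDeriv P w).toReal with hf
  have hf0 : ∀ w, 0 ≤ f w := fun w => ENNReal.toReal_nonneg
  set u : W → ℝ := fun w => √(f w) - 1 with hu
  set v : W → ℝ := fun w => (√(f w) - 1) / γ - g w / 2 with hv
  set S := Q.singularPart P
  have huL : MemLp u 2 P := memLp_sqrt_rnDeriv_sub_one P Q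
  have hvL : MemLp v 2 P := by
    have := (huL.mul_const γ⁻¹).sub (hg.mul_const 2⁻¹)
    simpa [hv, hu, div_eq_mul_inv, Pi.sub_def] using this
  obtain ⟨hsL, hsq⟩ := memLp_mul_sqrt_rnDeriv P Q hΦP.1 hΦQ
  have hb0 : 0 ≤ b := (Real.sqrt_nonneg _).trans hb
  have hn0 : 0 ≤ n := (Real.sqrt_nonneg _).trans hn
  have hsb : √(∫ w, (Φ w * √(f w)) ^ 2 ∂P) ≤ b := (Real.sqrt_le_sqrt hsq).trans hb
  set gM : W → ℝ := {w | M < |g w|}.indicator g with hgM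
  have hset : NullMeasurableSet {w | M < |g w|} P :=
    nullMeasurableSet_lt aemeasurable_const (continuous_abs.comp_aestronglyMeasurable
      hg.1).aemeasurable
  have hgML : MemLp gM 2 P := hg.mono (hg.1.indicator₀ hset)
    (ae_of_all _ fun w => norm_indicator_le_norm_self _ _)
  have iΦP : Integrable Φ P := hΦP.integrable one_le_two
  have iΦQ : Integrable Φ Q := hΦQ.integrable one_le_two
  have i1 : Integrable (fun w => Φ w * √(f w) * v w) P := hsL.integrable_mul hvL
  have i2 : Integrable (fun w => Φ w * v w) P := hΦP.integrable_mul hvL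
  have i3 : Integrable (fun w => Φ w * g w) P := hΦP.integrable_mul hg
  have i4 : Integrable (fun w => Φ w * √(f w) * g w) P := hsL.integrable_mul hg
  have i5 : Integrable (fun w => Φ w * f w) P := by
    have := hsL.integrable_mul (memLp_sqrt_rnDeriv P Q)
    refine this.congr (ae_of_all _ fun w => ?_)
    simp only [Pi.mul_apply]
    rw [mul_assoc, Real.mul_self_sqrt (hf0 w)]
  have i6 : Integrable (fun w => Φ w * u w * g w) P := by
    refine (i4.sub i3).congr (ae_of_all _ fun w => ?_)
    simp only [Pi.sub_apply, hu]
    ring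
  have i7 : Integrable (fun w => Φ w * √(f w) * gM w) P := hsL.integrable_mul hgML
  have i8 : Integrable (fun w => Φ w * gM w) P := hΦP.integrable_mul hgML
  have i9 : Integrable (fun w => Φ w * u w) P := hΦP.integrable_mul huL
  -- Centring allows f to be replaced by f - 1 = (√f + 1)(√f - 1), and then (f - 1)/γ - g = (√f + 1)
  -- v + (√f - 1) g/2 pointwise.
  have key : (∫ w, Φ w ∂Q) / γ - ∫ w, Φ w * g w ∂P
      = (∫ w, Φ w * √(f w) * v w ∂P + ∫ w, Φ w * v w ∂P) + 2⁻¹ * ∫ w, Φ w * u w * g w ∂P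
        + (∫ w, Φ w ∂S) / γ := by
    rw [integral_eq_integral_rnDeriv_mul_add P Q iΦQ, add_div, add_sub_right_comm]
    congr 1
    have e1 : ∫ w, Φ w * f w ∂P = ∫ w, (Φ w * f w - Φ w) ∂P := by
      rw [integral_sub i5 iΦP, h0, sub_zero]
    have i10 : Integrable (fun w => (Φ w * f w - Φ w) / γ) P := (i5.sub iΦP).div_const γ
    have i11 : Integrable (fun w => Φ w * √(f w) * v w + Φ w * v w) P := i1.add i2
    rw [e1, ← integral_div, ← integral_sub i10 i3, ← integral_const_mul,
      ← integral_add i1 i2, ← integral_add i11 (i6.const_mul _)]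
    refine integral_congr_ae (ae_of_all _ fun w => ?_)
    have hsq : f w = √(f w) ^ 2 := (Real.sq_sqrt (hf0 w)).symm
    simp only [hu, hv]
    field_simp
    nth_rewrite 1 [hsq]
    ring
  have B1 : |∫ w, Φ w * √(f w) * v w ∂P| ≤ b * √(∫ w, v w ^ 2 ∂P) :=
    (abs_integral_mul_le_sqrt_mul_sqrt hsL hvL).trans (by gcongr)
  have B2 : |∫ w, Φ w * v w ∂P| ≤ n * √(∫ w, v w ^ 2 ∂P) :=
    (abs_integral_mul_le_sqrt_mul_sqrt hΦP hvL).trans (by gcongr)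
  have B3 : |∫ w, Φ w ∂S| ≤ b * √(S.real Set.univ) := by
    have hle : S ≤ Q := Measure.singularPart_le Q P
    have h := abs_setIntegral_le_sqrt_mul_sqrt (μ := S) (hΦQ.mono_measure hle) Set.univ
    rw [Measure.restrict_univ] at h
    refine h.trans (mul_le_mul_of_nonneg_right (le_trans (Real.sqrt_le_sqrt ?_) hb)
      (Real.sqrt_nonneg _))
    exact integral_mono_measure hle (ae_of_all _ fun _ => sq_nonneg _) hΦQ.integrable_sq
  have B4 : |∫ w, Φ w * u w * g w ∂P| ≤ M * (n * √(∫ w, u w ^ 2 ∂P))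
      + (b + n) * √(∫ w, gM w ^ 2 ∂P) := by
    -- A product of three L² functions need not be small: where |g| ≤ M the factor g is bounded by
    -- M, and elsewhere u = √f - 1 is split into its two terms, leaving only the tail of g.
    have hpt : ∀ w, |Φ w * u w * g w|
        ≤ M * |Φ w * u w| + (|Φ w * √(f w) * gM w| + |Φ w * gM w|) := by
      intro w
      by_cases hw : M < |g w|
      · have e : gM w = g w := Set.indicator_of_mem (s := {w | M < |g w|}) hw g
        rw [e]
        have e2 : Φ w * u w * g w = Φ w * √(f w) * g w - Φ w * g w := by simp only [hu]; ring
        have h3 := abs_sub (Φ w * √(f w) * g w) (Φ w * g w)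
        rw [← e2] at h3
        have : 0 ≤ M * |Φ w * u w| := by positivity
        linarith
      · have h3 : |Φ w * u w * g w| ≤ M * |Φ w * u w| := by
          rw [abs_mul, mul_comm]
          exact mul_le_mul_of_nonneg_right (not_lt.1 hw) (abs_nonneg _)
        have : 0 ≤ |Φ w * √(f w) * gM w| + |Φ w * gM w| := by positivity
        linarith
    calc |∫ w, Φ w * u w * g w ∂P| ≤ ∫ w, |Φ w * u w * g w| ∂P := abs_integral_le_integral_abs
      _ ≤ ∫ w, (M * |Φ w * u w| + (|Φ w * √(f w) * gM w| + |Φ w * gM w|)) ∂P :=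
          integral_mono i6.abs ((i9.abs.const_mul M).add (i7.abs.add i8.abs)) hpt
      _ = M * ∫ w, |Φ w * u w| ∂P + (∫ w, |Φ w * √(f w) * gM w| ∂P + ∫ w, |Φ w * gM w| ∂P) := by
          have j1 : Integrable (fun w => M * |Φ w * u w|) P := i9.abs.const_mul M
          have j2 : Integrable (fun w => |Φ w * √(f w) * gM w| + |Φ w * gM w|) P :=
            i7.abs.add i8.abs
          rw [integral_add j1 j2, integral_const_mul,
            integral_add i7.abs i8.abs]
      _ ≤ M * (n * √(∫ w, u w ^ 2 ∂P)) + (b * √(∫ w, gM w ^ 2 ∂P) + n * √(∫ w, gM w ^ 2 ∂P)) := by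
          have k1 := integral_abs_mul_le_sqrt_mul_sqrt hΦP huL
          have k2 := integral_abs_mul_le_sqrt_mul_sqrt hsL hgML
          have k3 := integral_abs_mul_le_sqrt_mul_sqrt hΦP hgML
          gcongr
          · exact k1.trans (by gcongr)
          · exact k2.trans (by gcongr)
          · exact k3.trans (by gcongr)
      _ = _ := by ring
  rw [key]
  have hB3' : |(∫ w, Φ w ∂S) / γ| ≤ b * √(S.real Set.univ) / |γ| := by
    rw [abs_div]; gcongr
  have t1 := abs_add_le (∫ w, Φ w * √(f w) * v w ∂P + ∫ w, Φ w * v w ∂P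
    + 2⁻¹ * ∫ w, Φ w * u w * g w ∂P) ((∫ w, Φ w ∂S) / γ)
  have t2 := abs_add_le (∫ w, Φ w * √(f w) * v w ∂P + ∫ w, Φ w * v w ∂P)
    (2⁻¹ * ∫ w, Φ w * u w * g w ∂P)
  have t3 := abs_add_le (∫ w, Φ w * √(f w) * v w ∂P) (∫ w, Φ w * v w ∂P)
  have t4 : |2⁻¹ * ∫ w, Φ w * u w * g w ∂P| ≤ M * (n * √(∫ w, u w ^ 2 ∂P))
      + (b + n) * √(∫ w, gM w ^ 2 ∂P) := by
    rw [abs_mul, abs_of_pos (by norm_num : (0 : ℝ) < 2⁻¹)]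
    have := abs_nonneg (∫ w, Φ w * u w * g w ∂P)
    linarith
  linarith

end Differentiation

end Efficiency

namespace Efficiency

/-! ### Residuals whose weights move along the path. -/

section Differentiation

variable {W V : Type*} [MeasurableSpace W] [MeasurableSpace V]

lemma memLp_sqrt_rnDeriv_residual (P Q : Measure W) [IsFiniteMeasure P] [IsFiniteMeasure Q]
    {g : W → ℝ} (hg : MemLp g 2 P) (γ : ℝ) :
    MemLp (fun w => (√((Q.rnDeriv P w).toReal) - 1) / γ - g w / 2) 2 P := by
  have := ((memLp_sqrt_rnDeriv_sub_one P Q).mul_const γ⁻¹).sub (hg.mul_const 2⁻¹)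
  simpa [div_eq_mul_inv, Pi.sub_def] using this

/-- The squared Hellinger distance along a path that is differentiable in quadratic mean. -/
lemma setIntegral_sq_sqrt_rnDeriv_sub_one_le (P Q : Measure W) [IsFiniteMeasure P]
    [IsFiniteMeasure Q] {g : W → ℝ} (hg : MemLp g 2 P) {γ : ℝ} (hγ : γ ≠ 0) (A : Set W) :
    ∫ w in A, (√((Q.rnDeriv P w).toReal) - 1) ^ 2 ∂P
      ≤ γ ^ 2 * (2 * ∫ w, ((√((Q.rnDeriv P w).toReal) - 1) / γ - g w / 2) ^ 2 ∂P
        + ∫ w in A, g w ^ 2 ∂P) := by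
  have hv := memLp_sqrt_rnDeriv_residual P Q hg γ
  have i1 := hv.integrable_sq
  have i2 := hg.integrable_sq
  have h1 : ∫ w in A, ((√((Q.rnDeriv P w).toReal) - 1) / γ - g w / 2) ^ 2 ∂P
      ≤ ∫ w, ((√((Q.rnDeriv P w).toReal) - 1) / γ - g w / 2) ^ 2 ∂P :=
    setIntegral_le_integral i1 (ae_of_all _ fun _ => sq_nonneg _)
  calc _ ≤ ∫ w in A, γ ^ 2 * (2 * ((√((Q.rnDeriv P w).toReal) - 1) / γ - g w / 2) ^ 2
        + g w ^ 2) ∂P := by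
        refine integral_mono ((memLp_sqrt_rnDeriv_sub_one P Q).restrict A).integrable_sq
          (((i1.restrict.const_mul 2).add i2.restrict).const_mul _) fun w => ?_
        have e : √((Q.rnDeriv P w).toReal) - 1
            = γ * (((√((Q.rnDeriv P w).toReal) - 1) / γ - g w / 2) + g w / 2) := by
          field_simp
          ring
        dsimp only
        generalize (√((Q.rnDeriv P w).toReal) - 1) / γ - g w / 2 = v at e
        rw [e, mul_pow]
        gcongr
        nlinarith [sq_nonneg (v - g w / 2), sq_nonneg (g w)]
    _ = γ ^ 2 * (2 * ∫ w in A, ((√((Q.rnDeriv P w).toReal) - 1) / γ - g w / 2) ^ 2 ∂P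
        + ∫ w in A, g w ^ 2 ∂P) := by
        rw [integral_const_mul, integral_add (i1.restrict.const_mul 2) i2.restrict,
          integral_const_mul]
    _ ≤ _ := by gcongr

/-- Expectation of a weighted residual whose weights change along the path: off a set of small
mass the weights are close to the original ones. -/
lemma exists_set_abs_integral_weighted_div_sub_le (P Q : Measure W) [IsProbabilityMeasure P]
    [IsProbabilityMeasure Q] {π : W → V} (hπ : Measurable π) {w₀ w₁ : V → ℝ}
    (hw₀ : Measurable w₀) (hw₁ : Measurable w₁) (hw₀' : ∀ v, 0 ≤ w₀ v) (hw₁' : ∀ v, 0 ≤ w₁ v)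
    (hν : (Q.map π).withDensity (fun v => ENNReal.ofReal (w₁ v))
      = (P.map π).withDensity fun v => ENNReal.ofReal (w₀ v))
    {r : W → ℝ} (hr : Measurable r) (h₀ : MemLp (fun z => w₀ (π z) * r z) 2 P)
    (h₁ : MemLp (fun z => w₁ (π z) * r z) 2 Q)
    (hcent : ∀ φ : V → ℝ, Measurable φ → (∃ c, ∀ v, |φ v| ≤ c) →
      ∫ z, φ (π z) * (w₀ (π z) * r z) ∂P = 0)
    {g : W → ℝ} (hg : MemLp g 2 P) {γ b M η : ℝ} (hγ : γ ≠ 0) (hM : 0 ≤ M) (hη : 0 < η)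
    (hη' : η ≤ 1 / 2) (hb : √(∫ z, (w₁ (π z) * r z) ^ 2 ∂Q) ≤ b) :
    ∃ A : Set W, MeasurableSet A ∧
      P.real A ≤ 2 * ((1 + 2 / η) * (4 / η)) * (γ ^ 2 *
        (2 * ∫ w, ((√((Q.rnDeriv P w).toReal) - 1) / γ - g w / 2) ^ 2 ∂P
          + ∫ w, g w ^ 2 ∂P + (Q.singularPart P).real Set.univ / γ ^ 2)) ∧
      |(∫ z, w₁ (π z) * r z ∂Q) / γ - ∫ z, w₀ (π z) * r z * g z ∂P| ≤
        b * √(2 * ((1 + 2 / η) * (4 / η)) *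
          (2 * ∫ w, ((√((Q.rnDeriv P w).toReal) - 1) / γ - g w / 2) ^ 2 ∂P
            + ∫ w in A, g w ^ 2 ∂P + (Q.singularPart P).real Set.univ / γ ^ 2))
        + ((b + 2 * √(∫ z, (w₀ (π z) * r z) ^ 2 ∂P))
            * √(∫ w, ((√((Q.rnDeriv P w).toReal) - 1) / γ - g w / 2) ^ 2 ∂P)
          + (M * (2 * √(∫ z, (w₀ (π z) * r z) ^ 2 ∂P))
              * √(∫ w, (√((Q.rnDeriv P w).toReal) - 1) ^ 2 ∂P)
            + (b + 2 * √(∫ z, (w₀ (π z) * r z) ^ 2 ∂P))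
              * √(∫ w, ({w | M < |g w|}.indicator g w) ^ 2 ∂P))
          + b * √((Q.singularPart P).real Set.univ) / |γ|)
        + (2 * η * ∫ z, |w₀ (π z) * r z * g z| ∂P
          + ∫ z in A, |w₀ (π z) * r z * g z| ∂P) := by
  have : IsProbabilityMeasure (P.map π) := Measure.isProbabilityMeasure_map hπ.aemeasurable
  have : IsProbabilityMeasure (Q.map π) := Measure.isProbabilityMeasure_map hπ.aemeasurable
  -- The comparison is made between the laws of π, since the weights are functions of π; the
  -- exceptional set is then pulled back, which keeps multipliers of the form φ(π).
  obtain ⟨A₁, A₂, θ, hA₁, hA₂, hθ, hA₁', hA₂', hθ', hres⟩ :=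
    exists_density_near_one (P.map π) (Q.map π) hη (by linarith)
  set B := A₁ ∪ A₂
  have hB : MeasurableSet B := hA₁.union hA₂
  set A : Set W := π ⁻¹' B
  have hA : MeasurableSet A := hπ hB
  set K := (1 + 2 / η) * (4 / η)
  have hK : 0 ≤ K := by positivity
  set S := Q.singularPart P
  set D : Set W → ℝ := fun E => ∫ w in E, (√((Q.rnDeriv P w).toReal) - 1) ^ 2 ∂P
  set W₀ : W → ℝ := fun z => w₀ (π z) * r z with hW₀
  set W₁ : W → ℝ := fun z => w₁ (π z) * r z with hW₁
  set n := √(∫ z, W₀ z ^ 2 ∂P)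
  have hb0 : 0 ≤ b := (Real.sqrt_nonneg _).trans hb
  -- the mass of the exceptional set
  have hmass : P.real A ≤ 2 * K * (D A + S.real Set.univ) ∧
      Q.real A ≤ 2 * K * (D A + S.real Set.univ) := by
    rw [map_measureReal_apply hπ hA₁, map_measureReal_apply hπ hA₁] at hA₁'
    rw [map_measureReal_apply hπ hA₂, map_measureReal_apply hπ hA₂] at hA₂'
    have k1 := measureReal_le_hellinger P Q hη (by linarith) (Or.inl hA₁')
    have k2 := measureReal_le_hellinger P Q hη (by linarith) (Or.inr hA₂')
    have hDmono : ∀ E ⊆ A, D E ≤ D A := fun E hE =>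
      setIntegral_mono_set ((memLp_sqrt_rnDeriv_sub_one P Q).restrict A).integrable_sq
        (ae_of_all _ fun _ => sq_nonneg _) hE.eventuallyLE
    have hSmono : ∀ E, S.real E ≤ S.real Set.univ := fun E => measureReal_mono (Set.subset_univ E)
    have m1 := hDmono (π ⁻¹' A₁) (Set.preimage_mono Set.subset_union_left)
    have m2 := hDmono (π ⁻¹' A₂) (Set.preimage_mono Set.subset_union_right)
    have b1 : K * (D (π ⁻¹' A₁) + S.real (π ⁻¹' A₁)) ≤ K * (D A + S.real Set.univ) := by
      have := hSmono (π ⁻¹' A₁); gcongr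
    have b2 : K * (D (π ⁻¹' A₂) + S.real (π ⁻¹' A₂)) ≤ K * (D A + S.real Set.univ) := by
      have := hSmono (π ⁻¹' A₂); gcongr
    have hu : ∀ R : Measure W, R.real A ≤ R.real (π ⁻¹' A₁) + R.real (π ⁻¹' A₂) := fun R => by
      rw [show A = π ⁻¹' A₁ ∪ π ⁻¹' A₂ from Set.preimage_union]
      exact measureReal_union_le _ _
    have c1 := hu P
    have c2 := hu Q
    constructor
    · linarith [k1.1, k2.1]
    · linarith [k1.2, k2.2]
  have hDA := setIntegral_sq_sqrt_rnDeriv_sub_one_le P Q hg hγ A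
  have hγ2 : 0 < γ ^ 2 := by positivity
  have hmass2 : D A + S.real Set.univ ≤ γ ^ 2 *
      (2 * ∫ w, ((√((Q.rnDeriv P w).toReal) - 1) / γ - g w / 2) ^ 2 ∂P
        + ∫ w in A, g w ^ 2 ∂P + S.real Set.univ / γ ^ 2) := by
    rw [mul_add _ (_ + _), mul_div_cancel₀ _ hγ2.ne']
    gcongr
  -- the weights off the exceptional set
  have hθpos : ∀ v, 0 < θ v := fun v => by linarith [(hθ' v).1]
  -- The two weighted laws of π coincide, and off B the law under Q has density θ, so θ w₁ = w₀
  -- there.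
  have hwP : ∀ᵐ v ∂((P.map π).restrict Bᶜ), w₁ v = (θ v)⁻¹ * w₀ v := by
    have h1 := congrArg (fun μ : Measure V => μ.restrict Bᶜ) hν
    simp only [restrict_withDensity hB.compl] at h1
    rw [hres, ← withDensity_mul _ hθ.ennreal_ofReal hw₁.ennreal_ofReal] at h1
    rw [withDensity_eq_iff_of_sigmaFinite (by fun_prop) (by fun_prop)] at h1
    filter_upwards [h1] with v hv
    rw [Pi.mul_apply, ← ENNReal.ofReal_mul (hθpos v).le,
      ENNReal.ofReal_eq_ofReal_iff (mul_nonneg (hθpos v).le (hw₁' v)) (hw₀' v)] at hv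
    rw [← hv, inv_mul_cancel_left₀ (hθpos v).ne']
  have hwQ : ∀ᵐ v ∂((Q.map π).restrict Bᶜ), w₁ v = (θ v)⁻¹ * w₀ v := by
    rw [hres]
    exact (withDensity_absolutelyContinuous _ _).ae_le hwP
  classical
  -- Under Q the weighted residual off the exceptional set equals φ(π) w₀(π) r. As a bounded
  -- function of π times a centred residual it is centred under P, so the estimate with a single
  -- function Φ applies; φ ≤ 2 because θ ≥ 1/2.
  set φ : V → ℝ := Bᶜ.indicator fun v => (θ v)⁻¹ with hφ
  have hφm : Measurable φ := hθ.inv.indicator hB.compl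
  have hφb : ∀ v, |φ v| ≤ 2 := by
    intro v
    by_cases hv : v ∈ Bᶜ
    · rw [hφ, Set.indicator_of_mem hv, abs_of_pos (inv_pos.2 (hθpos v))]
      exact inv_le_of_inv_le₀ two_pos (by linarith [(hθ' v).1])
    · rw [hφ, Set.indicator_of_notMem hv, abs_zero]
      exact zero_le_two
  set Φ : W → ℝ := fun z => φ (π z) * W₀ z with hΦ
  have hW₀m : Measurable W₀ := (hw₀.comp hπ).mul hr
  have hΦm : Measurable Φ := (hφm.comp hπ).mul hW₀m
  have hΦle : ∀ z, |Φ z| ≤ 2 * |W₀ z| := fun z => by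
    rw [hΦ]
    dsimp only
    rw [abs_mul]
    exact mul_le_mul_of_nonneg_right (hφb _) (abs_nonneg _)
  have hΦP : MemLp Φ 2 P := (h₀.const_mul 2).mono hΦm.aestronglyMeasurable
    (ae_of_all _ fun z => by simpa [abs_mul] using hΦle z)
  have hΦW : ∀ᵐ z ∂Q, Φ z = Aᶜ.indicator W₁ z := by
    have h1 : ∀ᵐ v ∂(Q.map π), v ∈ Bᶜ → w₁ v = (θ v)⁻¹ * w₀ v :=
      (ae_restrict_iff' hB.compl).1 hwQ
    filter_upwards [ae_of_ae_map hπ.aemeasurable h1] with z hz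
    by_cases hzB : π z ∈ Bᶜ
    · rw [Set.indicator_of_mem (show z ∈ Aᶜ from hzB)]
      simp only [hΦ, hφ, Set.indicator_of_mem hzB, hW₀, hW₁, hz hzB, mul_assoc]
    · rw [Set.indicator_of_notMem (show z ∉ Aᶜ from hzB)]
      simp only [hΦ, hφ, Set.indicator_of_notMem hzB, zero_mul]
  have hΦQ : MemLp Φ 2 Q := (memLp_congr_ae hΦW).2 (h₁.indicator hA.compl)
  have hΦQb : √(∫ z, Φ z ^ 2 ∂Q) ≤ b := by
    refine le_trans (Real.sqrt_le_sqrt (integral_mono_ae hΦQ.integrable_sq h₁.integrable_sq ?_)) hb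
    filter_upwards [hΦW] with z hz
    rw [hz]
    by_cases h : z ∈ Aᶜ
    · rw [Set.indicator_of_mem h]
    · rw [Set.indicator_of_notMem h, zero_pow two_ne_zero]; exact sq_nonneg _
  have hΦPn : √(∫ z, Φ z ^ 2 ∂P) ≤ 2 * n := by
    rw [Real.sqrt_le_left (by positivity), mul_pow,
      Real.sq_sqrt (integral_nonneg fun _ => sq_nonneg _), ← integral_const_mul]
    refine integral_mono hΦP.integrable_sq (h₀.integrable_sq.const_mul _) fun z => ?_
    have := pow_le_pow_left₀ (abs_nonneg _) (hΦle z) 2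
    simpa [mul_pow] using this
  have hΦ0 : ∫ z, Φ z ∂P = 0 := hcent φ hφm ⟨2, hφb⟩
  have hmain := abs_integral_div_sub_integral_mul_le P Q hg hΦP hΦQ hΦQb hΦPn hΦ0 hγ hM
  have hsplit : ∫ z, W₁ z ∂Q = ∫ z in A, W₁ z ∂Q + ∫ z, Φ z ∂Q := by
    rw [integral_congr_ae hΦW, integral_indicator hA.compl,
      integral_add_compl hA (h₁.integrable one_le_two)]
  -- Cauchy-Schwarz with the mass bound for A: the factor γ² under the root cancels the division by
  -- γ.
  have hexc : |(∫ z in A, W₁ z ∂Q) / γ| ≤ b * √(2 * K *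
      (2 * ∫ w, ((√((Q.rnDeriv P w).toReal) - 1) / γ - g w / 2) ^ 2 ∂P
        + ∫ w in A, g w ^ 2 ∂P + S.real Set.univ / γ ^ 2)) := by
    rw [abs_div, div_le_iff₀ (abs_pos.2 hγ), mul_assoc, ← Real.sqrt_sq_eq_abs γ,
      ← Real.sqrt_mul' _ hγ2.le]
    refine (abs_setIntegral_le_sqrt_mul_sqrt h₁ A).trans
      (mul_le_mul hb (Real.sqrt_le_sqrt ?_) (Real.sqrt_nonneg _) hb0)
    calc Q.real A ≤ 2 * K * (D A + S.real Set.univ) := hmass.2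
      _ ≤ 2 * K * _ := mul_le_mul_of_nonneg_left hmass2 (by positivity)
      _ = _ := by ring
  have iWg : Integrable (fun z => W₀ z * g z) P := h₀.integrable_mul hg
  have iΦg : Integrable (fun z => Φ z * g z) P := hΦP.integrable_mul hg
  -- Off A the error is |1/θ - 1| ≤ η/θ ≤ 2η times |W₀ g|; on A the function Φ vanishes.
  have hlast : |∫ z, Φ z * g z ∂P - ∫ z, W₀ z * g z ∂P| ≤ 2 * η * ∫ z, |W₀ z * g z| ∂P
      + ∫ z in A, |W₀ z * g z| ∂P := by
    rw [← integral_sub iΦg iWg, ← integral_const_mul, ← integral_indicator hA,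
      ← integral_add (iWg.abs.const_mul _) (iWg.abs.indicator hA)]
    refine abs_integral_le_integral_abs.trans (integral_mono (iΦg.sub iWg).abs
      ((iWg.abs.const_mul _).add (iWg.abs.indicator hA)) fun z => ?_)
    dsimp only
    by_cases hz : π z ∈ Bᶜ
    · rw [Set.indicator_of_notMem (show z ∉ A from hz), add_zero]
      simp only [hΦ, hφ, Set.indicator_of_mem hz]
      rw [mul_assoc, ← sub_one_mul, abs_mul]
      refine mul_le_mul_of_nonneg_right ?_ (abs_nonneg _)
      have h1 := hθ' (π z)
      have h2 := hθpos (π z)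
      rw [show (θ (π z))⁻¹ - 1 = (1 - θ (π z)) / θ (π z) by field_simp, abs_div, abs_of_pos h2,
        div_le_iff₀ h2, abs_le]
      constructor <;> nlinarith [h1.1, h1.2]
    · rw [Set.indicator_of_mem (show z ∈ A from not_not.1 hz)]
      simp only [hΦ, hφ, Set.indicator_of_notMem hz, zero_mul, zero_sub, abs_neg]
      have : 0 ≤ 2 * η * |W₀ z * g z| := by positivity
      linarith
  refine ⟨A, hA, ?_, ?_⟩
  · refine hmass.1.trans (mul_le_mul_of_nonneg_left (hmass2.trans ?_) (by positivity))
    have : ∫ w in A, g w ^ 2 ∂P ≤ ∫ w, g w ^ 2 ∂P :=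
      setIntegral_le_integral hg.integrable_sq (ae_of_all _ fun _ => sq_nonneg _)
    gcongr
  · have e : (∫ z, W₁ z ∂Q) / γ - ∫ z, W₀ z * g z ∂P
        = (∫ z in A, W₁ z ∂Q) / γ + ((∫ z, Φ z ∂Q) / γ - ∫ z, Φ z * g z ∂P)
          + (∫ z, Φ z * g z ∂P - ∫ z, W₀ z * g z ∂P) := by
      rw [hsplit, add_div]; ring
    rw [e]
    refine (abs_add_le _ _).trans (add_le_add ((abs_add_le _ _).trans
      (add_le_add hexc hmain)) hlast)

end Differentiation

end Efficiency

namespace Efficiency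

/-! ### Passage to the limit along a path with a score. -/

section Differentiation

variable {W V : Type*} [MeasurableSpace W] [MeasurableSpace V]

/-- Both summands of the quadratic-mean integral are nonnegative, so they vanish separately; in
particular the singular mass is o(γ²). -/
lemma HasScore.tendsto_integral_sq_residual {Q : ℝ → Measure W} [∀ γ, IsProbabilityMeasure (Q γ)]
    {g : W → ℝ} (h : HasScore Q g) :
    Tendsto (fun γ => ∫ w, ((√(((Q γ).rnDeriv (Q 0) w).toReal) - 1) / γ - g w / 2) ^ 2 ∂(Q 0))
        (𝓝[≠] 0) (𝓝 0) ∧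
      Tendsto (fun γ => ((Q γ).singularPart (Q 0)).real Set.univ / γ ^ 2) (𝓝[≠] 0) (𝓝 0) := by
  have h2 := h.2
  simp only [lintegral_sq_sqrt_rnDeriv] at h2
  constructor
  · have h3 := (ENNReal.tendsto_toReal ENNReal.zero_ne_top).comp
      (tendsto_of_tendsto_of_tendsto_of_le_of_le tendsto_const_nhds h2
        (fun _ => zero_le) (fun _ => le_self_add))
    refine Tendsto.congr (fun γ => ?_) h3
    rw [integral_eq_lintegral_of_nonneg_ae (ae_of_all _ fun _ => sq_nonneg _)
      ((memLp_sqrt_rnDeriv_residual _ _ h.1 γ).1.pow 2)]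
    rfl
  · have h3 := (ENNReal.tendsto_toReal ENNReal.zero_ne_top).comp
      (tendsto_of_tendsto_of_tendsto_of_le_of_le tendsto_const_nhds h2
        (fun _ => zero_le) (fun _ => le_add_self))
    refine Tendsto.congr (fun γ => ?_) h3
    simp only [Function.comp_apply, ENNReal.toReal_mul, measureReal_def]
    rw [ENNReal.toReal_ofReal (sq_nonneg _), one_div, inv_pow]
    ring

lemma tendsto_integral_sq_indicator_lt_abs {P : Measure W} {g : W → ℝ} (hg : MemLp g 2 P) :
    Tendsto (fun M : ℕ => ∫ w, ({w | (M : ℝ) < |g w|}.indicator g w) ^ 2 ∂P) atTop (𝓝 0) := by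
  have h : Tendsto (fun M : ℕ => ∫ w, ({w | (M : ℝ) < |g w|}.indicator g w) ^ 2 ∂P) atTop
      (𝓝 (∫ _, (0 : ℝ) ∂P)) := by
    refine tendsto_integral_of_dominated_convergence (fun w => g w ^ 2) (fun M => ?_)
      hg.integrable_sq (fun M => ae_of_all _ fun w => ?_) (ae_of_all _ fun w => ?_)
    · exact (hg.1.indicator₀ (nullMeasurableSet_lt aemeasurable_const
        (continuous_abs.comp_aestronglyMeasurable hg.1).aemeasurable)).pow 2
    · rw [Real.norm_eq_abs, abs_pow, ← sq_abs (g w)]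
      exact pow_le_pow_left₀ (abs_nonneg _) (norm_indicator_le_norm_self g w) 2
    · obtain ⟨N, hN⟩ := exists_nat_ge |g w|
      refine tendsto_const_nhds.congr' ?_
      filter_upwards [eventually_ge_atTop N] with M hM
      have : ¬ (M : ℝ) < |g w| := not_lt.2 (hN.trans (by exact_mod_cast hM))
      rw [Set.indicator_of_notMem (by simpa using this)]
      simp
  simpa using h

lemma tendsto_setIntegral_of_tendsto_measureReal {P : Measure W} [IsFiniteMeasure P] {f : W → ℝ}
    (hf : Integrable f P) {A : ℝ → Set W} {l : Filter ℝ}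
    (hA : Tendsto (fun γ => P.real (A γ)) l (𝓝 0)) :
    Tendsto (fun γ => ∫ w in A γ, f w ∂P) l (𝓝 0) := by
  refine hf.tendsto_setIntegral_nhds_zero ?_
  have := (ENNReal.tendsto_ofReal hA)
  simpa [Function.comp_def, ofReal_measureReal] using this

/-- Differentiation, along a path that is differentiable in quadratic mean, of the expectation of
a weighted residual whose weights turn the law of `π` into a fixed measure. -/
theorem HasScore.tendsto_integral_weighted_div {Q : ℝ → Measure W}
    [∀ γ, IsProbabilityMeasure (Q γ)] {g : W → ℝ} (hQ : HasScore Q g) {π : W → V}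
    (hπ : Measurable π) {w : ℝ → V → ℝ} (hw : ∀ γ, Measurable (w γ)) (hw' : ∀ γ v, 0 ≤ w γ v)
    {ν : Measure V}
    (hν : ∀ᶠ γ in 𝓝 0, ((Q γ).map π).withDensity (fun v => ENNReal.ofReal (w γ v)) = ν)
    {r : W → ℝ} (hr : Measurable r) (h₀ : MemLp (fun z => w 0 (π z) * r z) 2 (Q 0)) {B : ℝ≥0}
    (hB : ∀ᶠ γ in 𝓝 0, ∫⁻ z, ENNReal.ofReal ((w γ (π z) * r z) ^ 2) ∂(Q γ) ≤ B)
    (hcent : ∀ φ : V → ℝ, Measurable φ → (∃ c, ∀ v, |φ v| ≤ c) →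
      ∫ z, φ (π z) * (w 0 (π z) * r z) ∂(Q 0) = 0) :
    Tendsto (fun γ => (∫ z, w γ (π z) * r z ∂(Q γ)) / γ) (𝓝[≠] 0)
      (𝓝 (∫ z, w 0 (π z) * r z * g z ∂(Q 0))) := by
  obtain ⟨hV, hs⟩ := hQ.tendsto_integral_sq_residual
  have hg := hQ.1
  set V2 : ℝ → ℝ := fun γ =>
    ∫ w, ((√(((Q γ).rnDeriv (Q 0) w).toReal) - 1) / γ - g w / 2) ^ 2 ∂(Q 0) with hV2
  set s : ℝ → ℝ := fun γ => ((Q γ).singularPart (Q 0)).real Set.univ / γ ^ 2 with hsdef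
  set n := √(∫ z, (w 0 (π z) * r z) ^ 2 ∂(Q 0))
  set I := ∫ z, |w 0 (π z) * r z * g z| ∂(Q 0)
  have hI : 0 ≤ I := integral_nonneg fun _ => abs_nonneg _
  have iWg : Integrable (fun z => w 0 (π z) * r z * g z) (Q 0) := h₀.integrable_mul hg
  set b := √(B : ℝ)
  have hν0 := hν.self_of_nhds
  have hWm : ∀ γ, Measurable fun z => w γ (π z) * r z := fun γ => ((hw γ).comp hπ).mul hr
  have hQL : ∀ᶠ γ in 𝓝[≠] (0 : ℝ), MemLp (fun z => w γ (π z) * r z) 2 (Q γ) ∧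
      √(∫ z, (w γ (π z) * r z) ^ 2 ∂(Q γ)) ≤ b := by
    filter_upwards [hB.filter_mono nhdsWithin_le_nhds] with γ hγ
    have hint : Integrable (fun z => (w γ (π z) * r z) ^ 2) (Q γ) := by
      refine ⟨((hWm γ).pow_const 2).aestronglyMeasurable, ?_⟩
      rw [hasFiniteIntegral_iff_ofReal (ae_of_all _ fun _ => sq_nonneg _)]
      exact hγ.trans_lt ENNReal.coe_lt_top
    refine ⟨(memLp_two_iff_integrable_sq (hWm γ).aestronglyMeasurable).2 hint,
      Real.sqrt_le_sqrt ?_⟩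
    rw [integral_eq_lintegral_of_nonneg_ae (ae_of_all _ fun _ => sq_nonneg _) hint.1]
    exact ENNReal.toReal_mono ENNReal.coe_ne_top hγ
  rw [Metric.tendsto_nhds]
  intro ε hε
  -- truncation level and tolerance
  obtain ⟨M, hM⟩ : ∃ M : ℕ, (b + 2 * n) *
      √(∫ w, ({w | (M : ℝ) < |g w|}.indicator g w) ^ 2 ∂(Q 0)) < ε / 4 := by
    have h1 := ((tendsto_integral_sq_indicator_lt_abs hg).sqrt).const_mul (b + 2 * n)
    rw [Real.sqrt_zero, mul_zero] at h1
    exact (h1.eventually (gt_mem_nhds (by positivity))).exists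
  set tM := √(∫ w, ({w | (M : ℝ) < |g w|}.indicator g w) ^ 2 ∂(Q 0))
  obtain ⟨η, hη, hη', hηI⟩ : ∃ η : ℝ, 0 < η ∧ η ≤ 1 / 2 ∧ 2 * η * I < ε / 4 := by
    -- `I + 1` replaces `I` in the denominator to allow `I = 0`.
    refine ⟨min (1 / 2) (ε / (8 * (I + 1))), by positivity, min_le_left _ _, ?_⟩
    calc 2 * min (1 / 2) (ε / (8 * (I + 1))) * I ≤ 2 * (ε / (8 * (I + 1))) * I := by
          gcongr; exact min_le_right _ _
      _ = ε / 4 * (I / (I + 1)) := by field_simp; ring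
      _ < ε / 4 * 1 := by
          gcongr
          rw [div_lt_one (by positivity)]
          linarith
      _ = ε / 4 := mul_one _
  set K := 2 * ((1 + 2 / η) * (4 / η))
  have hex := ((hQL.and (hν.filter_mono nhdsWithin_le_nhds)).and
    (eventually_mem_nhdsWithin (a := (0 : ℝ)) (s := {0}ᶜ))).mono
    fun γ ⟨⟨⟨h1, h2⟩, h3⟩, h4⟩ =>
      exists_set_abs_integral_weighted_div_sub_le (Q 0) (Q γ) hπ (hw 0) (hw γ) (hw' 0) (hw' γ)
        (h3.trans hν0.symm) hr h₀ h1 hcent hg (M := M) h4 (Nat.cast_nonneg M) hη hη' h2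
  obtain ⟨A, hA⟩ := hex.choice
  have hid : Tendsto (fun γ : ℝ => γ) (𝓝[≠] 0) (𝓝 0) :=
    tendsto_id.mono_left nhdsWithin_le_nhds
  have hPA : Tendsto (fun γ => (Q 0).real (A γ)) (𝓝[≠] 0) (𝓝 0) := by
    have hlim : Tendsto (fun γ => K * (γ ^ 2 * (2 * V2 γ + ∫ w, g w ^ 2 ∂(Q 0) + s γ)))
        (𝓝[≠] 0) (𝓝 0) := by
      have := (((hid.pow 2).mul (((hV.const_mul 2).add_const (∫ w, g w ^ 2 ∂(Q 0))).add hs)).const_mul K)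
      simpa using this
    refine squeeze_zero' (Eventually.of_forall fun _ => measureReal_nonneg) ?_ hlim
    filter_upwards [hA] with γ hγ using hγ.2.1
  have hgA := tendsto_setIntegral_of_tendsto_measureReal hg.integrable_sq hPA
  have hWA := tendsto_setIntegral_of_tendsto_measureReal iWg.abs hPA
  have hD : Tendsto (fun γ => ∫ w, (√(((Q γ).rnDeriv (Q 0) w).toReal) - 1) ^ 2 ∂(Q 0))
      (𝓝[≠] 0) (𝓝 0) := by
    have hlim : Tendsto (fun γ => γ ^ 2 * (2 * V2 γ + ∫ w, g w ^ 2 ∂(Q 0))) (𝓝[≠] 0) (𝓝 0) := by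
      have := (hid.pow 2).mul ((hV.const_mul 2).add_const (∫ w, g w ^ 2 ∂(Q 0)))
      simpa using this
    refine squeeze_zero' (Eventually.of_forall fun _ => integral_nonneg fun _ => sq_nonneg _) ?_ hlim
    filter_upwards [eventually_mem_nhdsWithin (a := (0 : ℝ)) (s := {0}ᶜ)] with γ hγ
    simpa using setIntegral_sq_sqrt_rnDeriv_sub_one_le (Q 0) (Q γ) hg hγ Set.univ
  -- With M and η fixed, and hence K, all other terms tend to 0. The integrals over `A γ` do so by
  -- absolute continuity, since the mass of `A γ` vanishes. The budget is ε/4 for the truncation,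
  -- ε/4 for the tolerance and ε/2 for these terms.
  have hrest : Tendsto (fun γ => b * √(K * (2 * V2 γ + ∫ w in A γ, g w ^ 2 ∂(Q 0) + s γ))
      + ((b + 2 * n) * √(V2 γ) + (M * (2 * n) *
        √(∫ w, (√(((Q γ).rnDeriv (Q 0) w).toReal) - 1) ^ 2 ∂(Q 0))) + b * √(s γ))
      + ∫ z in A γ, |w 0 (π z) * r z * g z| ∂(Q 0)) (𝓝[≠] 0) (𝓝 0) := by
    have := (((((((hV.const_mul 2).add hgA).add hs).const_mul K).sqrt.const_mul b).add
      (((hV.sqrt.const_mul (b + 2 * n)).add (hD.sqrt.const_mul (M * (2 * n)))).add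
        (hs.sqrt.const_mul b))).add hWA)
    simpa using this
  filter_upwards [hA, hrest.eventually (gt_mem_nhds (show (0 : ℝ) < ε / 2 by positivity)),
    eventually_mem_nhdsWithin (a := (0 : ℝ)) (s := {0}ᶜ)] with γ hγ hlt hne
  rw [Real.dist_eq]
  have hle := hγ.2.2
  have hsq : b * √(((Q γ).singularPart (Q 0)).real Set.univ) / |γ| = b * √(s γ) := by
    rw [hsdef]
    dsimp only
    rw [Real.sqrt_div measureReal_nonneg, Real.sqrt_sq_eq_abs, mul_div_assoc]
  rw [hsq] at hle
  linarith

end Differentiation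

end Efficiency

namespace Efficiency

/-! ### Scores of linear tilts, and efficiency by approximation. -/

section Scores

variable {Θ W : Type*} [MeasurableSpace W]

/-- The Taylor remainder is exactly -(√(1+u) - 1)²/(2γ), and |√(1+u) - 1| ≤ |u| = |γ h|. It is thus
of order γ uniformly, which suffices for bounded tilts. -/
lemma sq_sqrt_one_add_div_sub_le {u γ h c : ℝ} (hu : u = γ * h) (hu1 : -1 ≤ u) (hγ : γ ≠ 0)
    (hh : |h| ≤ c) : ((√(1 + u) - 1) / γ - h / 2) ^ 2 ≤ (γ * c ^ 2 / 2) ^ 2 := by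
  have hs : √(1 + u) ^ 2 = 1 + u := Real.sq_sqrt (by linarith)
  have hs0 := Real.sqrt_nonneg (1 + u)
  have h1 : (√(1 + u) - 1) / γ - h / 2 = -((√(1 + u) - 1) ^ 2 / (2 * γ)) := by
    have : h = (√(1 + u) ^ 2 - 1) / γ := by
      rw [hs, hu]; field_simp; ring
    rw [this]; field_simp; ring
  have h2 : (√(1 + u) - 1) ^ 2 ≤ u ^ 2 := by
    have : u = (√(1 + u) - 1) * (√(1 + u) + 1) := by linarith
    conv_rhs => rw [this]
    rw [mul_pow]
    exact le_mul_of_one_le_right (sq_nonneg _) (one_le_pow₀ (by linarith))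
  have h3 : h ^ 2 ≤ c ^ 2 := by
    rw [← sq_abs h]; exact pow_le_pow_left₀ (abs_nonneg _) hh 2
  rw [h1, neg_sq, ← sq_abs]
  rw [← sq_abs (γ * c ^ 2 / 2)]
  refine pow_le_pow_left₀ (abs_nonneg _) ?_ 2
  have hγ' := abs_pos.2 hγ
  rw [abs_div, abs_div, abs_mul, abs_mul, abs_two, abs_of_nonneg (sq_nonneg (√(1 + u) - 1)),
    abs_of_nonneg (sq_nonneg c), div_le_div_iff₀ (by positivity) two_pos]
  have h4 : u ^ 2 = |γ| ^ 2 * h ^ 2 := by rw [hu, mul_pow, sq_abs]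
  calc (√(1 + u) - 1) ^ 2 * 2 ≤ |γ| ^ 2 * h ^ 2 * 2 := by rw [← h4]; gcongr
    _ ≤ |γ| ^ 2 * c ^ 2 * 2 := by gcongr
    _ = _ := by ring

/-- A linear tilt by a bounded function `h` has score `h`. -/
lemma hasScore_of_eventually_withDensity {Q : ℝ → Measure W} [∀ γ, IsProbabilityMeasure (Q γ)]
    {h : W → ℝ} (hm : Measurable h) {c : ℝ} (hc : ∀ w, |h w| ≤ c)
    (hQ : ∀ᶠ γ in 𝓝 0, Q γ = (Q 0).withDensity fun w => ENNReal.ofReal (1 + γ * h w)) :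
    HasScore Q h := by
  refine ⟨MemLp.of_bound hm.aestronglyMeasurable c (ae_of_all _ hc), ?_⟩
  simp only [lintegral_sq_sqrt_rnDeriv]
  have hlim : Tendsto (fun γ : ℝ => ENNReal.ofReal ((γ * c ^ 2 / 2) ^ 2)) (𝓝[≠] 0) (𝓝 0) := by
    have h1 : Continuous fun γ : ℝ => ENNReal.ofReal ((γ * c ^ 2 / 2) ^ 2) :=
      ENNReal.continuous_ofReal.comp (by fun_prop)
    have h2 := h1.tendsto 0
    simp only [zero_mul, zero_div, ne_eq, OfNat.ofNat_ne_zero, not_false_eq_true, zero_pow,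
      ENNReal.ofReal_zero] at h2
    exact h2.mono_left nhdsWithin_le_nhds
  have hsmall : ∀ᶠ γ : ℝ in 𝓝 0, |γ| * c < 1 := by
    have h1 : Continuous fun γ : ℝ => |γ| * c := by fun_prop
    have h2 := h1.tendsto 0
    simp only [abs_zero, zero_mul] at h2
    exact h2.eventually (gt_mem_nhds one_pos)
  refine tendsto_of_tendsto_of_tendsto_of_le_of_le' tendsto_const_nhds hlim
    (Eventually.of_forall fun _ => zero_le) ?_
  filter_upwards [hQ.filter_mono nhdsWithin_le_nhds, hsmall.filter_mono nhdsWithin_le_nhds,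
    eventually_mem_nhdsWithin (a := (0 : ℝ)) (s := {0}ᶜ)] with γ hγ hsm hne
  have hfm : Measurable fun w => ENNReal.ofReal (1 + γ * h w) := by fun_prop
  have hs : (Q γ).singularPart (Q 0) = 0 := by rw [hγ]; exact Measure.singularPart_withDensity _ _
  have hd : (Q γ).rnDeriv (Q 0) =ᵐ[Q 0] fun w => ENNReal.ofReal (1 + γ * h w) := by
    conv_lhs => rw [hγ]
    exact Measure.rnDeriv_withDensity _ hfm
  rw [hs, Measure.coe_zero, Pi.zero_apply, mul_zero, add_zero]
  calc _ ≤ ∫⁻ _, ENNReal.ofReal ((γ * c ^ 2 / 2) ^ 2) ∂(Q 0) := by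
        refine lintegral_mono_ae ?_
        filter_upwards [hd] with w hw
        have hu : |γ * h w| ≤ 1 := by
          rw [abs_mul]
          exact (mul_le_mul_of_nonneg_left (hc w) (abs_nonneg _)).trans hsm.le
        have hu' := (abs_le.1 hu).1
        rw [hw, ENNReal.toReal_ofReal (by linarith)]
        exact ENNReal.ofReal_le_ofReal (sq_sqrt_one_add_div_sub_le rfl hu' hne (hc w))
    _ = _ := by rw [lintegral_const, measure_univ, mul_one]

lemma eLpNorm_two_eq_ofReal_sqrt {P : Measure W} {f : W → ℝ} (hf : MemLp f 2 P) :
    eLpNorm f 2 P = ENNReal.ofReal (√(∫ w, f w ^ 2 ∂P)) := by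
  rw [hf.eLpNorm_eq_integral_rpow_norm two_ne_zero ENNReal.ofNat_ne_top, Real.sqrt_eq_rpow]
  simp

/-- An influence function that can be approximated by scores is efficient, and its second moment is
the efficiency lower bound. -/
theorem IsInfluenceFunction.efficient_of_approx {obs : Θ → Measure W} {χ : Θ → ℝ} {θ₀ : Θ}
    {Γ : Set (ℝ → Θ)} {ψ : W → ℝ} (hψ : IsInfluenceFunction obs χ θ₀ Γ ψ)
    (hΓ : ∀ path ∈ Γ, path 0 = θ₀)
    (happ : ∀ ε : ℝ, 0 < ε → ∃ g ∈ tangentSet obs Γ, ∫ w, (ψ w - g w) ^ 2 ∂(obs θ₀) < ε) :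
    IsEfficientInfluenceFunction obs χ θ₀ Γ ψ ∧
      efficiencyLowerBound obs χ θ₀ Γ = ENNReal.ofReal (∫ w, ψ w ^ 2 ∂(obs θ₀)) := by
  have hmem : ∀ path ∈ Γ, ∀ g : W → ℝ, HasScore (fun γ => obs (path γ)) g →
      MemLp g 2 (obs θ₀) := by
    intro path hp g hg
    have h := hg.1
    simp only [hΓ path hp] at h
    exact h
  refine ⟨⟨hψ, fun η hη => ?_⟩, le_antisymm ?_ ?_⟩
  -- The minimum with 1 covers η = ∞.
  · set η' : ℝ := (min η 1).toReal
    have hη'ne : min η 1 ≠ ∞ := ne_top_of_le_ne_top ENNReal.one_ne_top (min_le_right _ _)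
    have hη' : 0 < η' := ENNReal.toReal_pos (lt_min hη one_pos).ne' hη'ne
    obtain ⟨g, hgT, hlt⟩ := happ (η' ^ 2) (by positivity)
    obtain ⟨path, hp, hg⟩ := hgT
    refine ⟨g, Submodule.subset_span ⟨path, hp, hg⟩, ?_⟩
    have hL : MemLp (fun w => ψ w - g w) 2 (obs θ₀) := hψ.1.sub (hmem path hp g hg)
    rw [eLpNorm_two_eq_ofReal_sqrt hL]
    refine lt_of_lt_of_le ?_ (min_le_left η 1)
    rw [← ENNReal.ofReal_toReal hη'ne, ENNReal.ofReal_lt_ofReal_iff hη', Real.sqrt_lt' hη']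
    exact hlt
  · refine iSup_le fun path => iSup_le fun hp => iSup_le fun g => iSup_le fun hg => iSup_le fun d =>
      iSup_le fun hd => ENNReal.div_le_of_le_mul ?_
    have e : d = ∫ w, ψ w * g w ∂(obs θ₀) := hd.unique (hψ.2 path hp g hg)
    have hcs := abs_integral_mul_le_sqrt_mul_sqrt hψ.1 (hmem path hp g hg)
    have h1 : 0 ≤ ∫ w, ψ w ^ 2 ∂(obs θ₀) := integral_nonneg fun _ => sq_nonneg _
    have h2 : 0 ≤ ∫ w, g w ^ 2 ∂(obs θ₀) := integral_nonneg fun _ => sq_nonneg _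
    rw [← ENNReal.ofReal_mul h1]
    refine ENNReal.ofReal_le_ofReal ?_
    rw [← e] at hcs
    have := pow_le_pow_left₀ (abs_nonneg _) hcs 2
    rwa [sq_abs, mul_pow, Real.sq_sqrt h1, Real.sq_sqrt h2] at this
  · refine ENNReal.le_of_forall_pos_le_add fun ε hε _ => ?_
    obtain ⟨g, ⟨path, hp, hg⟩, hlt⟩ := happ ε (by exact_mod_cast hε)
    have hgL := hmem path hp g hg
    set s := ∫ w, ψ w ^ 2 ∂(obs θ₀)
    set G := ∫ w, g w ^ 2 ∂(obs θ₀)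
    set d := ∫ w, ψ w * g w ∂(obs θ₀)
    have hG : 0 ≤ G := integral_nonneg fun _ => sq_nonneg _
    have he : ∫ w, (ψ w - g w) ^ 2 ∂(obs θ₀) = s - 2 * d + G := by
      have i1 := hψ.1.integrable_sq
      have i2 : Integrable (fun w => 2 * (ψ w * g w)) (obs θ₀) :=
        (hψ.1.integrable_mul hgL).const_mul 2
      have i3 := hgL.integrable_sq
      have i4 : Integrable (fun w => ψ w ^ 2 - 2 * (ψ w * g w)) (obs θ₀) := i1.sub i2
      rw [← integral_const_mul, ← integral_sub i1 i2, ← integral_add i4 i3]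
      refine integral_congr_ae (ae_of_all _ fun w => ?_)
      ring
    rw [he] at hlt
    -- The left side is 2d - G, and 2d - G ≤ d²/G because (d - G)² ≥ 0. If G = 0 then d = 0 by
    -- Cauchy-Schwarz, and the convention 0/0 = 0 agrees.
    have hle : ENNReal.ofReal (s - (s - 2 * d + G)) ≤ ENNReal.ofReal (d ^ 2) / ENNReal.ofReal G := by
      rcases hG.eq_or_lt with hG0 | hGpos
      · have hcs := abs_integral_mul_le_sqrt_mul_sqrt hψ.1 hgL
        have hd0 : d = 0 := by
          have : |d| ≤ √s * √G := hcs
          rw [← hG0, Real.sqrt_zero, mul_zero] at this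
          exact abs_eq_zero.1 (le_antisymm this (abs_nonneg _))
        rw [hd0, ← hG0]
        simp
      · rw [ENNReal.le_div_iff_mul_le (Or.inl (ENNReal.ofReal_pos.2 hGpos).ne')
          (Or.inl ENNReal.ofReal_ne_top), ← ENNReal.ofReal_mul' hG]
        refine ENNReal.ofReal_le_ofReal ?_
        nlinarith [sq_nonneg (d - G)]
    calc ENNReal.ofReal s = ENNReal.ofReal (s - (s - 2 * d + G) + (s - 2 * d + G)) := by
          congr 1; ring
      _ ≤ ENNReal.ofReal (s - (s - 2 * d + G)) + ENNReal.ofReal (s - 2 * d + G) :=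
          ENNReal.ofReal_add_le
      _ ≤ efficiencyLowerBound obs χ θ₀ Γ + ε := by
          refine add_le_add (hle.trans ?_) ?_
          · refine le_iSup_of_le path (le_iSup_of_le hp (le_iSup_of_le g (le_iSup_of_le hg
              (le_iSup_of_le d (le_iSup_of_le (hψ.2 path hp g hg) le_rfl)))))
          · rw [← ENNReal.ofReal_coe_nnreal]
            exact ENNReal.ofReal_le_ofReal hlt.le

end Scores

end Efficiency

/-! ### Densities, composition products and conditioning. -/

section Measure

variable {α β : Type*} [MeasurableSpace α] [MeasurableSpace β]

lemma MeasureTheory.Measure.withDensity_fst_compProd (μ : Measure α) [SFinite μ] (κ : Kernel α β)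
    [IsSFiniteKernel κ] {f : α → ℝ≥0∞} (hf : Measurable f) [SFinite (μ.withDensity f)] :
    (μ ⊗ₘ κ).withDensity (fun z => f z.1) = μ.withDensity f ⊗ₘ κ := by
  have hf' : Measurable fun z : α × β => f z.1 := hf.comp measurable_fst
  refine Measure.ext_of_lintegral _ fun g hg => ?_
  rw [lintegral_withDensity_eq_lintegral_mul _ hf' hg,
    Measure.lintegral_compProd (hf'.mul hg), Measure.lintegral_compProd hg,
    lintegral_withDensity_eq_lintegral_mul _ hf hg.lintegral_kernel_prod_right']
  refine lintegral_congr fun a => ?_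
  simp only [Pi.mul_apply]
  rw [lintegral_const_mul _ (by fun_prop)]

lemma MeasureTheory.Measure.map_withDensity_comp {μ : Measure α} {f : α → β} (hf : Measurable f)
    {g : β → ℝ≥0∞} (hg : Measurable g) :
    (μ.withDensity fun a => g (f a)).map f = (μ.map f).withDensity g := by
  ext s hs
  rw [Measure.map_apply hf hs, withDensity_apply _ (hf hs), withDensity_apply _ hs,
    setLIntegral_map hs hg hf]

/-- Multiply by 1/f. It serves to cancel the propensity, which overlap makes positive, after a
comparison within one arm. -/
lemma MeasureTheory.Measure.eq_of_withDensity_eq {μ ν : Measure α} {f : α → ℝ≥0∞}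
    (hf : Measurable f) (hμ : ∀ᵐ a ∂μ, f a ≠ 0 ∧ f a ≠ ∞) (hν : ∀ᵐ a ∂ν, f a ≠ 0 ∧ f a ≠ ∞)
    (h : μ.withDensity f = ν.withDensity f) : μ = ν := by
  rw [← withDensity_inv_same hf (hμ.mono fun _ h => h.1) (hμ.mono fun _ h => h.2), h,
    withDensity_inv_same hf (hν.mono fun _ h => h.1) (hν.mono fun _ h => h.2)]

lemma MeasureTheory.Measure.restrict_eq_smul_cond (μ : Measure α) [IsFiniteMeasure μ] (s : Set α) :
    μ.restrict s = μ s • ProbabilityTheory.cond μ s := by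
  rcases eq_or_ne (μ s) 0 with h | h
  · rw [h, zero_smul, Measure.restrict_eq_zero.2 h]
  · rw [ProbabilityTheory.cond, smul_smul, ENNReal.mul_inv_cancel h (measure_ne_top _ _), one_smul]

end Measure

/-! ### Variables of a unit and laws restricted to an arm. -/

namespace Surrogate

variable {𝒳 𝒮 : Type*} [MeasurableSpace 𝒳] [MeasurableSpace 𝒮]

@[fun_prop]
lemma measurable_trt : Measurable (trt : FullData 𝒳 𝒮 → Bool) := measurable_fst.comp measurable_snd

attribute [fun_prop] measurable_cov

@[fun_prop]
lemma measurable_surr (t : Bool) : Measurable (surr t : FullData 𝒳 𝒮 → 𝒮) :=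
  (measurable_pi_apply t).comp (measurable_fst.comp (measurable_snd.comp measurable_snd))

@[fun_prop]
lemma measurable_out (t : Bool) : Measurable (out t : FullData 𝒳 𝒮 → ℝ) :=
  (measurable_pi_apply t).comp (measurable_snd.comp (measurable_snd.comp measurable_snd))

lemma measurableSet_arm (t : Bool) : MeasurableSet (arm t : Set (FullData 𝒳 𝒮)) :=
  measurable_trt (measurableSet_singleton t)

@[fun_prop]
lemma measurable_surrObs : Measurable (surrObs : FullData 𝒳 𝒮 → 𝒮) := by
  classical
  have h : (surrObs : FullData 𝒳 𝒮 → 𝒮)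
      = fun v => if v ∈ arm true then surr true v else surr false v := by
    funext v
    rcases h : trt v <;> simp [surrObs, arm, h]
  rw [h]
  exact Measurable.ite (measurableSet_arm true) (measurable_surr true) (measurable_surr false)

@[fun_prop]
lemma measurable_outObs : Measurable (outObs : FullData 𝒳 𝒮 → ℝ) := by
  classical
  have h : (outObs : FullData 𝒳 𝒮 → ℝ)
      = fun v => if v ∈ arm true then out true v else out false v := by
    funext v
    rcases h : trt v <;> simp [outObs, arm, h]
  rw [h]
  exact Measurable.ite (measurableSet_arm true) (measurable_out true) (measurable_out false)

@[fun_prop]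
lemma measurable_covTrtSurr : Measurable (covTrtSurr : FullData 𝒳 𝒮 → 𝒳 × Bool × 𝒮) :=
  measurable_cov.prodMk (measurable_trt.prodMk measurable_surrObs)

@[fun_prop]
lemma measurable_observe : Measurable (observe : FullData 𝒳 𝒮 → Obs 𝒳 𝒮) :=
  measurable_cov.prodMk (measurable_trt.prodMk (measurable_surrObs.prodMk measurable_outObs))

/-- A pair `(x, s)`, placed in arm `t`. -/
def inArm (t : Bool) (z : 𝒳 × 𝒮) : 𝒳 × Bool × 𝒮 := (z.1, t, z.2)

@[fun_prop]
lemma measurable_inArm (t : Bool) : Measurable (inArm t : 𝒳 × 𝒮 → 𝒳 × Bool × 𝒮) := by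
  unfold inArm; fun_prop

lemma measurable_of_comp_inArm {β : Type*} [MeasurableSpace β] {f : 𝒳 × Bool × 𝒮 → β}
    (h : ∀ t, Measurable fun z => f (inArm t z)) : Measurable f := by
  classical
  have e : f = fun z : 𝒳 × Bool × 𝒮 => if z.2.1 = true then f (inArm true (z.1, z.2.2))
      else f (inArm false (z.1, z.2.2)) := by
    funext ⟨x, t, s⟩
    rcases t <;> simp [inArm]
  rw [e]
  exact Measurable.ite ((measurable_fst.comp measurable_snd) (measurableSet_singleton true))
    ((h true).comp (by fun_prop)) ((h false).comp (by fun_prop))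

lemma ae_restrict_arm (m : Measure (FullData 𝒳 𝒮)) (t : Bool) :
    ∀ᵐ v ∂(m.restrict (arm t)), trt v = t ∧ surrObs v = surr t v ∧ outObs v = out t v := by
  filter_upwards [ae_restrict_mem (measurableSet_arm t)] with v hv
  have : trt v = t := hv
  simp [surrObs, outObs, this]

/-- The law of `X` in an arm has the arm probability as density. -/
lemma map_cov_restrict_arm (m : Measure (FullData 𝒳 𝒮)) [IsFiniteMeasure m] (t : Bool) :
    (m.restrict (arm t)).map cov
      = (m.map cov).withDensity fun x => condDistrib trt cov m x {t} := by
  ext s hs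
  rw [Measure.map_apply measurable_cov hs, Measure.restrict_apply (measurable_cov hs),
    withDensity_apply _ hs, setLIntegral_map hs
      (Kernel.measurable_coe _ (measurableSet_singleton t)) measurable_cov,
    setLIntegral_preimage_condDistrib measurable_cov measurable_trt.aemeasurable
      (measurableSet_singleton t) hs]
  rfl

/-- A conditional distribution given an arm, in terms of the restriction to the arm. -/
lemma map_restrict_arm_of_cond {β γ : Type*} [MeasurableSpace β] [MeasurableSpace γ]
    (m : Measure (FullData 𝒳 𝒮)) [IsFiniteMeasure m] (t : Bool) {f : FullData 𝒳 𝒮 → β}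
    {g : FullData 𝒳 𝒮 → γ} {κ : Kernel β γ} [IsSFiniteKernel κ]
    (h : (ProbabilityTheory.cond m (arm t)).map (fun v => (f v, g v))
      = (ProbabilityTheory.cond m (arm t)).map f ⊗ₘ κ) :
    (m.restrict (arm t)).map (fun v => (f v, g v)) = (m.restrict (arm t)).map f ⊗ₘ κ := by
  rw [Measure.restrict_eq_smul_cond m (arm t), Measure.map_smul, Measure.map_smul, h,
    Measure.compProd_smul_left]

lemma map_cov_surrObs_restrict_arm [StandardBorelSpace 𝒮] [Nonempty 𝒮]
    (m : Measure (FullData 𝒳 𝒮)) [IsFiniteMeasure m] (t : Bool) :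
    (m.restrict (arm t)).map (fun v => (cov v, surrObs v))
      = ((m.map cov).withDensity fun x => condDistrib trt cov m x {t}) ⊗ₘ
        condDistrib surrObs cov (ProbabilityTheory.cond m (arm t)) := by
  rw [← map_cov_restrict_arm]
  exact map_restrict_arm_of_cond m t
    (compProd_map_condDistrib measurable_surrObs.aemeasurable).symm

/-- A conditional distribution of the actual outcome given `(X, T, S)` restricts to one in each
arm. -/
lemma map_restrict_arm_of_covTrtSurr (m : Measure (FullData 𝒳 𝒮)) [IsFiniteMeasure m] (t : Bool)
    {K : Kernel (𝒳 × Bool × 𝒮) ℝ} [IsSFiniteKernel K]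
    (h : m.map (fun v => (covTrtSurr v, outObs v)) = m.map covTrtSurr ⊗ₘ K) :
    (m.restrict (arm t)).map (fun v => ((cov v, surrObs v), outObs v))
      = (m.restrict (arm t)).map (fun v => (cov v, surrObs v)) ⊗ₘ
        K.comap (inArm t) (measurable_inArm t) := by
  classical
  refine Measure.ext_of_lintegral _ fun f hf => ?_
  have hset : MeasurableSet {z : 𝒳 × Bool × 𝒮 | z.2.1 = t} :=
    (measurable_fst.comp measurable_snd) (measurableSet_singleton t)
  set F : (𝒳 × Bool × 𝒮) × ℝ → ℝ≥0∞ := fun z =>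
    {z : 𝒳 × Bool × 𝒮 | z.2.1 = t}.indicator 1 z.1 * f ((z.1.1, z.1.2.2), z.2) with hF
  have hFm : Measurable F := ((measurable_one.indicator hset).comp measurable_fst).mul
    (hf.comp (by fun_prop))
  have h1 := congrArg (fun μ => ∫⁻ z, F z ∂μ) h
  beta_reduce at h1
  rw [lintegral_map hFm (by fun_prop), Measure.lintegral_compProd hFm,
    lintegral_map hFm.lintegral_kernel_prod_right' (by fun_prop)] at h1
  have hind : ∀ v : FullData 𝒳 𝒮, {z : 𝒳 × Bool × 𝒮 | z.2.1 = t}.indicator (1 : 𝒳 × Bool × 𝒮 → ℝ≥0∞)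
      (covTrtSurr v) = (arm t).indicator 1 v := fun v => rfl
  rw [lintegral_map hf (by fun_prop), Measure.lintegral_compProd hf,
    lintegral_map hf.lintegral_kernel_prod_right' (by fun_prop),
    ← lintegral_indicator (measurableSet_arm t), ← lintegral_indicator (measurableSet_arm t)]
  convert h1 using 1
  · refine lintegral_congr fun v => ?_
    simp only [hF, hind]
    by_cases hv : v ∈ arm t
    · simp [hv, covTrtSurr]
    · simp [hv]
  · refine lintegral_congr fun v => ?_
    simp only [hF, hind]
    by_cases hv : v ∈ arm t
    · have : trt v = t := hv
      simp [hv, covTrtSurr, inArm, this, Kernel.comap_apply]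
    · simp [hv]

end Surrogate

/-! ### The weights and their effect on labelled covariates and surrogates. -/

namespace Surrogate

namespace Population

variable {𝒳 𝒮 : Type*} [MeasurableSpace 𝒳] [MeasurableSpace 𝒮]

lemma real_singleton_false (μ : Measure Bool) [IsProbabilityMeasure μ] :
    μ.real {false} = 1 - μ.real {true} := by
  rw [← probReal_compl_eq_one_sub (measurableSet_singleton true)]
  congr 1
  ext b
  simp

lemma real_singleton_pos_of_mem_Ioo {μ : Measure Bool} [IsProbabilityMeasure μ]
    (h : 0 < μ.real {true} ∧ μ.real {true} < 1) (t : Bool) : 0 < μ.real {t} := by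
  cases t
  · rw [real_singleton_false]; linarith [h.2]
  · exact h.1

lemma measurable_ratioCov (p : Population 𝒳 𝒮) : Measurable p.ratioCov :=
  (Measure.measurable_rnDeriv _ _).ennreal_toReal

/-- The sign with which the mean outcome in an arm enters the average treatment effect. -/
def armSign (t : Bool) : ℝ := if t then 1 else -1

lemma measurable_armSign : Measurable armSign := measurable_of_finite _

/-- Forget the outcome. -/
def dropOut (w : Obs 𝒳 𝒮) : 𝒳 × Bool × 𝒮 := (w.1, w.2.1, w.2.2.1)

@[fun_prop]
lemma measurable_dropOut : Measurable (dropOut : Obs 𝒳 𝒮 → 𝒳 × Bool × 𝒮) := by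
  unfold dropOut; fun_prop

lemma measurable_outcomeReg (p : Population 𝒳 𝒮) :
    Measurable fun z : 𝒳 × Bool × 𝒮 => p.outcomeReg z.2.1 z.1 z.2.2 := by
  have h : StronglyMeasurable fun z : 𝒳 × Bool × 𝒮 =>
      ∫ y, y ∂(condDistrib outObs covTrtSurr p.labelled z) :=
    StronglyMeasurable.integral_condDistrib (f := fun q : (𝒳 × Bool × 𝒮) × ℝ => q.2)
      measurable_snd.stronglyMeasurable
  exact h.measurable

/-- The signed residual of the outcome. -/
def signedResidual (p : Population 𝒳 𝒮) (w : Obs 𝒳 𝒮) : ℝ :=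
  armSign w.2.1 * (w.2.2.2 - p.outcomeReg w.2.1 w.1 w.2.2.1)

lemma measurable_signedResidual (p : Population 𝒳 𝒮) : Measurable p.signedResidual :=
  (measurable_armSign.comp (by fun_prop)).mul
    ((by fun_prop : Measurable fun w : Obs 𝒳 𝒮 => w.2.2.2).sub
      (p.measurable_outcomeReg.comp measurable_dropOut))

variable [StandardBorelSpace 𝒮] [Nonempty 𝒮]

instance (p : Population 𝒳 𝒮) (t : Bool) : IsMarkovKernel (p.surrKernel t) := by
  unfold surrKernel; infer_instance

instance (p : Population 𝒳 𝒮) (t : Bool) : IsMarkovKernel (p.surrKernelLabelled t) := by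
  unfold surrKernelLabelled; infer_instance

/-- The density of the law of `(X, S)`, had the covariates the unconditional law and the surrogate
the unconditional law in its arm, with respect to the labelled law in that arm. -/
def weight (p : Population 𝒳 𝒮) (z : 𝒳 × Bool × 𝒮) : ℝ :=
  p.ratioCov z.1 * p.ratioSurr z.2.1 z.2.2 z.1 / (condDistrib trt cov p.labelled z.1).real {z.2.1}

lemma weight_nonneg (p : Population 𝒳 𝒮) (z : 𝒳 × Bool × 𝒮) : 0 ≤ p.weight z :=
  div_nonneg (mul_nonneg ENNReal.toReal_nonneg ENNReal.toReal_nonneg) measureReal_nonneg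

lemma measurable_weight (p : Population 𝒳 𝒮) : Measurable p.weight := by
  refine measurable_of_comp_inArm fun t => ?_
  have h1 : Measurable fun z : 𝒳 × 𝒮 => p.ratioSurr t z.2 z.1 :=
    (Kernel.measurable_rnDeriv (p.surrKernel t) (p.surrKernelLabelled t)).ennreal_toReal
  have h2 : Measurable fun z : 𝒳 × 𝒮 => (condDistrib trt cov p.labelled z.1).real {t} :=
    ((Kernel.measurable_coe _ (measurableSet_singleton t)).comp measurable_fst).ennreal_toReal
  exact ((p.measurable_ratioCov.comp measurable_fst).mul h1).div h2

/-- Only one arm indicator is nonzero, so the difference collapses to a product: a weight in (X,T,S)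
that moves with the population, and a residual fixed at `p₀`. The differentiation theorem needs this
form. -/
lemma weightedResidual_eq (p p₀ : Population 𝒳 𝒮) (w : Obs 𝒳 𝒮) :
    p.weightedResidual p₀ w = p.weight (dropOut w) * p₀.signedResidual w := by
  obtain ⟨x, t, s, y⟩ := w
  cases t
  · simp [weightedResidual, weight, signedResidual, dropOut, armSign, propensityLabelled,
      real_singleton_false]
    ring
  · simp [weightedResidual, weight, signedResidual, dropOut, armSign, propensityLabelled]

lemma measurable_weightedResidual (p p₀ : Population 𝒳 𝒮) :
    Measurable (p.weightedResidual p₀) := by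
  rw [funext (p.weightedResidual_eq p₀)]
  exact (p.measurable_weight.comp measurable_dropOut).mul p₀.measurable_signedResidual

variable [StandardBorelSpace 𝒳] {ε C : ℝ} {p : Population 𝒳 𝒮}

lemma Admissible.condDistrib_trt_singleton_pos (hε : 0 < ε) (hp : p.Admissible ε C) (t : Bool) :
    ∀ᵐ x ∂(p.law.map cov), condDistrib trt cov p.law x {t} ≠ 0 := by
  filter_upwards [hp.overlap] with x hx h0
  have h := real_singleton_pos_of_mem_Ioo (μ := condDistrib trt cov p.law x)
    ⟨hε.trans_le hx.1, by linarith [show p.propensity x ≤ 1 - ε from hx.2,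
      show (condDistrib trt cov p.law x).real {true} = p.propensity x from rfl]⟩ t
  rw [measureReal_def, h0] at h
  simp at h

/-- The weights turn the labelled law of `(X, S)` in an arm into the law of `X` followed by the
conditional law of `S` in the arm. -/
lemma Admissible.withDensity_weight_arm (hp : p.Admissible ε C) (t : Bool) :
    ((p.labelled.restrict (arm t)).map fun v => (cov v, surrObs v)).withDensity
        (fun z => ENNReal.ofReal (p.weight (inArm t z)))
      = p.law.map cov ⊗ₘ p.surrKernel t := by
  rw [map_cov_surrObs_restrict_arm]
  set L := p.labelled.map cov
  set Λ := (p.law.map cov).rnDeriv L with hΛ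
  set E : 𝒳 → ℝ≥0∞ := fun x => condDistrib trt cov p.labelled x {t} with hE
  have hEm : Measurable E := Kernel.measurable_coe _ (measurableSet_singleton t)
  have hΛm : Measurable Λ := Measure.measurable_rnDeriv _ _
  have hX : p.law.map cov = L.withDensity Λ := (Measure.withDensity_rnDeriv_eq _ _ hp.ratioCov_ac).symm
  have hae := ((hp.ratioSurr_ac t).and hp.overlap_labelled)
  have hwm : Measurable fun z : 𝒳 × 𝒮 => ENNReal.ofReal (p.weight (inArm t z)) :=
    (p.measurable_weight.comp (measurable_inArm t)).ennreal_ofReal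
  change (L.withDensity E ⊗ₘ p.surrKernelLabelled t).withDensity _ = _
  have : IsFiniteMeasure (L.withDensity E) := by
    refine isFiniteMeasure_withDensity ?_
    refine ne_top_of_le_ne_top (measure_ne_top L Set.univ) ?_
    calc ∫⁻ x, E x ∂L ≤ ∫⁻ _, 1 ∂L := lintegral_mono fun x => prob_le_one
      _ = _ := lintegral_one
  have : IsFiniteMeasure (L.withDensity Λ) := by rw [← hX]; infer_instance
  rw [hX, ae_withDensity_iff hΛm] at hae
  rw [hX]
  refine Measure.ext_of_lintegral _ fun f hf => ?_
  rw [lintegral_withDensity_eq_lintegral_mul _ hwm hf, Measure.lintegral_compProd (hwm.mul hf),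
    lintegral_withDensity_eq_lintegral_mul _ hEm (hwm.mul hf).lintegral_kernel_prod_right',
    Measure.lintegral_compProd hf,
    lintegral_withDensity_eq_lintegral_mul _ hΛm hf.lintegral_kernel_prod_right']
  refine lintegral_congr_ae ?_
  filter_upwards [hae, Measure.rnDeriv_lt_top (p.law.map cov) L] with x hx hfin
  simp only [Pi.mul_apply]
  have hfx : Measurable fun s => f (x, s) := hf.comp measurable_prodMk_left
  have hwx : Measurable fun s => ENNReal.ofReal (p.weight (inArm t (x, s))) :=
    hwm.comp measurable_prodMk_left
  -- Absolute continuity and labelled overlap are known only almost surely for the unconditional law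
  -- of X, that is, where Λ ≠ 0. Elsewhere both sides vanish, the weight containing the factor λ(x)
  -- = 0.
  by_cases h0 : Λ x = 0
  · have hw0 : ∀ s, p.weight (inArm t (x, s)) = 0 := fun s => by
      have : p.ratioCov x = 0 := by
        rw [ratioCov]; change (Λ x).toReal = 0; rw [h0, ENNReal.toReal_zero]
      simp [weight, inArm, this]
    simp [hw0, h0]
  · obtain ⟨hac, hov⟩ := hx h0
    have hEpos : 0 < (condDistrib trt cov p.labelled x).real {t} :=
      real_singleton_pos_of_mem_Ioo hov t
    have hm1 : Measurable fun s => ENNReal.ofReal (p.weight (inArm t (x, s))) * f (x, s) :=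
      hwx.mul hfx
    have hm2 : Measurable fun s =>
        (p.surrKernel t x).rnDeriv (p.surrKernelLabelled t x) s * f (x, s) :=
      (Measure.measurable_rnDeriv _ _).mul hfx
    rw [← lintegral_const_mul _ hm1, ← lintegral_rnDeriv_mul hac hfx.aemeasurable,
      ← lintegral_const_mul _ hm2]
    refine lintegral_congr_ae ?_
    filter_upwards [Kernel.rnDeriv_eq_rnDeriv_measure (κ := p.surrKernel t)
      (η := p.surrKernelLabelled t) (a := x),
      Measure.rnDeriv_lt_top (p.surrKernel t x) (p.surrKernelLabelled t x)] with s hs hs'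
    rw [← mul_assoc, ← mul_assoc]
    congr 1
    have hEx : E x = ENNReal.ofReal ((condDistrib trt cov p.labelled x).real {t}) :=
      (ofReal_measureReal).symm
    have hwt : p.weight (inArm t (x, s)) = (Λ x).toReal
        * ((p.surrKernel t x).rnDeriv (p.surrKernelLabelled t x) s).toReal
        / (condDistrib trt cov p.labelled x).real {t} := by
      simp only [weight, inArm, ratioCov, ratioSurr, hs]
      rfl
    rw [hEx, hwt, ← ENNReal.ofReal_mul hEpos.le, mul_div_cancel₀ _ hEpos.ne',
      ENNReal.ofReal_mul ENNReal.toReal_nonneg, ENNReal.ofReal_toReal hfin.ne,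
      ENNReal.ofReal_toReal hs'.ne]

end Population

end Surrogate

/-! ### Identification of the potential-outcome laws. -/

namespace Surrogate

namespace Population

variable {𝒳 𝒮 : Type*} [MeasurableSpace 𝒳] [MeasurableSpace 𝒮] [StandardBorelSpace 𝒮] [Nonempty 𝒮]
  [StandardBorelSpace 𝒳] {ε C : ℝ} {p : Population 𝒳 𝒮}

/-- By unconfoundedness, restricting to an arm multiplies the law of a potential pair by the
propensity. -/
lemma Admissible.map_restrict_arm_potential (hp : p.Admissible ε C) (t : Bool) :
    (p.law.restrict (arm t)).map (fun v => (cov v, out t v, surr t v))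
      = (p.law.map fun v => (cov v, out t v, surr t v)).withDensity
        fun z => condDistrib trt cov p.law z.1 {t} := by
  have h := (condIndepFun_iff_map_prod_eq_prod_condDistrib_prod_condDistrib (μ := p.law)
    (by fun_prop : Measurable fun v : FullData 𝒳 𝒮 => (out t v, surr t v)) measurable_trt
    measurable_cov).1 (hp.unconfounded_trt t)
  have hem : Measurable fun x => condDistrib trt cov p.law x {t} :=
    Kernel.measurable_coe _ (measurableSet_singleton t)
  have hem2 : Measurable fun z : 𝒳 × ℝ × 𝒮 => condDistrib trt cov p.law z.1 {t} :=
    hem.comp measurable_fst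
  refine Measure.ext_prod fun {A B} hA hB => ?_
  have hAB := congrArg (fun μ => μ (A ×ˢ (B ×ˢ {t}))) h
  beta_reduce at hAB
  rw [Measure.map_apply (by fun_prop) (hA.prod (hB.prod (measurableSet_singleton t))),
    Measure.bind_apply (hA.prod (hB.prod (measurableSet_singleton t)))
      (Kernel.aemeasurable _)] at hAB
  rw [Measure.map_apply (by fun_prop) (hA.prod hB), Measure.restrict_apply
    ((by fun_prop : Measurable fun v : FullData 𝒳 𝒮 => (cov v, out t v, surr t v)) (hA.prod hB))]
  have hset : (fun v : FullData 𝒳 𝒮 => (cov v, out t v, surr t v)) ⁻¹' A ×ˢ B ∩ arm t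
      = (fun v : FullData 𝒳 𝒮 => (cov v, (out t v, surr t v), trt v)) ⁻¹' A ×ˢ B ×ˢ {t} := by
    ext v
    simp [arm, and_assoc]
  rw [hset, hAB, withDensity_apply _ (hA.prod hB),
    ← compProd_map_condDistrib (X := cov)
      (by fun_prop : AEMeasurable (fun v : FullData 𝒳 𝒮 => (out t v, surr t v)) p.law),
    Measure.setLIntegral_compProd hem2 hA hB,
    ← lintegral_indicator hA]
  refine lintegral_congr fun x => ?_
  simp only [Kernel.prod_apply_prod, Kernel.id_apply, Measure.dirac_apply' _ hA, lintegral_const,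
    MeasurableSet.univ, Measure.restrict_apply, Set.univ_inter]
  by_cases hx : x ∈ A <;> simp [hx, mul_comm]

/-- The law of `(X, S(t))`. -/
lemma Admissible.map_cov_surr (hε : 0 < ε) (hp : p.Admissible ε C) (t : Bool) :
    p.law.map (fun v => (cov v, surr t v)) = p.law.map cov ⊗ₘ p.surrKernel t := by
  have hem : Measurable fun x => condDistrib trt cov p.law x {t} :=
    Kernel.measurable_coe _ (measurableSet_singleton t)
  have hem' : Measurable fun z : 𝒳 × 𝒮 => condDistrib trt cov p.law z.1 {t} :=
    hem.comp measurable_fst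
  have hpos := hp.condDistrib_trt_singleton_pos hε t
  have hpos' : ∀ᵐ x ∂(p.law.map cov), condDistrib trt cov p.law x {t} ≠ 0
      ∧ condDistrib trt cov p.law x {t} ≠ ∞ := hpos.mono fun x hx => ⟨hx, measure_ne_top _ _⟩
  have hms : MeasurableSet {x | condDistrib trt cov p.law x {t} ≠ 0
      ∧ condDistrib trt cov p.law x {t} ≠ ∞} :=
    ((hem (measurableSet_singleton 0)).compl).inter ((hem (measurableSet_singleton ∞)).compl)
  have hms' : MeasurableSet {z : 𝒳 × 𝒮 | condDistrib trt cov p.law z.1 {t} ≠ 0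
      ∧ condDistrib trt cov p.law z.1 {t} ≠ ∞} := measurable_fst hms
  -- After multiplication by the propensity both sides are the law of (X,S) in arm t: the left one
  -- by unconfoundedness together with S = S(t) there, the right one by the definition of the
  -- conditional law of S.
  refine Measure.eq_of_withDensity_eq hem' ?_ (Measure.ae_compProd_of_ae_fst _ hms hpos') ?_
  · rw [ae_map_iff (by fun_prop) hms']
    exact ae_of_ae_map measurable_cov.aemeasurable hpos'
  · have : IsFiniteMeasure ((p.law.map cov).withDensity
        fun x => condDistrib trt cov p.law x {t}) := by
      rw [← map_cov_restrict_arm]; infer_instance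
    rw [Measure.withDensity_fst_compProd _ _ hem]
    have h1 := map_cov_surrObs_restrict_arm p.law t
    have h2 : (p.law.restrict (arm t)).map (fun v => (cov v, surrObs v))
        = (p.law.restrict (arm t)).map (fun v => (cov v, surr t v)) := by
      refine Measure.map_congr ?_
      filter_upwards [ae_restrict_arm p.law t] with v hv
      rw [hv.2.1]
    have h3 := congrArg (fun μ => μ.map fun z : 𝒳 × ℝ × 𝒮 => (z.1, z.2.2))
      (hp.map_restrict_arm_potential t)
    beta_reduce at h3
    rw [Measure.map_map (by fun_prop) (by fun_prop)] at h3
    have h4 := Measure.map_withDensity_comp (μ := p.law.map fun v => (cov v, out t v, surr t v))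
      (f := fun z : 𝒳 × ℝ × 𝒮 => (z.1, z.2.2)) (by fun_prop) hem'
    beta_reduce at h4
    rw [h4, Measure.map_map (by fun_prop) (by fun_prop)] at h3
    exact h3.symm.trans (h2.symm.trans h1)

/-- The conditional law of `Y(t)` given `(X, T = t, S(t))` is that given `(X, S(t))`. -/
lemma Admissible.exists_kernel_out (hε : 0 < ε) (hp : p.Admissible ε C) (t : Bool) :
    ∃ κ : Kernel (𝒳 × 𝒮) ℝ, IsMarkovKernel κ ∧
      p.law.map (fun v => ((cov v, surr t v), out t v))
        = p.law.map (fun v => (cov v, surr t v)) ⊗ₘ κ ∧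
      (p.labelled.restrict (arm t)).map (fun v => ((cov v, surrObs v), outObs v))
        = (p.labelled.restrict (arm t)).map (fun v => (cov v, surrObs v)) ⊗ₘ κ := by
  obtain ⟨κ, hκ, h1, h2⟩ := hp.missing_at_random t
  refine ⟨κ, hκ, ?_, ?_⟩
  · have hem : Measurable fun x => condDistrib trt cov p.law x {t} :=
      Kernel.measurable_coe _ (measurableSet_singleton t)
    have hem2 : Measurable fun z : 𝒳 × 𝒮 => condDistrib trt cov p.law z.1 {t} :=
      hem.comp measurable_fst
    have hem3 : Measurable fun z : (𝒳 × 𝒮) × ℝ => condDistrib trt cov p.law z.1.1 {t} :=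
      hem.comp (by fun_prop)
    have hpos' : ∀ᵐ x ∂(p.law.map cov), condDistrib trt cov p.law x {t} ≠ 0
        ∧ condDistrib trt cov p.law x {t} ≠ ∞ :=
      (hp.condDistrib_trt_singleton_pos hε t).mono fun x hx => ⟨hx, measure_ne_top _ _⟩
    have hms : MeasurableSet {x | condDistrib trt cov p.law x {t} ≠ 0
        ∧ condDistrib trt cov p.law x {t} ≠ ∞} :=
      ((hem (measurableSet_singleton 0)).compl).inter ((hem (measurableSet_singleton ∞)).compl)
    have hms2 : MeasurableSet {z : 𝒳 × 𝒮 | condDistrib trt cov p.law z.1 {t} ≠ 0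
        ∧ condDistrib trt cov p.law z.1 {t} ≠ ∞} := measurable_fst hms
    have hms3 : MeasurableSet {z : (𝒳 × 𝒮) × ℝ | condDistrib trt cov p.law z.1.1 {t} ≠ 0
        ∧ condDistrib trt cov p.law z.1.1 {t} ≠ ∞} := measurable_fst.comp measurable_fst hms
    have hpos2 : ∀ᵐ z ∂(p.law.map fun v => (cov v, surr t v)),
        condDistrib trt cov p.law z.1 {t} ≠ 0 ∧ condDistrib trt cov p.law z.1 {t} ≠ ∞ := by
      rw [ae_map_iff (by fun_prop) hms2]
      exact ae_of_ae_map measurable_cov.aemeasurable hpos'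
    have h3 := hp.map_restrict_arm_potential t
    have e2 : (p.law.restrict (arm t)).map (fun v => (cov v, surr t v))
        = (p.law.map fun v => (cov v, surr t v)).withDensity
          fun z => condDistrib trt cov p.law z.1 {t} := by
      have h4 := congrArg (fun μ => μ.map fun z : 𝒳 × ℝ × 𝒮 => (z.1, z.2.2)) h3
      beta_reduce at h4
      have h5 := Measure.map_withDensity_comp (μ := p.law.map fun v => (cov v, out t v, surr t v))
        (f := fun z : 𝒳 × ℝ × 𝒮 => (z.1, z.2.2)) (by fun_prop) hem2
      beta_reduce at h5
      rw [h5, Measure.map_map (by fun_prop) (by fun_prop),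
        Measure.map_map (by fun_prop) (by fun_prop)] at h4
      exact h4
    have e3 : (p.law.restrict (arm t)).map (fun v => ((cov v, surr t v), out t v))
        = (p.law.map fun v => ((cov v, surr t v), out t v)).withDensity
          fun z => condDistrib trt cov p.law z.1.1 {t} := by
      have h4 := congrArg (fun μ => μ.map fun z : 𝒳 × ℝ × 𝒮 => ((z.1, z.2.2), z.2.1)) h3
      beta_reduce at h4
      have h5 := Measure.map_withDensity_comp (μ := p.law.map fun v => (cov v, out t v, surr t v))
        (f := fun z : 𝒳 × ℝ × 𝒮 => ((z.1, z.2.2), z.2.1)) (by fun_prop) hem3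
      beta_reduce at h5
      rw [h5, Measure.map_map (by fun_prop) (by fun_prop),
        Measure.map_map (by fun_prop) (by fun_prop)] at h4
      exact h4
    -- The same cancellation: times the propensity, the claim is the factorization within the arm
    -- supplied by the missing-at-random condition.
    refine Measure.eq_of_withDensity_eq hem3 ?_ (Measure.ae_compProd_of_ae_fst _ hms2 hpos2) ?_
    · rw [ae_map_iff (by fun_prop) hms3]
      exact ae_of_ae_map measurable_cov.aemeasurable hpos'
    · have : IsFiniteMeasure ((p.law.map fun v => (cov v, surr t v)).withDensity
          fun z => condDistrib trt cov p.law z.1 {t}) := by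
        rw [← e2]; infer_instance
      have e4 := Measure.withDensity_fst_compProd (p.law.map fun v => (cov v, surr t v)) κ hem2
      rw [e4, ← e3, ← e2]
      exact map_restrict_arm_of_cond p.law t h1.map_eq
  · have h3 := map_restrict_arm_of_cond p.labelled t h2.map_eq
    have e1 : (p.labelled.restrict (arm t)).map (fun v => (cov v, surrObs v))
        = (p.labelled.restrict (arm t)).map (fun v => (cov v, surr t v)) := by
      refine Measure.map_congr ?_
      filter_upwards [ae_restrict_arm p.labelled t] with v hv
      rw [hv.2.1]
    have e2 : (p.labelled.restrict (arm t)).map (fun v => ((cov v, surrObs v), outObs v))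
        = (p.labelled.restrict (arm t)).map (fun v => ((cov v, surr t v), out t v)) := by
      refine Measure.map_congr ?_
      filter_upwards [ae_restrict_arm p.labelled t] with v hv
      rw [hv.2.1, hv.2.2]
    rw [e1, e2, h3]

/-- Reweighting the labelled law of `(X, S, Y)` in arm `t` gives the law of
`(X, S(t), Y(t))`. -/
lemma Admissible.withDensity_weight_out (hε : 0 < ε) (hp : p.Admissible ε C) (t : Bool) :
    ((p.labelled.restrict (arm t)).map fun v => ((cov v, surrObs v), outObs v)).withDensity
        (fun z => ENNReal.ofReal (p.weight (inArm t z.1)))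
      = p.law.map fun v => ((cov v, surr t v), out t v) := by
  obtain ⟨κ, hκ, h1, h2⟩ := hp.exists_kernel_out hε t
  have hwm : Measurable fun z : 𝒳 × 𝒮 => ENNReal.ofReal (p.weight (inArm t z)) :=
    (p.measurable_weight.comp (measurable_inArm t)).ennreal_ofReal
  have h3 := hp.withDensity_weight_arm t
  have : IsFiniteMeasure (((p.labelled.restrict (arm t)).map fun v => (cov v, surrObs v)).withDensity
      fun z => ENNReal.ofReal (p.weight (inArm t z))) := by rw [h3]; infer_instance
  have e := Measure.withDensity_fst_compProd
    ((p.labelled.restrict (arm t)).map fun v => (cov v, surrObs v)) κ hwm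
  rw [h2, e, h3, h1, hp.map_cov_surr hε]

/-- The labelled conditional law of the outcome given `(X, T = t, S)` is the conditional law of
`Y(t)` given `(X, S(t))`. -/
lemma Admissible.map_out_eq_compProd (hε : 0 < ε) (hp : p.Admissible ε C) (t : Bool) :
    p.law.map (fun v => ((cov v, surr t v), out t v))
      = p.law.map (fun v => (cov v, surr t v)) ⊗ₘ
        (condDistrib outObs covTrtSurr p.labelled).comap (inArm t) (measurable_inArm t) := by
  have hwm : Measurable fun z : 𝒳 × 𝒮 => ENNReal.ofReal (p.weight (inArm t z)) :=
    (p.measurable_weight.comp (measurable_inArm t)).ennreal_ofReal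
  have h3 := hp.withDensity_weight_arm t
  have : IsFiniteMeasure (((p.labelled.restrict (arm t)).map fun v => (cov v, surrObs v)).withDensity
      fun z => ENNReal.ofReal (p.weight (inArm t z))) := by rw [h3]; infer_instance
  have e := Measure.withDensity_fst_compProd
    ((p.labelled.restrict (arm t)).map fun v => (cov v, surrObs v))
    ((condDistrib outObs covTrtSurr p.labelled).comap (inArm t) (measurable_inArm t)) hwm
  -- The weights depend on (X,S) alone, so reweighting changes the law of (X,S) and leaves the
  -- labelled outcome kernel in place.
  rw [← hp.withDensity_weight_out hε t, map_restrict_arm_of_covTrtSurr p.labelled t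
    (compProd_map_condDistrib measurable_outObs.aemeasurable).symm, e, h3, hp.map_cov_surr hε]

/-- Expectation under weights: `E[w 1(T = t) (Y - m(X, S)) | R = 1] = E[Y(t) - m(X, S(t))]`. -/
lemma Admissible.setIntegral_weight_mul (hε : 0 < ε) (hp : p.Admissible ε C) (t : Bool)
    {m : 𝒳 × 𝒮 → ℝ} (hm : Measurable m) :
    ∫ v in arm t, p.weight (covTrtSurr v) * (outObs v - m (cov v, surrObs v)) ∂p.labelled
      = ∫ v, (out t v - m (cov v, surr t v)) ∂p.law := by
  have hF : Measurable fun z : (𝒳 × 𝒮) × ℝ => z.2 - m z.1 :=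
    measurable_snd.sub (hm.comp measurable_fst)
  have hwm : Measurable fun z : (𝒳 × 𝒮) × ℝ => p.weight (inArm t z.1) :=
    p.measurable_weight.comp ((measurable_inArm t).comp measurable_fst)
  have h1 : ∫ v, (out t v - m (cov v, surr t v)) ∂p.law
      = ∫ z, (z.2 - m z.1) ∂(p.law.map fun v => ((cov v, surr t v), out t v)) :=
    (integral_map (by fun_prop : Measurable fun v : FullData 𝒳 𝒮 =>
      ((cov v, surr t v), out t v)).aemeasurable hF.aestronglyMeasurable).symm
  rw [h1, ← hp.withDensity_weight_out hε t,
    integral_withDensity_eq_integral_toReal_smul hwm.ennreal_ofReal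
      (ae_of_all _ fun _ => ENNReal.ofReal_lt_top),
    integral_map (by fun_prop) (by
      exact (hwm.ennreal_ofReal.ennreal_toReal.smul hF).aestronglyMeasurable)]
  refine integral_congr_ae ?_
  filter_upwards [ae_restrict_arm p.labelled t] with v hv
  rw [ENNReal.toReal_ofReal (p.weight_nonneg _), smul_eq_mul, covTrtSurr, hv.1]
  rfl

/-- The regression function is integrable and has the mean of the potential outcome. -/
lemma Admissible.integral_outcomeReg (hε : 0 < ε) (hp : p.Admissible ε C) (t : Bool) :
    Integrable (fun z => p.outcomeReg t z.1 z.2) (p.law.map fun v => (cov v, surr t v)) ∧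
      ∫ z, p.outcomeReg t z.1 z.2 ∂(p.law.map fun v => (cov v, surr t v))
        = ∫ v, out t v ∂p.law := by
  have hmap := hp.map_out_eq_compProd hε t
  have hi : Integrable (fun z : (𝒳 × 𝒮) × ℝ => z.2)
      (p.law.map fun v => ((cov v, surr t v), out t v)) := by
    rw [integrable_map_measure measurable_snd.aestronglyMeasurable (by fun_prop)]
    exact hp.integrable_out t
  have e1 : ∫ v, out t v ∂p.law
      = ∫ z, z.2 ∂(p.law.map fun v => ((cov v, surr t v), out t v)) :=
    (integral_map (by fun_prop : Measurable fun v : FullData 𝒳 𝒮 =>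
      ((cov v, surr t v), out t v)).aemeasurable measurable_snd.aestronglyMeasurable).symm
  rw [hmap] at hi e1
  rw [Measure.integral_compProd hi] at e1
  exact ⟨hi.integral_compProd, e1.symm⟩

end Population

end Surrogate

/-- `condDistrib` is constructed from the joint law, so equality holds for the chosen versions and
not merely almost everywhere. Propensities and density ratios thus become literally equal when the
laws agree. -/
lemma ProbabilityTheory.condDistrib_congr_of_map_eq {α β Ω : Type*} [MeasurableSpace α]
    [MeasurableSpace β] [MeasurableSpace Ω] [StandardBorelSpace Ω] [Nonempty Ω] {Y : α → Ω}
    {X : α → β} {μ μ' : Measure α} [IsFiniteMeasure μ] [IsFiniteMeasure μ']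
    (h : μ.map (fun a => (X a, Y a)) = μ'.map fun a => (X a, Y a)) :
    condDistrib Y X μ = condDistrib Y X μ' := by
  simp only [condDistrib, h]

/-! ### Centring of the residual and exact change of the treatment effect. -/

namespace Surrogate

lemma compl_arm_true {𝒳 𝒮 : Type*} : (arm true : Set (FullData 𝒳 𝒮))ᶜ = arm false := by
  ext v
  simp [arm]

lemma arm_eq_preimage {𝒳 𝒮 : Type*} (t : Bool) :
    (arm t : Set (FullData 𝒳 𝒮)) = covTrtSurr ⁻¹' {z : 𝒳 × Bool × 𝒮 | z.2.1 = t} := rfl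

section SameLaw

variable {𝒳 𝒮 : Type*} [MeasurableSpace 𝒳] [MeasurableSpace 𝒮] {m m' : Measure (FullData 𝒳 𝒮)}

lemma map_cov_congr (h : m.map covTrtSurr = m'.map covTrtSurr) : m.map cov = m'.map cov := by
  have := congrArg (fun μ => μ.map Prod.fst) h
  beta_reduce at this
  rw [Measure.map_map measurable_fst measurable_covTrtSurr,
    Measure.map_map measurable_fst measurable_covTrtSurr] at this
  exact this

lemma map_cov_trt_congr (h : m.map covTrtSurr = m'.map covTrtSurr) :
    m.map (fun v => (cov v, trt v)) = m'.map fun v => (cov v, trt v) := by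
  have hf : Measurable fun z : 𝒳 × Bool × 𝒮 => (z.1, z.2.1) := by fun_prop
  have := congrArg (fun μ => μ.map fun z : 𝒳 × Bool × 𝒮 => (z.1, z.2.1)) h
  beta_reduce at this
  rw [Measure.map_map hf measurable_covTrtSurr, Measure.map_map hf measurable_covTrtSurr] at this
  exact this

lemma measurableSet_snd_fst_eq (t : Bool) : MeasurableSet {z : 𝒳 × Bool × 𝒮 | z.2.1 = t} :=
  (measurable_fst.comp measurable_snd) (measurableSet_singleton t)

lemma measure_arm_congr (h : m.map covTrtSurr = m'.map covTrtSurr) (t : Bool) :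
    m (arm t) = m' (arm t) := by
  rw [arm_eq_preimage, ← Measure.map_apply measurable_covTrtSurr (measurableSet_snd_fst_eq t), h,
    Measure.map_apply measurable_covTrtSurr (measurableSet_snd_fst_eq t)]

lemma map_cov_surrObs_restrict_arm_eq (m : Measure (FullData 𝒳 𝒮)) (t : Bool) :
    (m.restrict (arm t)).map (fun v => (cov v, surrObs v))
      = ((m.map covTrtSurr).restrict {z | z.2.1 = t}).map fun z => (z.1, z.2.2) := by
  rw [Measure.restrict_map measurable_covTrtSurr (measurableSet_snd_fst_eq t),
    Measure.map_map (by fun_prop) measurable_covTrtSurr]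
  rfl

lemma condDistrib_surrObs_congr [StandardBorelSpace 𝒮] [Nonempty 𝒮] [IsFiniteMeasure m]
    [IsFiniteMeasure m'] (h : m.map covTrtSurr = m'.map covTrtSurr) (t : Bool) :
    condDistrib surrObs cov (ProbabilityTheory.cond m (arm t))
      = condDistrib surrObs cov (ProbabilityTheory.cond m' (arm t)) := by
  refine condDistrib_congr_of_map_eq ?_
  simp only [ProbabilityTheory.cond, Measure.map_smul, map_cov_surrObs_restrict_arm_eq, h,
    measure_arm_congr h t]

end SameLaw

/-- Put an outcome next to `(X, T, S)`. -/
def addOut {𝒳 𝒮 : Type*} (q : (𝒳 × Bool × 𝒮) × ℝ) : Obs 𝒳 𝒮 := (q.1.1, q.1.2.1, q.1.2.2, q.2)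

@[fun_prop]
lemma measurable_addOut {𝒳 𝒮 : Type*} [MeasurableSpace 𝒳] [MeasurableSpace 𝒮] :
    Measurable (addOut : (𝒳 × Bool × 𝒮) × ℝ → Obs 𝒳 𝒮) := by
  unfold addOut; fun_prop

/-- The weight c may be 0, in which case the outcome need not be integrable but the claim is
trivial; for c ≠ 0 integrability of the product yields that of y. -/
lemma integral_mul_sub_mean {μ : Measure ℝ} [IsProbabilityMeasure μ] {c : ℝ}
    (h : Integrable (fun y => c * (y - ∫ x, x ∂μ)) μ) : ∫ y, c * (y - ∫ x, x ∂μ) ∂μ = 0 := by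
  rw [integral_const_mul]
  rcases eq_or_ne c 0 with rfl | hc
  · simp
  · have h1 : Integrable (fun y => y - ∫ x, x ∂μ) μ := by
      simpa [hc] using h.const_mul c⁻¹
    have h2 : Integrable (fun y : ℝ => y) μ :=
      (h1.add (integrable_const (∫ x, x ∂μ))).congr (ae_of_all _ fun y => by simp)
    rw [integral_sub h2 (integrable_const _)]
    simp

namespace Population

variable {𝒳 𝒮 : Type*} [MeasurableSpace 𝒳] [MeasurableSpace 𝒮]

instance (p : Population 𝒳 𝒮) : IsProbabilityMeasure p.obsLaw :=
  Measure.isProbabilityMeasure_map measurable_observe.aemeasurable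

lemma map_dropOut_obsLaw (p : Population 𝒳 𝒮) :
    p.obsLaw.map dropOut = p.labelled.map covTrtSurr := by
  rw [obsLaw, Measure.map_map measurable_dropOut measurable_observe]
  rfl

lemma obsLaw_eq_map_compProd (p : Population 𝒳 𝒮) :
    p.obsLaw = (p.labelled.map covTrtSurr ⊗ₘ condDistrib outObs covTrtSurr p.labelled).map
      addOut := by
  rw [compProd_map_condDistrib measurable_outObs.aemeasurable,
    Measure.map_map measurable_addOut (by fun_prop)]
  rfl

variable [StandardBorelSpace 𝒮] [Nonempty 𝒮]

lemma ae_integral_psi (p : Population 𝒳 𝒮) (hψ : MemLp p.psi 2 p.obsLaw) :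
    ∀ᵐ z ∂(p.labelled.map covTrtSurr),
      Integrable (fun y => p.psi (addOut (z, y))) (condDistrib outObs covTrtSurr p.labelled z) ∧
      ∫ y, p.psi (addOut (z, y)) ∂(condDistrib outObs covTrtSurr p.labelled z) = 0 := by
  have hi := hψ.integrable one_le_two
  rw [obsLaw_eq_map_compProd] at hi
  replace hi := (integrable_map_measure hi.1 measurable_addOut.aemeasurable).1 hi
  filter_upwards [((Measure.integrable_compProd_iff hi.1).1 hi).1] with z hz
  refine ⟨hz, ?_⟩
  have e : (fun y => p.psi (addOut (z, y))) = fun y => (p.weight z * armSign z.2.1)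
      * (y - ∫ x, x ∂(condDistrib outObs covTrtSurr p.labelled z)) := by
    funext y
    rw [psi, weightedResidual_eq, mul_assoc]
    rfl
  simp only [Function.comp_def, e] at hz
  rw [e]
  exact integral_mul_sub_mean hz

/-- `ψ̃'` is centred given `(X, T, S)` on labelled data. -/
lemma integral_mul_psi (p : Population 𝒳 𝒮) (hψ : MemLp p.psi 2 p.obsLaw)
    {φ : 𝒳 × Bool × 𝒮 → ℝ} (hφ : Measurable φ) (hφb : ∃ c, ∀ v, |φ v| ≤ c) :
    ∫ w, φ (dropOut w) * p.psi w ∂p.obsLaw = 0 := by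
  obtain ⟨c, hc⟩ := hφb
  have hi : Integrable (fun w => φ (dropOut w) * p.psi w) p.obsLaw :=
    (hψ.integrable one_le_two).bdd_mul (hφ.comp measurable_dropOut).aestronglyMeasurable
      (ae_of_all _ fun w => hc (dropOut w))
  have hz := p.ae_integral_psi hψ
  rw [obsLaw_eq_map_compProd] at hi ⊢
  have hi2 : Integrable (fun q => φ (dropOut (addOut q)) * p.psi (addOut q))
      (p.labelled.map covTrtSurr ⊗ₘ condDistrib outObs covTrtSurr p.labelled) :=
    (integrable_map_measure hi.1 measurable_addOut.aemeasurable).1 hi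
  rw [integral_map measurable_addOut.aemeasurable hi.1, Measure.integral_compProd hi2]
  refine integral_eq_zero_of_ae ?_
  filter_upwards [hz] with z hz
  have e : ∀ y : ℝ, dropOut (addOut (z, y)) = z := fun _ => rfl
  simp only [e, Pi.zero_apply]
  rw [integral_const_mul, hz.2, mul_zero]

/-- The law of `(X, T, S)` towards which the weights change the labelled one. -/
def targetLaw (p : Population 𝒳 𝒮) : Measure (𝒳 × Bool × 𝒮) :=
  (p.law.map cov ⊗ₘ p.surrKernel true).map (inArm true)
    + (p.law.map cov ⊗ₘ p.surrKernel false).map (inArm false)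

/-- Only the law of (X,T,S) enters, so the target is common to the whole model: it is the fixed
measure ν in `HasScore.tendsto_integral_weighted_div`. -/
lemma targetLaw_congr {p p' : Population 𝒳 𝒮} (h : p.covTrtSurrLaw = p'.covTrtSurrLaw) :
    p.targetLaw = p'.targetLaw := by
  simp only [targetLaw, surrKernel, map_cov_congr h, condDistrib_surrObs_congr h]

variable [StandardBorelSpace 𝒳] {ε C : ℝ} {p p' : Population 𝒳 𝒮}

lemma Admissible.withDensity_weight (hp : p.Admissible ε C) :
    (p.obsLaw.map dropOut).withDensity (fun z => ENNReal.ofReal (p.weight z)) = p.targetLaw := by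
  have hsplit : p.labelled.map covTrtSurr
      = ((p.labelled.restrict (arm true)).map fun v => (cov v, surrObs v)).map (inArm true)
        + ((p.labelled.restrict (arm false)).map fun v => (cov v, surrObs v)).map
          (inArm false) := by
    have h : ∀ t, ((p.labelled.restrict (arm t)).map fun v => (cov v, surrObs v)).map (inArm t)
        = (p.labelled.restrict (arm t)).map covTrtSurr := fun t => by
      rw [Measure.map_map (measurable_inArm t) (by fun_prop)]
      refine Measure.map_congr ?_
      filter_upwards [ae_restrict_arm p.labelled t] with v hv
      simp [covTrtSurr, inArm, hv.1]
    rw [h, h, ← Measure.map_add _ _ measurable_covTrtSurr, ← compl_arm_true,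
      Measure.restrict_add_restrict_compl (measurableSet_arm true)]
  have hwm := p.measurable_weight.ennreal_ofReal
  rw [map_dropOut_obsLaw, hsplit, withDensity_add_measure,
    ← Measure.map_withDensity_comp (measurable_inArm true) hwm,
    ← Measure.map_withDensity_comp (measurable_inArm false) hwm,
    hp.withDensity_weight_arm true, hp.withDensity_weight_arm false, targetLaw]

/-- The average treatment effect changes by the mean of the weighted residual. -/
lemma Admissible.ate_sub_ate (hε : 0 < ε) (hp : p.Admissible ε C) (hp' : p'.Admissible ε C)
    (h : p'.covTrtSurrLaw = p.covTrtSurrLaw) (hi : Integrable (p'.weightedResidual p) p'.obsLaw) :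
    p'.ate - p.ate = ∫ w, p'.weightedResidual p w ∂p'.obsLaw := by
  have hi' : Integrable (fun v => p'.weightedResidual p (observe v)) p'.labelled :=
    (integrable_map_measure hi.1 measurable_observe.aemeasurable).1 hi
  have harm : ∀ t, ∫ v in arm t, p'.weightedResidual p (observe v) ∂p'.labelled
      = armSign t * ((∫ v, out t v ∂p'.law) - ∫ v, out t v ∂p.law) := by
    intro t
    have hm : Measurable fun z : 𝒳 × 𝒮 => p.outcomeReg t z.1 z.2 :=
      p.measurable_outcomeReg.comp (measurable_inArm t)
    have hmap : p'.law.map (fun v => (cov v, surr t v)) = p.law.map fun v => (cov v, surr t v) := by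
      rw [hp'.map_cov_surr hε, hp.map_cov_surr hε, surrKernel, surrKernel, map_cov_congr h,
        condDistrib_surrObs_congr h]
    obtain ⟨hreg, hregI⟩ := hp.integral_outcomeReg hε t
    have hpair : Measurable fun v : FullData 𝒳 𝒮 => (cov v, surr t v) := by fun_prop
    have hreg' : Integrable (fun v => p.outcomeReg t (cov v) (surr t v)) p'.law := by
      rw [← hmap] at hreg
      exact (integrable_map_measure hreg.1 hpair.aemeasurable).1 hreg
    -- The law of (X,S(t)) is the same for both populations, so the regression of `p` keeps the mean
    -- of Y(t) under `p`; this is why the identity has no remainder.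
    have e2 : ∫ v, p.outcomeReg t (cov v) (surr t v) ∂p'.law = ∫ v, out t v ∂p.law := by
      rw [← hregI, ← hmap, integral_map hpair.aemeasurable hm.aestronglyMeasurable]
    have e1 := hp'.setIntegral_weight_mul hε t hm
    beta_reduce at e1
    rw [integral_sub (hp'.integrable_out t) hreg', e2] at e1
    rw [← e1, ← integral_const_mul]
    refine integral_congr_ae ?_
    filter_upwards [ae_restrict_arm p'.labelled t] with v hv
    rw [weightedResidual_eq]
    simp only [signedResidual, dropOut, observe, covTrtSurr, hv.1]
    ring
  rw [obsLaw, integral_map measurable_observe.aemeasurable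
    (p'.measurable_weightedResidual p).aestronglyMeasurable,
    ← integral_add_compl (measurableSet_arm true) hi', compl_arm_true, harm, harm, ate, ate]
  simp only [armSign, if_true, Bool.false_eq_true, if_false]
  ring

/-- `ψ̃'` is an influence function of the average treatment effect. -/
theorem Admissible.isInfluenceFunction_psi (hε : 0 < ε) (hp : p.Admissible ε C)
    (hψ : MemLp p.psi 2 p.obsLaw) :
    Efficiency.IsInfluenceFunction obsLaw ate p
      (regularSubmodels (model ε C p.covTrtSurrLaw) p) p.psi := by
  refine ⟨hψ, fun path hpath g hg => ?_⟩
  obtain ⟨h0, hM, B, hB⟩ := hpath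
  have hMB : ∀ᶠ γ in 𝓝 (0 : ℝ), (path γ).ate - p.ate
      = ∫ w, (path γ).weightedResidual p w ∂(path γ).obsLaw := by
    filter_upwards [hM, hB] with γ hγ hBγ
    refine Admissible.ate_sub_ate hε hp hγ.1 hγ.2 (MemLp.integrable (q := 2) one_le_two ?_)
    have hm := (path γ).measurable_weightedResidual p
    rw [memLp_two_iff_integrable_sq hm.aestronglyMeasurable]
    refine ⟨(hm.pow_const 2).aestronglyMeasurable, ?_⟩
    rw [hasFiniteIntegral_iff_ofReal (ae_of_all _ fun _ => sq_nonneg _)]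
    exact hBγ.trans_lt ENNReal.coe_lt_top
  have hpsi : ∀ w, (path 0).weight (dropOut w) * p.signedResidual w = p.psi w := fun w => by
    rw [h0, psi, weightedResidual_eq]
  -- Here π = (X,T,S), the weights carry its labelled law to the common target law, and centring
  -- given π is `integral_mul_psi`.
  have key := hg.tendsto_integral_weighted_div (π := dropOut) measurable_dropOut
    (w := fun γ => (path γ).weight) (fun γ => (path γ).measurable_weight)
    (fun γ => (path γ).weight_nonneg) (ν := p.targetLaw)
    (by
      filter_upwards [hM] with γ hγ
      rw [hγ.1.withDensity_weight, targetLaw_congr hγ.2])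
    p.measurable_signedResidual (B := B)
    (by simp only [hpsi]; rw [h0]; exact hψ)
    (by
      filter_upwards [hB] with γ hγ
      simpa only [weightedResidual_eq] using hγ)
    (by
      intro φ hφ hφb
      simp only [hpsi]
      rw [h0]
      exact p.integral_mul_psi hψ hφ hφb)
  simp only [hpsi] at key
  rw [h0] at key
  rw [hasDerivAt_iff_tendsto_slope]
  refine key.congr' ?_
  filter_upwards [hMB.filter_mono nhdsWithin_le_nhds] with γ hγ
  rw [slope_def_field, sub_zero, h0, hγ]
  simp only [weightedResidual_eq]

end Population

end Surrogate

/-! ### Building complete data with a prescribed outcome kernel. -/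

namespace Surrogate

section Completion

variable {𝒳 𝒮 : Type*} [MeasurableSpace 𝒳] [MeasurableSpace 𝒮]

/-- Draw a surrogate in arm `t` from `c t`, then an outcome from `K`. -/
def pairKernel (c : Bool → Kernel 𝒳 𝒮) (K : Kernel (𝒳 × Bool × 𝒮) ℝ) (t : Bool) :
    Kernel 𝒳 (𝒮 × ℝ) :=
  c t ⊗ₖ K.comap (inArm t) (measurable_inArm t)

instance (c : Bool → Kernel 𝒳 𝒮) [∀ t, IsMarkovKernel (c t)] (K : Kernel (𝒳 × Bool × 𝒮) ℝ)
    [IsMarkovKernel K] (t : Bool) : IsMarkovKernel (pairKernel c K t) := by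
  unfold pairKernel; infer_instance

lemma lintegral_pairKernel (c : Bool → Kernel 𝒳 𝒮) [∀ t, IsMarkovKernel (c t)]
    (K : Kernel (𝒳 × Bool × 𝒮) ℝ) [IsMarkovKernel K] (t : Bool) (x : 𝒳) {f : 𝒮 × ℝ → ℝ≥0∞}
    (hf : Measurable f) :
    ∫⁻ u, f u ∂(pairKernel c K t x) = ∫⁻ s, ∫⁻ y, f (s, y) ∂(K (x, t, s)) ∂(c t x) := by
  rw [pairKernel, Kernel.lintegral_compProd _ _ _ hf]
  rfl

open Classical in
/-- The conditional law of the counterfactual pair given `(X, T, S)`. -/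
def counterfactualKernel (c : Bool → Kernel 𝒳 𝒮) (K : Kernel (𝒳 × Bool × 𝒮) ℝ) :
    Kernel (𝒳 × Bool × 𝒮) (𝒮 × ℝ) :=
  Kernel.piecewise (measurableSet_snd_fst_eq true)
    ((pairKernel c K false).comap Prod.fst measurable_fst)
    ((pairKernel c K true).comap Prod.fst measurable_fst)

instance (c : Bool → Kernel 𝒳 𝒮) [∀ t, IsMarkovKernel (c t)] (K : Kernel (𝒳 × Bool × 𝒮) ℝ)
    [IsMarkovKernel K] : IsMarkovKernel (counterfactualKernel c K) := by
  unfold counterfactualKernel; infer_instance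

lemma counterfactualKernel_apply (c : Bool → Kernel 𝒳 𝒮) (K : Kernel (𝒳 × Bool × 𝒮) ℝ)
    (x : 𝒳) (t : Bool) (s : 𝒮) :
    counterfactualKernel c K (x, t, s) = pairKernel c K (!t) x := by
  cases t <;> simp [counterfactualKernel, Kernel.piecewise_apply, Kernel.comap_apply]

/-- Assemble complete data from actual and counterfactual variables. -/
def assemble (q : (𝒳 × Bool × 𝒮) × ℝ × 𝒮 × ℝ) : FullData 𝒳 𝒮 :=
  (q.1.1, q.1.2.1, fun b => if b = q.1.2.1 then q.1.2.2 else q.2.2.1,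
    fun b => if b = q.1.2.1 then q.2.1 else q.2.2.2)

@[fun_prop]
lemma measurable_assemble : Measurable (assemble : _ → FullData 𝒳 𝒮) := by
  have h : ∀ b : Bool, MeasurableSet {q : (𝒳 × Bool × 𝒮) × ℝ × 𝒮 × ℝ | b = q.1.2.1} := fun b =>
    (by fun_prop : Measurable fun q : (𝒳 × Bool × 𝒮) × ℝ × 𝒮 × ℝ => q.1.2.1)
      (measurableSet_singleton b |>.preimage measurable_id) |> fun h => by
        convert h using 1
        ext q
        simp [eq_comm]
  refine Measurable.prodMk (by fun_prop) (Measurable.prodMk (by fun_prop)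
    (Measurable.prodMk (measurable_pi_lambda _ fun b => ?_) (measurable_pi_lambda _ fun b => ?_)))
  · exact Measurable.ite (h b) (by fun_prop) (by fun_prop)
  · exact Measurable.ite (h b) (by fun_prop) (by fun_prop)

/-- Given `(X, T, S)`, draw the outcome from `K` and, independently, the counterfactual pair. -/
def completion (c : Bool → Kernel 𝒳 𝒮) (K : Kernel (𝒳 × Bool × 𝒮) ℝ)
    (m : Measure (𝒳 × Bool × 𝒮)) : Measure (FullData 𝒳 𝒮) :=
  (m ⊗ₘ (K ×ₖ counterfactualKernel c K)).map assemble

/-- Labelled and unlabelled units are completed with the same kernels, so by linearity the mixture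
of the completions is the completion of the unconditional law. -/
lemma completion_add_smul (c : Bool → Kernel 𝒳 𝒮) (K : Kernel (𝒳 × Bool × 𝒮) ℝ)
    (m₁ m₂ : Measure (𝒳 × Bool × 𝒮)) [SFinite m₁] [SFinite m₂]
    (a b : ℝ≥0) :
    completion c K (a • m₁ + b • m₂) = a • completion c K m₁ + b • completion c K m₂ := by
  have e1 : a • m₁ = (a : ℝ≥0∞) • m₁ := rfl
  have e2 : b • m₂ = (b : ℝ≥0∞) • m₂ := rfl
  simp only [completion]
  rw [e1, e2, Measure.compProd_add_left, Measure.map_add _ _ measurable_assemble,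
    Measure.compProd_smul_left, Measure.compProd_smul_left, Measure.map_smul, Measure.map_smul]
  rfl

variable (c : Bool → Kernel 𝒳 𝒮) [∀ t, IsMarkovKernel (c t)] (K : Kernel (𝒳 × Bool × 𝒮) ℝ)
  [IsMarkovKernel K] (m : Measure (𝒳 × Bool × 𝒮))

instance [IsProbabilityMeasure m] : IsProbabilityMeasure (completion c K m) :=
  Measure.isProbabilityMeasure_map measurable_assemble.aemeasurable

lemma map_covTrtSurr_outObs_completion [SFinite m] :
    (completion c K m).map (fun v => (covTrtSurr v, outObs v)) = m ⊗ₘ K := by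
  have h : (K ×ₖ counterfactualKernel c K).map Prod.fst = K := by
    rw [← Kernel.fst_eq, Kernel.fst_prod]
  rw [completion, Measure.map_map (by fun_prop) measurable_assemble]
  conv_rhs => rw [← h, Measure.compProd_map measurable_fst]
  congr 1
  funext q
  simp [assemble, covTrtSurr, cov, trt, surrObs, surr, outObs, out]
  rfl

lemma map_covTrtSurr_completion [SFinite m] : (completion c K m).map covTrtSurr = m := by
  have h := congrArg (fun μ => μ.map Prod.fst) (map_covTrtSurr_outObs_completion c K m)
  beta_reduce at h
  rw [Measure.map_map measurable_fst (by fun_prop)] at h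
  exact h.trans (Measure.fst_compProd m K)

/-- In the completed data a potential pair is conditionally independent of the treatment, provided
that `c` is the conditional law of the surrogate. -/
lemma map_potential_completion [IsFiniteMeasure m] (t : Bool)
    (hm : (m.restrict {z | z.2.1 = t}).map (fun z => (z.1, z.2.2))
      = (m.restrict {z | z.2.1 = t}).map Prod.fst ⊗ₘ c t) :
    (completion c K m).map (fun v => ((cov v, trt v), (surr t v, out t v)))
      = m.map (fun z => (z.1, z.2.1)) ⊗ₘ (pairKernel c K t).prodMkRight Bool := by
  have hset : MeasurableSet {z : 𝒳 × Bool × 𝒮 | z.2.1 = t} := measurableSet_snd_fst_eq t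
  have hmap : Measurable fun v : FullData 𝒳 𝒮 => ((cov v, trt v), (surr t v, out t v)) := by
    fun_prop
  have hproj : Measurable fun z : 𝒳 × Bool × 𝒮 => (z.1, z.2.1) := by fun_prop
  refine Measure.ext_of_lintegral _ fun f hf => ?_
  set F : (𝒳 × Bool × 𝒮) × ℝ × 𝒮 × ℝ → ℝ≥0∞ := fun q =>
    f ((cov (assemble q), trt (assemble q)), (surr t (assemble q), out t (assemble q))) with hF
  have hfa : Measurable F := hf.comp (hmap.comp measurable_assemble)
  have hstart : ∫⁻ v, f v ∂((completion c K m).map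
      fun v => ((cov v, trt v), (surr t v, out t v)))
        = ∫⁻ q, F q ∂(m ⊗ₘ (K ×ₖ counterfactualKernel c K)) := by
    rw [completion, Measure.map_map hmap measurable_assemble,
      lintegral_map hf (hmap.comp measurable_assemble)]
    rfl
  rw [hstart, Measure.lintegral_compProd hfa, Measure.lintegral_compProd hf,
    lintegral_map hf.lintegral_kernel_prod_right' hproj]
  have hfz : ∀ z, Measurable fun u => F (z, u) := fun z => hfa.comp measurable_prodMk_left
  -- On T = t the pair is the actual one, whose surrogate has conditional law `c t` by `hm`; on T ≠
  -- t it is the counterfactual one, drawn from `pairKernel c K t` by construction.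
  refine (lintegral_add_compl _ hset).symm.trans
    ((congrArg₂ (· + ·) ?_ ?_).trans (lintegral_add_compl _ hset))
  · have e1 : ∀ z ∈ {z : 𝒳 × Bool × 𝒮 | z.2.1 = t},
        ∫⁻ u, F (z, u) ∂((K ×ₖ counterfactualKernel c K) z)
        = ∫⁻ y, f ((z.1, t), (z.2.2, y)) ∂(K (inArm t (z.1, z.2.2))) := by
      rintro ⟨x, t', s⟩ (rfl : t' = t)
      rw [Kernel.lintegral_prod _ _ _ (hfz _)]
      simp [hF, assemble, cov, trt, surr, out, inArm]
    rw [setLIntegral_congr_fun hset e1]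
    have hG : Measurable fun q : (𝒳 × 𝒮) × ℝ => f ((q.1.1, t), (q.1.2, q.2)) :=
      hf.comp (by fun_prop)
    have hG1 : Measurable fun w : 𝒳 × 𝒮 => ∫⁻ y, f ((w.1, t), (w.2, y)) ∂(K (inArm t w)) :=
      hG.lintegral_kernel_prod_right' (κ := K.comap (inArm t) (measurable_inArm t))
    have h2 := lintegral_map (μ := m.restrict {z | z.2.1 = t}) hG1
      (by fun_prop : Measurable fun z : 𝒳 × Bool × 𝒮 => (z.1, z.2.2))
    refine h2.symm.trans ?_
    rw [hm, Measure.lintegral_compProd hG1,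
      lintegral_map hG1.lintegral_kernel_prod_right' measurable_fst]
    refine setLIntegral_congr_fun hset ?_
    rintro ⟨x, t', s⟩ (rfl : t' = t)
    simp only [Kernel.prodMkRight_apply]
    exact (lintegral_pairKernel c K t' x (hf.comp measurable_prodMk_left)).symm
  · refine setLIntegral_congr_fun hset.compl ?_
    rintro ⟨x, t', s⟩ ht
    have ht' : t = !t' := by
      have : ¬ t' = t := ht
      cases t <;> cases t' <;> simp_all
    subst ht'
    simp only [Kernel.prodMkRight_apply]
    rw [Kernel.lintegral_prod _ _ _ (hfz _)]
    simp [hF, assemble, cov, trt, surr, out, counterfactualKernel_apply]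

end Completion

end Surrogate

/-- If the conditional law of `f` given `(k, g)` depends on `k` only, then `g` and `f` are
conditionally independent given `k`. -/
lemma ProbabilityTheory.condIndepFun_of_map_eq_compProd_prodMkRight {Ω β β' γ : Type*}
    [MeasurableSpace Ω] [StandardBorelSpace Ω] [MeasurableSpace β] [StandardBorelSpace β]
    [Nonempty β] [MeasurableSpace β'] [StandardBorelSpace β'] [Nonempty β'] [MeasurableSpace γ]
    {μ : Measure Ω} [IsFiniteMeasure μ] {f : Ω → β} {g : Ω → β'} {k : Ω → γ} (hf : Measurable f)
    (hg : Measurable g) (hk : Measurable k) {D : Kernel γ β} [IsMarkovKernel D]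
    (h : μ.map (fun ω => ((k ω, g ω), f ω)) = μ.map (fun ω => (k ω, g ω)) ⊗ₘ D.prodMkRight β') :
    CondIndepFun (MeasurableSpace.comap k inferInstance) hk.comap_le f g μ := by
  refine CondIndepFun.symm ((condIndepFun_iff_condDistrib_prod_ae_eq_prodMkRight hf hg hk).2 ?_)
  have h1 : condDistrib f (fun ω => (k ω, g ω)) μ
      =ᵐ[μ.map fun ω => (k ω, g ω)] D.prodMkRight β' :=
    condDistrib_ae_eq_of_measure_eq_compProd _ hf.aemeasurable h
  have h2 : μ.map (fun ω => (k ω, f ω)) = μ.map k ⊗ₘ D := by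
    refine Measure.ext_of_lintegral _ fun F hF => ?_
    have hF' : Measurable fun q : (γ × β') × β => F (q.1.1, q.2) := hF.comp (by fun_prop)
    have h3 := congrArg (fun μ => ∫⁻ q, F (q.1.1, q.2) ∂μ) h
    beta_reduce at h3
    rw [lintegral_map hF' (by fun_prop), Measure.lintegral_compProd hF',
      lintegral_map hF'.lintegral_kernel_prod_right' (by fun_prop)] at h3
    rw [lintegral_map hF (by fun_prop), Measure.lintegral_compProd hF,
      lintegral_map hF.lintegral_kernel_prod_right' hk]
    exact h3
  have h3 := condDistrib_ae_eq_of_measure_eq_compProd k hf.aemeasurable h2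
  have h4 : ∀ᵐ q ∂(μ.map fun ω => (k ω, g ω)), condDistrib f k μ q.1 = D q.1 := by
    refine ae_of_ae_map (f := Prod.fst) measurable_fst.aemeasurable (p := fun x =>
      condDistrib f k μ x = D x) ?_
    rw [Measure.map_map measurable_fst (by fun_prop)]
    exact h3
  filter_upwards [h1, h4] with q hq1 hq2
  rw [hq1, Kernel.prodMkRight_apply, Kernel.prodMkRight_apply, hq2]

/-! ### Recombined populations stay in the model. -/

namespace Surrogate

namespace Population

variable {𝒳 𝒮 : Type*} [MeasurableSpace 𝒳] [MeasurableSpace 𝒮]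

lemma covTrtSurrLaw_eq (p : Population 𝒳 𝒮) :
    p.covTrtSurrLaw = p.rate • p.labelled.map covTrtSurr
      + (1 - p.rate) • p.unlabelled.map covTrtSurr := by
  rw [covTrtSurrLaw, law, Measure.map_add _ _ measurable_covTrtSurr, Measure.map_smul,
    Measure.map_smul]

/-- Within an arm the actual variables are the potential ones. Using this for the unconditional and
the labelled law with one K gives the missing-at-random condition. -/
lemma hasCondDistrib_cond_arm {m : Measure (FullData 𝒳 𝒮)} [IsFiniteMeasure m]
    {K : Kernel (𝒳 × Bool × 𝒮) ℝ} [IsMarkovKernel K]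
    (h : m.map (fun v => (covTrtSurr v, outObs v)) = m.map covTrtSurr ⊗ₘ K) (t : Bool) :
    HasCondDistrib (out t) (fun v => (cov v, surr t v))
      (K.comap (inArm t) (measurable_inArm t)) (ProbabilityTheory.cond m (arm t)) := by
  refine ⟨by fun_prop, ?_⟩
  have h1 := map_restrict_arm_of_covTrtSurr m t h
  have e1 : (m.restrict (arm t)).map (fun v => (cov v, surrObs v))
      = (m.restrict (arm t)).map (fun v => (cov v, surr t v)) := by
    refine Measure.map_congr ?_
    filter_upwards [ae_restrict_arm m t] with v hv
    rw [hv.2.1]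
  have e2 : (m.restrict (arm t)).map (fun v => ((cov v, surrObs v), outObs v))
      = (m.restrict (arm t)).map (fun v => ((cov v, surr t v), out t v)) := by
    refine Measure.map_congr ?_
    filter_upwards [ae_restrict_arm m t] with v hv
    rw [hv.2.1, hv.2.2]
  rw [e1, e2] at h1
  rw [ProbabilityTheory.cond, Measure.map_smul, Measure.map_smul, h1, Measure.compProd_smul_left]

variable [StandardBorelSpace 𝒮] [Nonempty 𝒮]

/-- The population with the same law of `(X, T, S, R)` in which outcomes are drawn from `K` and
counterfactual variables are drawn independently. -/
def recombine (p : Population 𝒳 𝒮) (K : Kernel (𝒳 × Bool × 𝒮) ℝ) [IsMarkovKernel K] :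
    Population 𝒳 𝒮 where
  rate := p.rate
  rate_le_one := p.rate_le_one
  labelled := completion p.surrKernel K (p.labelled.map covTrtSurr)
  unlabelled := completion p.surrKernel K (p.unlabelled.map covTrtSurr)
  isProb_labelled := by
    have : IsProbabilityMeasure (p.labelled.map covTrtSurr) :=
      Measure.isProbabilityMeasure_map measurable_covTrtSurr.aemeasurable
    infer_instance
  isProb_unlabelled := by
    have : IsProbabilityMeasure (p.unlabelled.map covTrtSurr) :=
      Measure.isProbabilityMeasure_map measurable_covTrtSurr.aemeasurable
    infer_instance

section Recombine

variable (p : Population 𝒳 𝒮) (K : Kernel (𝒳 × Bool × 𝒮) ℝ) [IsMarkovKernel K]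

lemma law_recombine : (p.recombine K).law = completion p.surrKernel K p.covTrtSurrLaw := by
  rw [covTrtSurrLaw_eq, completion_add_smul]
  rfl

instance : IsProbabilityMeasure p.covTrtSurrLaw :=
  Measure.isProbabilityMeasure_map measurable_covTrtSurr.aemeasurable

lemma map_covTrtSurr_law_recombine : (p.recombine K).law.map covTrtSurr = p.law.map covTrtSurr := by
  rw [law_recombine, map_covTrtSurr_completion]
  rfl

lemma map_covTrtSurr_labelled_recombine :
    (p.recombine K).labelled.map covTrtSurr = p.labelled.map covTrtSurr :=
  map_covTrtSurr_completion _ _ _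

lemma propensity_recombine : (p.recombine K).propensity = p.propensity := by
  funext x
  rw [propensity, propensity, condDistrib_congr_of_map_eq
    (map_cov_trt_congr (p.map_covTrtSurr_law_recombine K))]

lemma propensityLabelled_recombine :
    (p.recombine K).propensityLabelled = p.propensityLabelled := by
  funext x
  rw [propensityLabelled, propensityLabelled, condDistrib_congr_of_map_eq
    (map_cov_trt_congr (p.map_covTrtSurr_labelled_recombine K))]

lemma ratioCov_recombine : (p.recombine K).ratioCov = p.ratioCov := by
  funext x
  rw [ratioCov, ratioCov, map_cov_congr (p.map_covTrtSurr_law_recombine K),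
    map_cov_congr (p.map_covTrtSurr_labelled_recombine K)]

lemma surrKernel_recombine (t : Bool) : (p.recombine K).surrKernel t = p.surrKernel t := by
  rw [surrKernel, surrKernel, condDistrib_surrObs_congr (p.map_covTrtSurr_law_recombine K)]

lemma surrKernelLabelled_recombine (t : Bool) :
    (p.recombine K).surrKernelLabelled t = p.surrKernelLabelled t := by
  rw [surrKernelLabelled, surrKernelLabelled,
    condDistrib_surrObs_congr (p.map_covTrtSurr_labelled_recombine K)]

lemma ratioSurr_recombine (t : Bool) : (p.recombine K).ratioSurr t = p.ratioSurr t := by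
  funext s x
  rw [ratioSurr, ratioSurr, surrKernel_recombine, surrKernelLabelled_recombine]

/-- The weights depend only on the unconditional and labelled laws of (X,T,S), both of which
recombination preserves. -/
lemma weightedResidual_recombine : (p.recombine K).weightedResidual p = p.psi := by
  funext ⟨x, t, s, y⟩
  simp only [psi, weightedResidual, ratioCov_recombine, ratioSurr_recombine,
    propensityLabelled_recombine]

lemma obsLaw_recombine :
    (p.recombine K).obsLaw = (p.labelled.map covTrtSurr ⊗ₘ K).map addOut := by
  have h := map_covTrtSurr_outObs_completion p.surrKernel K (p.labelled.map covTrtSurr)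
  rw [← h, Measure.map_map measurable_addOut (by fun_prop)]
  rfl

lemma map_potential_law_recombine (t : Bool) :
    (p.recombine K).law.map (fun v => ((cov v, trt v), (surr t v, out t v)))
      = (p.recombine K).law.map (fun v => (cov v, trt v))
        ⊗ₘ (pairKernel p.surrKernel K t).prodMkRight Bool := by
  rw [map_cov_trt_congr (p.map_covTrtSurr_law_recombine K), law_recombine,
    map_potential_completion p.surrKernel K p.covTrtSurrLaw t, covTrtSurrLaw,
    Measure.map_map (by fun_prop) measurable_covTrtSurr]
  · rfl
  · have h := map_restrict_arm_of_cond p.law t (f := cov) (g := surrObs)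
      (κ := p.surrKernel t) (compProd_map_condDistrib measurable_surrObs.aemeasurable).symm
    rw [map_cov_surrObs_restrict_arm_eq] at h
    rw [covTrtSurrLaw, h, Measure.restrict_map measurable_covTrtSurr (measurableSet_snd_fst_eq t),
      Measure.map_map measurable_fst measurable_covTrtSurr]
    rfl

end Recombine

variable [StandardBorelSpace 𝒳] {ε C : ℝ} {p : Population 𝒳 𝒮}

/-- Unconfoundedness holds because a potential pair has conditional law `pairKernel p.surrKernel K
t` whatever the treatment, and labels are missing at random because K is shared. The overlap and
density-ratio conditions involve only the preserved laws of (X,T,S), so integrability of the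
outcomes is all that K has to supply. -/
lemma Admissible.recombine (hε : 0 < ε) (hp : p.Admissible ε C)
    (K : Kernel (𝒳 × Bool × 𝒮) ℝ) [IsMarkovKernel K]
    (hK : ∀ t, ∫⁻ z, ∫⁻ y, ‖y‖ₑ ∂(K (inArm t z)) ∂(p.law.map fun v => (cov v, surr t v)) < ∞) :
    (p.recombine K).Admissible ε C where
  integrable_out t := by
    refine ⟨(measurable_out t).aestronglyMeasurable, ?_⟩
    have hf : Measurable fun q : (𝒳 × Bool) × 𝒮 × ℝ => ‖q.2.2‖ₑ := by fun_prop
    have h1 := congrArg (fun μ => ∫⁻ q, ‖q.2.2‖ₑ ∂μ) (p.map_potential_law_recombine K t)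
    beta_reduce at h1
    have hE : Measurable fun x => ∫⁻ s, ∫⁻ y, ‖y‖ₑ ∂(K (x, t, s)) ∂(p.surrKernel t x) := by
      have h2 : Measurable fun z : 𝒳 × 𝒮 => ∫⁻ y, ‖y‖ₑ ∂(K (inArm t z)) :=
        (measurable_enorm.lintegral_kernel (κ := K)).comp (measurable_inArm t)
      exact h2.lintegral_kernel_prod_right'
    have hK1 : Measurable fun z : 𝒳 × 𝒮 => ∫⁻ y, ‖y‖ₑ ∂(K (inArm t z)) :=
      (measurable_enorm.lintegral_kernel (κ := K)).comp (measurable_inArm t)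
    rw [lintegral_map hf (by fun_prop), Measure.lintegral_compProd hf] at h1
    simp only [Kernel.prodMkRight_apply] at h1
    have h2 : ∀ x, ∫⁻ u, ‖u.2‖ₑ ∂(pairKernel p.surrKernel K t x)
        = ∫⁻ s, ∫⁻ y, ‖y‖ₑ ∂(K (x, t, s)) ∂(p.surrKernel t x) := fun x =>
      lintegral_pairKernel p.surrKernel K t x (by fun_prop)
    simp only [h2] at h1
    have hlt := hK t
    rw [hp.map_cov_surr hε, Measure.lintegral_compProd hK1,
      ← map_cov_congr (p.map_covTrtSurr_law_recombine K), lintegral_map (by exact hE) measurable_cov]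
      at hlt
    have hE' : Measurable fun q : 𝒳 × Bool =>
        ∫⁻ s, ∫⁻ y, ‖y‖ₑ ∂(K (q.1, t, s)) ∂(p.surrKernel t q.1) := hE.comp measurable_fst
    rw [lintegral_map hE' (by fun_prop)] at h1
    rw [HasFiniteIntegral, h1]
    exact hlt
  unconfounded_trt t := by
    have : IsMarkovKernel ((pairKernel p.surrKernel K t).map Prod.swap) :=
      Kernel.IsMarkovKernel.map _ measurable_swap
    refine condIndepFun_of_map_eq_compProd_prodMkRight (by fun_prop) measurable_trt measurable_cov
      (D := (pairKernel p.surrKernel K t).map Prod.swap) (h := ?_)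
    have h1 := congrArg (fun μ => μ.map (Prod.map id Prod.swap)) (p.map_potential_law_recombine K t)
    beta_reduce at h1
    rw [← Measure.compProd_map measurable_swap,
      Measure.map_map (measurable_id.prodMap measurable_swap) (by fun_prop)] at h1
    refine Eq.trans (by rfl) (h1.trans ?_)
    congr 1
    ext q : 1
    rw [Kernel.map_apply _ measurable_swap, Kernel.prodMkRight_apply, Kernel.prodMkRight_apply,
      Kernel.map_apply _ measurable_swap]
  missing_at_random t := by
    refine ⟨K.comap (inArm t) (measurable_inArm t), inferInstance,
      hasCondDistrib_cond_arm ?_ t, hasCondDistrib_cond_arm ?_ t⟩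
    · rw [map_covTrtSurr_law_recombine, law_recombine, map_covTrtSurr_outObs_completion]
      rfl
    · rw [map_covTrtSurr_labelled_recombine]
      exact map_covTrtSurr_outObs_completion _ _ _
  overlap := by
    rw [map_cov_congr (p.map_covTrtSurr_law_recombine K), propensity_recombine]
    exact hp.overlap
  ratioCov_ac := by
    rw [map_cov_congr (p.map_covTrtSurr_law_recombine K),
      map_cov_congr (p.map_covTrtSurr_labelled_recombine K)]
    exact hp.ratioCov_ac
  ratioCov_le := by
    rw [map_cov_congr (p.map_covTrtSurr_law_recombine K), ratioCov_recombine]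
    exact hp.ratioCov_le
  overlap_labelled := by
    rw [map_cov_congr (p.map_covTrtSurr_law_recombine K), propensityLabelled_recombine]
    exact hp.overlap_labelled
  ratioSurr_ac t := by
    rw [map_cov_congr (p.map_covTrtSurr_law_recombine K), surrKernel_recombine,
      surrKernelLabelled_recombine]
    exact hp.ratioSurr_ac t
  ratioSurr_le t := by
    rw [map_cov_congr (p.map_covTrtSurr_law_recombine K), surrKernel_recombine,
      ratioSurr_recombine]
    exact hp.ratioSurr_le t

end Population

end Surrogate

/-! ### Linear tilts of the outcome kernel and density of their scores. -/

namespace Surrogate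

variable {𝒳 𝒮 : Type*} [MeasurableSpace 𝒳] [MeasurableSpace 𝒮]

/-- The linear tilt of an outcome kernel by a function of the observation. -/
def tilt (K : Kernel (𝒳 × Bool × 𝒮) ℝ) [IsMarkovKernel K] (h : Obs 𝒳 𝒮 → ℝ) (γ : ℝ) :
    Kernel (𝒳 × Bool × 𝒮) ℝ :=
  K.withDensity fun z y => ENNReal.ofReal (1 + γ * h (addOut (z, y)))

lemma measurable_tilt_density {h : Obs 𝒳 𝒮 → ℝ} (hh : Measurable h) (γ : ℝ) :
    Measurable (Function.uncurry fun (z : 𝒳 × Bool × 𝒮) (y : ℝ) =>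
      ENNReal.ofReal (1 + γ * h (addOut (z, y)))) :=
  (((hh.comp measurable_addOut).const_mul γ).const_add 1).ennreal_ofReal

lemma one_add_mul_mem {γ c x : ℝ} (hγ : |γ| * c ≤ 1) (hx : |x| ≤ c) :
    0 ≤ 1 + γ * x ∧ 1 + γ * x ≤ 2 := by
  have h : |γ * x| ≤ 1 := by
    rw [abs_mul]
    exact (mul_le_mul_of_nonneg_left hx (abs_nonneg _)).trans hγ
  obtain ⟨h1, h2⟩ := abs_le.1 h
  constructor <;> linarith

/-- Centring gives mass one and |γ| c ≤ 1 gives a nonnegative density. Centring is required at every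
z, not just almost every one, since a Markov kernel is normalized pointwise. -/
lemma isMarkovKernel_tilt {K : Kernel (𝒳 × Bool × 𝒮) ℝ} [IsMarkovKernel K] {h : Obs 𝒳 𝒮 → ℝ}
    (hh : Measurable h) {c γ : ℝ} (hc : ∀ w, |h w| ≤ c)
    (h0 : ∀ z, ∫ y, h (addOut (z, y)) ∂(K z) = 0) (hγ : |γ| * c ≤ 1) :
    IsMarkovKernel (tilt K h γ) := by
  refine ⟨fun z => ⟨?_⟩⟩
  have hi : Integrable (fun y => h (addOut (z, y))) (K z) :=
    (MemLp.of_bound (p := 1) (hh.comp (measurable_addOut.comp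
      measurable_prodMk_left)).aestronglyMeasurable c (ae_of_all _ fun y => hc _)).integrable le_rfl
  have hi2 : Integrable (fun y => 1 + γ * h (addOut (z, y))) (K z) :=
    (integrable_const 1).add (hi.const_mul γ)
  rw [tilt, Kernel.withDensity_apply' _ (measurable_tilt_density hh γ), Measure.restrict_univ,
    ← ofReal_integral_eq_lintegral_ofReal hi2
      (ae_of_all _ fun y => (one_add_mul_mem hγ (hc _)).1),
    integral_add (integrable_const 1) (hi.const_mul γ), integral_const_mul, h0]
  simp

namespace Population

variable [StandardBorelSpace 𝒮] [Nonempty 𝒮]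

/-- The labelled conditional law of the outcome. -/
abbrev outKernel (p : Population 𝒳 𝒮) : Kernel (𝒳 × Bool × 𝒮) ℝ :=
  condDistrib outObs covTrtSurr p.labelled

lemma obsLaw_recombine_tilt (p : Population 𝒳 𝒮) {h : Obs 𝒳 𝒮 → ℝ} (hh : Measurable h) (γ : ℝ)
    [IsMarkovKernel (tilt p.outKernel h γ)] :
    (p.recombine (tilt p.outKernel h γ)).obsLaw
      = p.obsLaw.withDensity fun w => ENNReal.ofReal (1 + γ * h w) := by
  have : IsSFiniteKernel (p.outKernel.withDensity
      fun z y => ENNReal.ofReal (1 + γ * h (addOut (z, y)))) :=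
    inferInstanceAs (IsSFiniteKernel (tilt p.outKernel h γ))
  have hg : Measurable fun w => ENNReal.ofReal (1 + γ * h w) :=
    ((hh.const_mul γ).const_add 1).ennreal_ofReal
  rw [obsLaw_recombine, obsLaw_eq_map_compProd, ← Measure.map_withDensity_comp measurable_addOut hg,
    tilt, Measure.compProd_withDensity (measurable_tilt_density hh γ)]

open Classical in
/-- The submodel that tilts the conditional law of the outcome linearly by `h`. -/
def tiltPath (p : Population 𝒳 𝒮) (h : Obs 𝒳 𝒮 → ℝ) (γ : ℝ) : Population 𝒳 𝒮 :=
  -- The value γ = 0 is excluded because recombination may alter the joint law with the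
  -- counterfactual variables even without a tilt, whereas the path has to start at `p` itself.
  if hγ : γ ≠ 0 ∧ IsMarkovKernel (tilt p.outKernel h γ) then
    haveI := hγ.2
    p.recombine (tilt p.outKernel h γ)
  else p

lemma tiltPath_zero (p : Population 𝒳 𝒮) (h : Obs 𝒳 𝒮 → ℝ) : p.tiltPath h 0 = p := by
  simp [tiltPath]

lemma tiltPath_cases (p : Population 𝒳 𝒮) {h : Obs 𝒳 𝒮 → ℝ} (hh : Measurable h) {c γ : ℝ}
    (hc : ∀ w, |h w| ≤ c) (h0 : ∀ z, ∫ y, h (addOut (z, y)) ∂(p.outKernel z) = 0)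
    (hγ : |γ| * c ≤ 1) :
    (γ = 0 ∧ p.tiltPath h γ = p) ∨ ∃ _ : IsMarkovKernel (tilt p.outKernel h γ),
      p.tiltPath h γ = p.recombine (tilt p.outKernel h γ) := by
  rcases eq_or_ne γ 0 with rfl | hne
  · exact Or.inl ⟨rfl, p.tiltPath_zero h⟩
  · have hM := isMarkovKernel_tilt hh hc h0 hγ
    exact Or.inr ⟨hM, by rw [tiltPath, dif_pos ⟨hne, hM⟩]⟩

lemma obsLaw_tiltPath (p : Population 𝒳 𝒮) {h : Obs 𝒳 𝒮 → ℝ} (hh : Measurable h) {c γ : ℝ}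
    (hc : ∀ w, |h w| ≤ c) (h0 : ∀ z, ∫ y, h (addOut (z, y)) ∂(p.outKernel z) = 0)
    (hγ : |γ| * c ≤ 1) :
    (p.tiltPath h γ).obsLaw = p.obsLaw.withDensity fun w => ENNReal.ofReal (1 + γ * h w) := by
  rcases p.tiltPath_cases hh hc h0 hγ with ⟨rfl, e⟩ | ⟨_, e⟩
  · rw [e]
    simp [withDensity_const]
  · rw [e, obsLaw_recombine_tilt p hh]

lemma weightedResidual_tiltPath (p : Population 𝒳 𝒮) (h : Obs 𝒳 𝒮 → ℝ) (γ : ℝ) :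
    (p.tiltPath h γ).weightedResidual p = p.psi := by
  rw [tiltPath]
  split_ifs with hγ
  · have := hγ.2
    exact weightedResidual_recombine p _
  · rfl

lemma eventually_abs_mul_le_one (c : ℝ) : ∀ᶠ γ : ℝ in 𝓝 0, |γ| * c ≤ 1 := by
  have h1 : Continuous fun γ : ℝ => |γ| * c := by fun_prop
  have h2 := h1.tendsto 0
  simp only [abs_zero, zero_mul] at h2
  exact (h2.eventually (gt_mem_nhds one_pos)).mono fun _ h => h.le

lemma hasScore_tiltPath (p : Population 𝒳 𝒮) {h : Obs 𝒳 𝒮 → ℝ} (hh : Measurable h) {c : ℝ}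
    (hc : ∀ w, |h w| ≤ c) (h0 : ∀ z, ∫ y, h (addOut (z, y)) ∂(p.outKernel z) = 0) :
    Efficiency.HasScore (fun γ => (p.tiltPath h γ).obsLaw) h := by
  refine Efficiency.hasScore_of_eventually_withDensity hh hc ?_
  filter_upwards [eventually_abs_mul_le_one c] with γ hγ
  rw [p.obsLaw_tiltPath hh hc h0 hγ, tiltPath_zero]

/-- A square integrable function that is centred given `(X, T, S)` is approximated by bounded
ones. -/
lemma exists_bounded_centred_approx (p : Population 𝒳 𝒮) (hψ : MemLp p.psi 2 p.obsLaw) {δ : ℝ}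
    (hδ : 0 < δ) : ∃ h : Obs 𝒳 𝒮 → ℝ, Measurable h ∧ (∃ c, ∀ w, |h w| ≤ c) ∧
      (∀ z, ∫ y, h (addOut (z, y)) ∂(p.outKernel z) = 0) ∧
      ∫ w, (p.psi w - h w) ^ 2 ∂p.obsLaw < δ := by
  have hψm : Measurable p.psi := p.measurable_weightedResidual p
  obtain ⟨M, hM⟩ := ((Efficiency.tendsto_integral_sq_indicator_lt_abs hψ).eventually
    (gt_mem_nhds hδ)).exists
  set d : Obs 𝒳 𝒮 → ℝ := {w | (M : ℝ) < |p.psi w|}.indicator p.psi with hd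
  have hdm : Measurable d := hψm.indicator (measurableSet_lt measurable_const hψm.abs)
  set u : Obs 𝒳 𝒮 → ℝ := fun w => p.psi w - d w with hu
  have hum : Measurable u := hψm.sub hdm
  have hub : ∀ w, |u w| ≤ M := by
    intro w
    by_cases hw : (M : ℝ) < |p.psi w|
    · have : d w = p.psi w := Set.indicator_of_mem (s := {w | (M : ℝ) < |p.psi w|}) hw _
      simp [hu, this]
    · have : d w = 0 := Set.indicator_of_notMem (s := {w | (M : ℝ) < |p.psi w|}) hw _
      simpa [hu, this] using hw
  set a : 𝒳 × Bool × 𝒮 → ℝ := fun z => ∫ y, u (addOut (z, y)) ∂(p.outKernel z) with ha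
  have ham : Measurable a :=
    ((hum.comp measurable_addOut).stronglyMeasurable.integral_kernel_prod_right'
      (κ := p.outKernel)).measurable
  have hui : ∀ z, Integrable (fun y => u (addOut (z, y))) (p.outKernel z) := fun z =>
    (MemLp.of_bound (p := 1) (hum.comp (measurable_addOut.comp
      measurable_prodMk_left)).aestronglyMeasurable M (ae_of_all _ fun y => hub _)).integrable le_rfl
  have hab : ∀ z, |a z| ≤ M := fun z => by
    have h1 := norm_integral_le_of_norm_le_const (μ := p.outKernel z)
      (f := fun y => u (addOut (z, y))) (C := (M : ℝ)) (ae_of_all _ fun y => hub _)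
    simpa using h1
  have hdz : ∀ (z : 𝒳 × Bool × 𝒮) (y : ℝ), dropOut (addOut (z, y)) = z := fun _ _ => rfl
  -- Truncating ψ̃' destroys the centring; subtracting the conditional mean of the truncation
  -- restores it at every z and keeps boundedness.
  refine ⟨fun w => u w - a (dropOut w), hum.sub (ham.comp measurable_dropOut), ⟨M + M, fun w =>
    (abs_sub _ _).trans (add_le_add (hub w) (hab _))⟩, fun z => ?_, lt_of_le_of_lt ?_ hM⟩
  · simp only [hdz]
    rw [integral_sub (hui z) (integrable_const _)]
    simp [ha]
  · have hdL : MemLp d 2 p.obsLaw := hψ.mono hdm.aestronglyMeasurable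
      (ae_of_all _ fun w => norm_indicator_le_norm_self _ _)
    have haL : MemLp (fun w => a (dropOut w)) 2 p.obsLaw :=
      MemLp.of_bound (ham.comp measurable_dropOut).aestronglyMeasurable M
        (ae_of_all _ fun w => hab _)
    have e : ∀ w, p.psi w - (u w - a (dropOut w)) = d w + a (dropOut w) := fun w => by
      simp only [hu]; ring
    simp only [e]
    have i1 : Integrable (fun w => (d w + a (dropOut w)) ^ 2) p.obsLaw :=
      (hdL.add haL).integrable_sq
    have i2 : Integrable (fun w => d w ^ 2) p.obsLaw := hdL.integrable_sq
    have hz := p.ae_integral_psi hψ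
    rw [obsLaw_eq_map_compProd] at i1 i2 ⊢
    have j1 : Integrable (fun q => (d (addOut q) + a (dropOut (addOut q))) ^ 2)
        (p.labelled.map covTrtSurr ⊗ₘ p.outKernel) :=
      (integrable_map_measure i1.1 measurable_addOut.aemeasurable).1 i1
    have j2 : Integrable (fun q => d (addOut q) ^ 2)
        (p.labelled.map covTrtSurr ⊗ₘ p.outKernel) :=
      (integrable_map_measure i2.1 measurable_addOut.aemeasurable).1 i2
    rw [integral_map measurable_addOut.aemeasurable i1.1,
      integral_map measurable_addOut.aemeasurable i2.1, Measure.integral_compProd j1,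
      Measure.integral_compProd j2]
    refine integral_mono_ae j1.integral_compProd j2.integral_compProd ?_
    filter_upwards [hz] with z hz
    have hdmz : Measurable fun y => d (addOut (z, y)) :=
      hdm.comp (measurable_addOut.comp measurable_prodMk_left)
    -- Since ψ̃' is centred, the truncated part and the tail d have opposite conditional means. The
    -- error is thus d minus its conditional mean, whose conditional second moment is a variance and
    -- at most that of d.
    have haz : a z = -∫ y, d (addOut (z, y)) ∂(p.outKernel z) := by
      have e1 : ∀ y : ℝ, d (addOut (z, y)) = p.psi (addOut (z, y)) - u (addOut (z, y)) :=
        fun y => by simp only [hu]; ring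
      simp only [e1]
      rw [integral_sub hz.1 (hui z), hz.2, zero_sub, neg_neg]
    simp only [hdz, haz, ← sub_eq_add_neg]
    rw [← variance_eq_integral hdmz.aemeasurable]
    exact variance_le_expectation_sq hdmz.aestronglyMeasurable

variable [StandardBorelSpace 𝒳] {ε C : ℝ} {p : Population 𝒳 𝒮}

/-- The tilting factor is at most 2, so the first absolute moment of each potential outcome at most
doubles. -/
lemma Admissible.recombine_tilt (hε : 0 < ε) (hp : p.Admissible ε C) {h : Obs 𝒳 𝒮 → ℝ}
    (hh : Measurable h) {c γ : ℝ} (hc : ∀ w, |h w| ≤ c) (hγ : |γ| * c ≤ 1)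
    [IsMarkovKernel (tilt p.outKernel h γ)] :
    (p.recombine (tilt p.outKernel h γ)).Admissible ε C := by
  refine hp.recombine hε _ fun t => ?_
  have hK1 : Measurable fun z : 𝒳 × 𝒮 => ∫⁻ y, ‖y‖ₑ ∂(p.outKernel (inArm t z)) :=
    (measurable_enorm.lintegral_kernel (κ := p.outKernel)).comp (measurable_inArm t)
  have hf : Measurable fun q : (𝒳 × 𝒮) × ℝ => ‖q.2‖ₑ := by fun_prop
  have hfin : ∫⁻ z, ∫⁻ y, ‖y‖ₑ ∂(p.outKernel (inArm t z))
      ∂(p.law.map fun v => (cov v, surr t v)) < ∞ := by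
    have h1 := congrArg (fun μ => ∫⁻ q, ‖q.2‖ₑ ∂μ) (hp.map_out_eq_compProd hε t)
    beta_reduce at h1
    rw [lintegral_map hf (by fun_prop), Measure.lintegral_compProd hf] at h1
    simp only [Kernel.comap_apply] at h1
    rw [← h1]
    exact (hp.integrable_out t).2
  refine lt_of_le_of_lt ?_ (ENNReal.mul_lt_top (ENNReal.ofNat_lt_top (n := 2)) hfin)
  rw [← lintegral_const_mul _ hK1]
  refine lintegral_mono fun z => ?_
  rw [tilt, Kernel.lintegral_withDensity _ (measurable_tilt_density hh γ) _ measurable_enorm,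
    ← lintegral_const_mul _ measurable_enorm]
  refine lintegral_mono fun y => mul_le_mul' ?_ le_rfl
  rw [← ENNReal.ofReal_ofNat]
  exact ENNReal.ofReal_le_ofReal (one_add_mul_mem hγ (hc _)).2

/-- Along the tilt the weighted residual remains ψ̃', and the observed law has density at most 2
with respect to the original one; twice the second moment of ψ̃' is therefore a local bound. -/
lemma Admissible.tiltPath_mem_regularSubmodels (hε : 0 < ε) (hp : p.Admissible ε C)
    (hψ : MemLp p.psi 2 p.obsLaw) {h : Obs 𝒳 𝒮 → ℝ} (hh : Measurable h) {c : ℝ}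
    (hc : ∀ w, |h w| ≤ c) (h0 : ∀ z, ∫ y, h (addOut (z, y)) ∂(p.outKernel z) = 0) :
    p.tiltPath h ∈ regularSubmodels (model ε C p.covTrtSurrLaw) p := by
  refine ⟨p.tiltPath_zero h, ?_, ?_⟩
  · filter_upwards [eventually_abs_mul_le_one c] with γ hγ
    rcases p.tiltPath_cases hh hc h0 hγ with ⟨-, e⟩ | ⟨_, e⟩
    · rw [e]
      exact ⟨hp, rfl⟩
    · rw [e]
      exact ⟨hp.recombine_tilt hε hh hc hγ, p.map_covTrtSurr_law_recombine _⟩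
  · have hm : Measurable fun w => ENNReal.ofReal (p.psi w ^ 2) :=
      ((p.measurable_weightedResidual p).pow_const 2).ennreal_ofReal
    have hfin : ∫⁻ w, ENNReal.ofReal (p.psi w ^ 2) ∂p.obsLaw ≠ ∞ := by
      have h1 := hψ.integrable_sq.2
      rw [hasFiniteIntegral_iff_ofReal (ae_of_all _ fun _ => sq_nonneg _)] at h1
      exact h1.ne
    refine ⟨(2 * ∫⁻ w, ENNReal.ofReal (p.psi w ^ 2) ∂p.obsLaw).toNNReal, ?_⟩
    filter_upwards [eventually_abs_mul_le_one c] with γ hγ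
    rw [ENNReal.coe_toNNReal (ENNReal.mul_ne_top ENNReal.ofNat_ne_top hfin),
      weightedResidual_tiltPath, p.obsLaw_tiltPath hh hc h0 hγ,
      lintegral_withDensity_eq_lintegral_mul _ ((hh.const_mul γ).const_add 1).ennreal_ofReal hm,
      ← lintegral_const_mul _ hm]
    refine lintegral_mono fun w => ?_
    rw [Pi.mul_apply]
    refine mul_le_mul' ?_ le_rfl
    rw [← ENNReal.ofReal_ofNat]
    exact ENNReal.ofReal_le_ofReal (one_add_mul_mem hγ (hc _)).2

end Population

end Surrogate

end

/-! ### The efficient influence function and the efficiency bound. -/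

theorem theorem10 {𝒳 𝒮 : Type*} [MeasurableSpace 𝒳] [StandardBorelSpace 𝒳]
    [MeasurableSpace 𝒮] [StandardBorelSpace 𝒮] [Nonempty 𝒮]
    (ε C : ℝ) (hε : 0 < ε) (hε' : ε < 1 / 2) (hC : 0 < C)
    (p : Surrogate.Population 𝒳 𝒮) (hp : p.Admissible ε C)
    (hψ : MemLp p.psi 2 p.obsLaw) :
    Efficiency.IsEfficientInfluenceFunction
      Surrogate.Population.obsLaw Surrogate.Population.ate p
      (Surrogate.Population.regularSubmodels
        (Surrogate.Population.model ε C p.covTrtSurrLaw) p) p.psi ∧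
    Efficiency.efficiencyLowerBound
      Surrogate.Population.obsLaw Surrogate.Population.ate p
      (Surrogate.Population.regularSubmodels
        (Surrogate.Population.model ε C p.covTrtSurrLaw) p) =
      ENNReal.ofReal (∫ w, p.psi w ^ 2 ∂p.obsLaw) := by
  refine (hp.isInfluenceFunction_psi hε hψ).efficient_of_approx (fun path h => h.1)
    fun δ hδ => ?_
  obtain ⟨h, hh, ⟨c, hc⟩, h0, hlt⟩ := p.exists_bounded_centred_approx hψ hδ
  exact ⟨h, ⟨p.tiltPath h, hp.tiltPath_mem_regularSubmodels hε hψ hh hc h0,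
    p.hasScore_tiltPath hh hc h0⟩, hlt⟩
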